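/- **Setting.** For $k\ge 1$ let $[k]$ be a set of $k$ elements. A channel from $[k]$ to a countable set $\mathcal Y$ is a matrix $T=(T(y,x))_{y\in\mathcal Y,\,x\in[k]}$ whose columns are probability distributions on $\mathcal Y$; $Tp$ is the law of the output when the input has law $p$, and $T_2T_1$ is $T_1$ followed by $T_2$. For real $\varepsilon\ge 0$, $T$ is $\varepsilon$-LDP if $T(y,x)\le e^{\varepsilon}\,T(y,x')$ for all $x,x'\in[k]$, $y\in\mathcal Y$. For a set $\mathcal C$ of channels from $[k]$ to $\mathcal Y$ and distributions $p,q$ on $[k]$, the sample complexity of testing $p$ against $q$ under $\mathcal C$ is the least $n$ for which there are $T_1,\dots,T_n\in\mathcal C$ and a test $\phi:\mathcal Y^n\to\{\text{“}p\text{”},\text{“}q\text{”}\}$ with $$\Pr_{Y\sim\bigotimes_i T_ip}\big[\phi(Y)=\text{“}q\text{”}\big]+\Pr_{Y\sim\bigotimes_i T_iq}\big[\phi(Y)=\text{“}p\text{”}\big]\le 0.1,$$ and $\infty$ if there is none. Write $n^*(p,q,\varepsilon)$ when $\mathcal C$ is the set of all $\varepsilon$-LDP channels from $[k]$ to $\mathbb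 N$, and $n^*(p,q,\varepsilon,\ell)$ when $\mathcal C$ is the set of all $\varepsilon$-LDP channels from $[k]$ to $[\ell]$. A channel from $[k]$ to $[m]$ is a threshold channel (for $p,q$) if it is the deterministic channel of a map $f:[k]\to[m]$ such that, whenever $\frac{p(u)}{q(u)}<\frac{p(v)}{q(v)}$ and $f(u)=f(v)$, every $w$ with $\frac{p(w)}{q(w)}$ strictly between these two ratios satisfies $f(w)=f(u)$. (Ratios are in $[0,\infty]$, with $0/0=0$.) Algorithms are programs for a real RAM: exact real arithmetic $+,-,\times,\div$ and comparison of reals, and addition, truncated subtraction and comparison of natural numbers, which also serve as array indices; every operation costs one step. **Theorem.** There are a single real RAM program and universal constants $A,C>0$ such that the following holds for all integers $k\ge1$ and $\ell>1$, all real $\varepsilon\ge 0$, and all distributions $p,q$ on $[k]$. On input $(k,\ell,e^{\varepsilon},p,q)$ the program halts after at most $$A\,\big(k^{\ell^2}\cdot 2^{\ell^3\log \ell}\big)^{A}$$ steps and outputs an $\varepsilon$-LDP channel $T$ from $[k]$ to $[\ell]$ such that: 1. If $N$ is the sample complexity of testing $p$ against $q$ when every user uses the channel $T$ (that is, under $\mathcal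 C=\{T\}$), then $N\asymp n^*(p,q,\varepsilon,\ell)$, namely $N\le C\,n^*(p,q,\varepsilon,\ell)$ and $n^*(p,q,\varepsilon,\ell)\le C\,N$ (in $\mathbb N\cup\{\infty\}$). 2. If $n^*(p,q,\varepsilon)<\infty$, then $N<\infty$ and $$N\le C\, n^*(p,q,\varepsilon)\left(1+\frac{\log n^*(p,q,\varepsilon)}{\ell}\right).$$ 3. $T=T_2T_1$ for some threshold channel $T_1$ from $[k]$ to $[2\ell^2]$ and some $\varepsilon$-LDP channel $T_2$ from $[2\ell^2]$ to $[\ell]$. -/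

import Mathlib

open scoped ENNReal Matrix

/-! ## Channels, local differential privacy, sample complexity

A channel from `X` to `Y` is a column-stochastic matrix `T : Matrix Y X ℝ`, where `T y x` is the
probability of the output `y` on the input `x`.  Then `T *ᵥ p` is the law of the output when the
input has law `p`, and `T₂ * T₁` is the channel `T₁` followed by the channel `T₂`. -/

section Channels

variable {X Y : Type}

/-- `T` is a channel from `X` to the countable set `Y`: every column is a probability
distribution on `Y`. -/
def IsChannel (T : Matrix Y X ℝ) : Prop :=
  (∀ y x, 0 ≤ T y x) ∧ ∀ x, HasSum (fun y => T y x) 1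

/-- The set of all `ε`-locally differentially private channels from `X` to `Y`. -/
def ldpChannels (X Y : Type) (ε : ℝ) : Set (Matrix Y X ℝ) :=
  {T | IsChannel T ∧ ∀ x x' y, T y x ≤ Real.exp ε * T y x'}

/-- The probability that the outputs `(Y₁, …, Yₙ)` lie in `S`, when user `i` observes `Xᵢ ∼ r`
(i.i.d.) and sends `Yᵢ = Tᵢ(Xᵢ)`, independently; the law of `Yᵢ` is `Tᵢ r`. -/
noncomputable def outputProb [Fintype X] {n : ℕ} (T : Fin n → Matrix Y X ℝ) (r : X → ℝ)
    (S : Set (Fin n → Y)) : ℝ≥0∞ :=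
  ∑' y : S, ∏ i, ENNReal.ofReal ((T i *ᵥ r) (y.1 i))

/-- With `n` users who choose their channels from `C`, some choice of channels and some test `φ`
(`true` stands for the answer `p`, `false` for the answer `q`) tell `p` from `q` with the sum of
the two error probabilities at most `0.1`. -/
def SolvableWith [Fintype X] (C : Set (Matrix Y X ℝ)) (p q : X → ℝ) (n : ℕ) : Prop :=
  ∃ (R : Fin n → Matrix Y X ℝ) (φ : (Fin n → Y) → Bool), (∀ i, R i ∈ C) ∧
    outputProb R p {y | φ y ≠ true} + outputProb R q {y | φ y ≠ false} ≤ 1 / 10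

/-- The sample complexity of simple binary hypothesis testing between `p` and `q` under the
channel constraint `C`: the least `n` that suffices, and `⊤` if there is none. -/
noncomputable def sampleComplexity [Fintype X] (C : Set (Matrix Y X ℝ)) (p q : X → ℝ) : ℕ∞ :=
  ⨅ (n : ℕ) (_ : SolvableWith C p q n), (n : ℕ∞)

/-- `n*(p, q, ε)`: the channels are all `ε`-LDP channels with outputs in `ℕ`. -/
noncomputable def nStarLDP [Fintype X] (p q : X → ℝ) (ε : ℝ) : ℕ∞ :=
  sampleComplexity (ldpChannels X ℕ ε) p q

/-- `n*(p, q, ε, ℓ)`: the channels are all `ε`-LDP channels with outputs in a set of size `ℓ`. -/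
noncomputable def nStarLDPComm [Fintype X] (p q : X → ℝ) (ε : ℝ) (ℓ : ℕ) : ℕ∞ :=
  sampleComplexity (ldpChannels X (Fin ℓ) ε) p q

/-- The likelihood ratio `p(x) / q(x)` in `[0, ∞]` (`0 / 0 = 0`, and `a / 0 = ∞` for `a > 0`). -/
noncomputable def likelihoodRatio (p q : X → ℝ) (x : X) : ℝ≥0∞ :=
  ENNReal.ofReal (p x) / ENNReal.ofReal (q x)

/-- The deterministic channel of a map `f`. -/
def detChannel [DecidableEq Y] (f : X → Y) : Matrix Y X ℝ :=
  Matrix.of fun y x => if y = f x then 1 else 0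

/-- `T` is a deterministic threshold channel with respect to the likelihood ratios of `p, q`. -/
def IsThresholdChannel [DecidableEq Y] (p q : X → ℝ) (T : Matrix Y X ℝ) : Prop :=
  ∃ f : X → Y, T = detChannel f ∧
    ∀ u v, likelihoodRatio p q u < likelihoodRatio p q v → f u = f v →
      ∀ w, likelihoodRatio p q w ∈ Set.Ioo (likelihoodRatio p q u) (likelihoodRatio p q v) →
        f w = f u

end Channels

/-! ## Real RAM with a step count

Memory consists of named one-dimensional arrays of natural numbers and of real numbers.  A program
is a finite text, so it names finitely many arrays.  Natural numbers serve for addressing and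
counting and allow only addition, truncated subtraction and comparison (no multiplication or
division at unit cost); real numbers allow exact field operations and comparison (no rounding, no
roots, no exponentials), and the only real constants of a program are integers.  Every operation,
memory access and comparison costs one step. -/

namespace RealRAM

/-- `nat a i` and `real a i` are the `i`-th entries of the `a`-th array of each kind. -/
structure Memory where
  nat : ℕ → ℕ → ℕ
  real : ℕ → ℕ → ℝ

/-- Expressions with values in the natural numbers. -/
inductive NatExpr where
  | const (c : ℕ)
  | get (a : ℕ) (i : NatExpr)
  | add (e f : NatExpr)
  | sub (e f : NatExpr)

/-- Value of a natural-number expression. -/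
def NatExpr.eval (m : Memory) : NatExpr → ℕ
  | const c => c
  | get a i => m.nat a (i.eval m)
  | add e f => e.eval m + f.eval m
  | sub e f => e.eval m - f.eval m

/-- Number of steps to evaluate a natural-number expression. -/
def NatExpr.cost : NatExpr → ℕ
  | const _ => 1
  | get _ i => i.cost + 1
  | add e f => e.cost + f.cost + 1
  | sub e f => e.cost + f.cost + 1

/-- Expressions with values in the real numbers. -/
inductive RealExpr where
  | const (c : ℤ)
  | get (a : ℕ) (i : NatExpr)
  | add (e f : RealExpr)
  | sub (e f : RealExpr)
  | mul (e f : RealExpr)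
  | div (e f : RealExpr)

/-- Value of a real expression (a division by zero returns zero). -/
noncomputable def RealExpr.eval (m : Memory) : RealExpr → ℝ
  | const c => c
  | get a i => m.real a (i.eval m)
  | add e f => e.eval m + f.eval m
  | sub e f => e.eval m - f.eval m
  | mul e f => e.eval m * f.eval m
  | div e f => e.eval m / f.eval m

/-- Number of steps to evaluate a real expression. -/
def RealExpr.cost : RealExpr → ℕ
  | const _ => 1
  | get _ i => i.cost + 1
  | add e f => e.cost + f.cost + 1
  | sub e f => e.cost + f.cost + 1
  | mul e f => e.cost + f.cost + 1
  | div e f => e.cost + f.cost + 1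

/-- Comparisons. -/
inductive Test where
  | natLt (e f : NatExpr)
  | realLt (e f : RealExpr)

/-- Truth of a comparison. -/
def Test.Holds (m : Memory) : Test → Prop
  | natLt e f => e.eval m < f.eval m
  | realLt e f => e.eval m < f.eval m

/-- Number of steps to evaluate a comparison. -/
def Test.cost : Test → ℕ
  | natLt e f => e.cost + f.cost + 1
  | realLt e f => e.cost + f.cost + 1

/-- Memory after writing `v` into entry `i` of the natural-number array `a`. -/
def Memory.setNat (m : Memory) (a i v : ℕ) : Memory where
  nat := fun b j => if b = a ∧ j = i then v else m.nat b j
  real := m.real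

/-- Memory after writing `v` into entry `i` of the real array `a`. -/
noncomputable def Memory.setReal (m : Memory) (a i : ℕ) (v : ℝ) : Memory where
  nat := m.nat
  real := fun b j => if b = a ∧ j = i then v else m.real b j

/-- Programs: assignments to array entries, sequencing, branching and while-loops. -/
inductive Prog where
  | skip
  | setNat (a : ℕ) (i e : NatExpr)
  | setReal (a : ℕ) (i : NatExpr) (e : RealExpr)
  | seq (P Q : Prog)
  | ite (b : Test) (P Q : Prog)
  | loop (b : Test) (P : Prog)

/-- `Exec P m m' t`: started in memory `m`, the program `P` halts in memory `m'` after exactly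
`t` steps. -/
inductive Exec : Prog → Memory → Memory → ℕ → Prop where
  | skip (m : Memory) : Exec .skip m m 1
  | setNat (m : Memory) (a : ℕ) (i e : NatExpr) :
      Exec (.setNat a i e) m (m.setNat a (i.eval m) (e.eval m)) (i.cost + e.cost + 1)
  | setReal (m : Memory) (a : ℕ) (i : NatExpr) (e : RealExpr) :
      Exec (.setReal a i e) m (m.setReal a (i.eval m) (e.eval m)) (i.cost + e.cost + 1)
  | seq {P Q : Prog} {m₁ m₂ m₃ : Memory} {s t : ℕ} :
      Exec P m₁ m₂ s → Exec Q m₂ m₃ t → Exec (.seq P Q) m₁ m₃ (s + t)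
  | iteTrue {b : Test} {P Q : Prog} {m m' : Memory} {t : ℕ} :
      b.Holds m → Exec P m m' t → Exec (.ite b P Q) m m' (b.cost + t)
  | iteFalse {b : Test} {P Q : Prog} {m m' : Memory} {t : ℕ} :
      ¬ b.Holds m → Exec Q m m' t → Exec (.ite b P Q) m m' (b.cost + t)
  | loopTrue {b : Test} {P : Prog} {m₁ m₂ m₃ : Memory} {s t : ℕ} :
      b.Holds m₁ → Exec P m₁ m₂ s → Exec (.loop b P) m₂ m₃ t →
      Exec (.loop b P) m₁ m₃ (b.cost + s + t)
  | loopFalse {b : Test} {P : Prog} {m : Memory} :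
      ¬ b.Holds m → Exec (.loop b P) m m b.cost

/-- Initial memory on the input `(k, ℓ, e^ε, p, q)`: entries 0 and 1 of natural-number array 0 hold
`k` and `ℓ`, entry 0 of real array 0 holds `e^ε`, real arrays 1 and 2 hold `p` and `q`, and every
other entry is 0. -/
noncomputable def inputMemory (k ℓ : ℕ) (ε : ℝ) (p q : Fin k → ℝ) : Memory where
  nat := fun a i => if a = 0 ∧ i = 0 then k else if a = 0 ∧ i = 1 then ℓ else 0
  real := fun a i =>
    if a = 0 ∧ i = 0 then Real.exp ε
    else if h : i < k then
      if a = 1 then p ⟨i, h⟩ else if a = 2 then q ⟨i, h⟩ else 0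
    else 0

/-- The `ℓ × k` matrix that a final memory holds, row by row, in real array 3. -/
def outputMatrix (k ℓ : ℕ) (m : Memory) : Matrix (Fin ℓ) (Fin k) ℝ :=
  Matrix.of fun r c => m.real 3 (r.val * k + c.val)

end RealRAM

/-! Write `D` for the triangular discrimination of the two output laws of a channel. The Hellinger
affinity multiplies over independent users and lies between `1 - D / 2` and `1 - D / 4`. Hence the
sample complexity under a set of channels is, up to constants, the inverse of the largest `D` in the
set (`exists_triDisc_ge_of_solvableWith`, `solvableWith_singleton`), and it suffices to find a
private channel whose `D` is nearly maximal.

Put `L = e^ε - 1`, `μ = p + q` and `a = (p - q) / (p + q)`. The candidates are randomized responses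
on `s` intervals of the likelihood ratio plus one answer for the rest, with `s = min (ℓ - 1) (⌊2L⌋ +
1)`. Each interval `S` contributes `L² / (s + e^ε)` times `clusterValue`, that is, `(p(S) - q(S))² /
(2 + L μ(S))`. Let `O` be the largest total value. The program finds it by trying all `k ^ (2s)`
choices of end points, and `min 1 L * L * O ≤ 5 D` for the channel found (`clusters_le_triDisc`).

Conversely, `O` controls every private channel. Subtracting from a row its minimum `m` leaves `0 ≤ e
≤ L m`, and the row contributes `(∑ e a μ)² / (2m + ∑ e μ)` to `D`. Take the part `a > 0`; the part
`a < 0` is symmetric. Cut at the height `t` above which `a` has mass about `1 / L`, and split the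
rest into dyadic levels of `a`. The top and the levels of mass below `1 / L` together are worth no
more than two intervals. Among the heavy levels a geometric-series inequality
(`geometric_square_le`) lets each row pay for a single level (`row_le`), and the value of a heavy
level is comparable to that of a cluster (`LevelFamily.value_le`). There are at most `2L` heavy
levels, and no more levels are used than there are rows, so `ℓ` outputs cost a constant factor. With
countably many outputs, levels beyond about `log n` are negligible because `a` is small there. The
remaining `K ≈ log n` levels exceed `s` by a factor of order at most `1 + K / (ℓ - 1)`, which gives
the logarithmic loss.

The factorization holds because the cluster of a point depends only on the number of end points that
precede it, which is monotone in the likelihood ratio (`exists_threshold_factorization`). -/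

/-! ## Triangular discrimination, Hellinger affinity and sample complexity -/

section Testing

variable {X Y : Type}

/-- The triangular discrimination of two functions on `Y`. -/
noncomputable def triDisc (u v : Y → ℝ) : ℝ := ∑' y, (u y - v y) ^ 2 / (u y + v y)

/-- The Hellinger affinity of two functions on `Y`. -/
noncomputable def affinity (u v : Y → ℝ) : ℝ≥0∞ := ∑' y, ENNReal.ofReal √(u y * v y)

/-- `u` is a probability distribution on `Y`. -/
def IsDist (u : Y → ℝ) : Prop := (∀ y, 0 ≤ u y) ∧ HasSum u 1

lemma IsChannel.isDist_mulVec [Fintype X] {T : Matrix Y X ℝ} (hT : IsChannel T) {p : X → ℝ}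
    (hp : p ∈ stdSimplex ℝ X) : IsDist (T *ᵥ p) := by
  refine ⟨fun y => Finset.sum_nonneg fun x _ => mul_nonneg (hT.1 y x) (hp.1 x), ?_⟩
  have h := hasSum_sum (s := Finset.univ) fun x _ => (hT.2 x).mul_right (p x)
  simp only [one_mul, hp.2] at h
  exact h

lemma IsDist.tsum_ofReal {u : Y → ℝ} (hu : IsDist u) : ∑' y, ENNReal.ofReal (u y) = 1 := by
  rw [← ENNReal.ofReal_tsum_of_nonneg hu.1 hu.2.summable, hu.2.tsum_eq, ENNReal.ofReal_one]

lemma tsum_pi_prod (n : ℕ) (g : Fin n → Y → ℝ≥0∞) :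
    ∑' y : Fin n → Y, ∏ i, g i (y i) = ∏ i, ∑' y, g i y := by
  induction n with
  | zero => simp
  | succ n ih =>
    rw [← (Fin.consEquiv (fun _ => Y)).tsum_eq, ENNReal.tsum_prod', Fin.prod_univ_succ,
      ← ih fun i => g i.succ]
    simp [Fin.consEquiv, Fin.prod_univ_succ, ENNReal.tsum_mul_left, ENNReal.tsum_mul_right]

lemma sq_div_le {u v : ℝ} (hu : 0 ≤ u) (hv : 0 ≤ v) : (u - v) ^ 2 / (u + v) ≤ u + v := by
  apply div_le_of_le_mul₀ <;> nlinarith [mul_nonneg hu hv]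

lemma summable_triDisc {u v : Y → ℝ} (hu : IsDist u) (hv : IsDist v) :
    Summable fun y => (u y - v y) ^ 2 / (u y + v y) :=
  Summable.of_nonneg_of_le
    (fun y => div_nonneg (sq_nonneg _) (add_nonneg (hu.1 y) (hv.1 y)))
    (fun y => sq_div_le (hu.1 y) (hv.1 y)) (hu.2.summable.add hv.2.summable)

lemma triDisc_nonneg {u v : Y → ℝ} (hu : ∀ y, 0 ≤ u y) (hv : ∀ y, 0 ≤ v y) : 0 ≤ triDisc u v :=
  tsum_nonneg fun y => div_nonneg (sq_nonneg _) (add_nonneg (hu y) (hv y))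

lemma triDisc_le_two {u v : Y → ℝ} (hu : IsDist u) (hv : IsDist v) : triDisc u v ≤ 2 := by
  have h := (summable_triDisc hu hv).tsum_le_tsum (fun y => sq_div_le (hu.1 y) (hv.1 y))
    (hu.2.summable.add hv.2.summable)
  rw [(hu.2.add hv.2).tsum_eq] at h
  norm_num at h
  exact h

/-- The right side is the average of the arithmetic mean `(u + v) / 2` and the harmonic mean `2uv /
(u + v)`, whose geometric mean is `√(uv)`. -/
lemma sqrt_mul_le {u v : ℝ} (hu : 0 ≤ u) (hv : 0 ≤ v) :
    √(u * v) ≤ (u + v) / 2 - (u - v) ^ 2 / (u + v) / 4 := by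
  rcases (add_nonneg hu hv).eq_or_lt with h | h
  · have h1 : u = 0 := by linarith
    have h2 : v = 0 := by linarith
    simp [h1, h2]
  · have h1 : (u + v) / 2 - (u - v) ^ 2 / (u + v) / 4
        = ((u + v) ^ 2 + 4 * (u * v)) / (4 * (u + v)) := by
      field_simp
      ring
    rw [h1]
    apply Real.sqrt_le_iff.2 ⟨by positivity, ?_⟩
    rw [div_pow, le_div_iff₀ (by positivity)]
    nlinarith [sq_nonneg ((u + v) ^ 2 - 4 * (u * v))]

/-- The left side is the harmonic mean `2uv / (u + v)`. -/
lemma le_sqrt_mul {u v : ℝ} (hu : 0 ≤ u) (hv : 0 ≤ v) :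
    (u + v) / 2 - (u - v) ^ 2 / (u + v) / 2 ≤ √(u * v) := by
  rcases (add_nonneg hu hv).eq_or_lt with h | h
  · have h1 : u = 0 := by linarith
    have h2 : v = 0 := by linarith
    simp [h1, h2]
  · have h1 : (u + v) / 2 - (u - v) ^ 2 / (u + v) / 2 = 2 * (u * v) / (u + v) := by
      field_simp
      ring
    rw [h1]
    apply Real.le_sqrt_of_sq_le
    rw [div_pow, div_le_iff₀ (by positivity)]
    nlinarith [mul_nonneg (mul_nonneg hu hv) (sq_nonneg (u - v))]

lemma summable_sqrt_mul {u v : Y → ℝ} (hu : IsDist u) (hv : IsDist v) :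
    Summable fun y => √(u y * v y) := by
  refine Summable.of_nonneg_of_le (fun _ => Real.sqrt_nonneg _) (fun y => ?_)
    (hu.2.summable.add hv.2.summable)
  have h := sqrt_mul_le (hu.1 y) (hv.1 y)
  have := div_nonneg (sq_nonneg (u y - v y)) (add_nonneg (hu.1 y) (hv.1 y))
  linarith [hu.1 y, hv.1 y]

lemma affinity_eq {u v : Y → ℝ} (hu : IsDist u) (hv : IsDist v) :
    affinity u v = ENNReal.ofReal (∑' y, √(u y * v y)) :=
  (ENNReal.ofReal_tsum_of_nonneg (fun _ => Real.sqrt_nonneg _) (summable_sqrt_mul hu hv)).symm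

lemma hasSum_half_sub {u v : Y → ℝ} (hu : IsDist u) (hv : IsDist v) (c : ℝ) :
    HasSum (fun y => (u y + v y) / 2 - (u y - v y) ^ 2 / (u y + v y) / c)
      (1 - triDisc u v / c) := by
  have h := ((hu.2.add hv.2).div_const 2).sub ((summable_triDisc hu hv).hasSum.div_const c)
  norm_num at h
  exact h

lemma affinity_le {u v : Y → ℝ} (hu : IsDist u) (hv : IsDist v) :
    affinity u v ≤ ENNReal.ofReal (1 - triDisc u v / 4) := by
  rw [affinity_eq hu hv]
  exact ENNReal.ofReal_le_ofReal
    (hasSum_le (fun y => sqrt_mul_le (hu.1 y) (hv.1 y)) (summable_sqrt_mul hu hv).hasSum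
      (hasSum_half_sub hu hv 4))

lemma le_affinity {u v : Y → ℝ} (hu : IsDist u) (hv : IsDist v) :
    ENNReal.ofReal (1 - triDisc u v / 2) ≤ affinity u v := by
  rw [affinity_eq hu hv]
  exact ENNReal.ofReal_le_ofReal
    (hasSum_le (fun y => le_sqrt_mul (hu.1 y) (hv.1 y)) (hasSum_half_sub hu hv 2)
      (summable_sqrt_mul hu hv).hasSum)

lemma prod_ofReal_sqrt {n : ℕ} {u v : Fin n → ℝ} (hu : ∀ i, 0 ≤ u i) (hv : ∀ i, 0 ≤ v i) :
    ∏ i, ENNReal.ofReal √(u i * v i) = ENNReal.ofReal √((∏ i, u i) * ∏ i, v i) := by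
  rw [← ENNReal.ofReal_prod_of_nonneg fun i _ => Real.sqrt_nonneg _, ← Finset.prod_mul_distrib,
    Real.sqrt_eq_rpow, ← Real.finsetProd_rpow _ _ fun i _ => mul_nonneg (hu i) (hv i)]
  simp [Real.sqrt_eq_rpow]

lemma two_mul_sqrt_le {u v : ℝ} (hu : 0 ≤ u) (hv : 0 ≤ v) : 2 * √(u * v) ≤ 3 * u + v / 3 := by
  have h : √(u * v) ≤ (3 * u + v / 3) / 2 := by
    apply Real.sqrt_le_iff.2 ⟨by positivity, ?_⟩
    nlinarith [sq_nonneg (3 * u - v / 3)]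
  linarith

lemma two_mul_ofReal_sqrt_le {u v : ℝ} (hu : 0 ≤ u) (hv : 0 ≤ v) :
    2 * ENNReal.ofReal √(u * v) ≤ 3 * ENNReal.ofReal u + ENNReal.ofReal v / 3 := by
  have h := ENNReal.ofReal_le_ofReal (two_mul_sqrt_le hu hv)
  rw [ENNReal.ofReal_mul (by norm_num), ENNReal.ofReal_add (by positivity) (by positivity),
    ENNReal.ofReal_mul (by norm_num), ENNReal.ofReal_div_of_pos (by norm_num)] at h
  simpa using h

/-- At each outcome `2√(PQ)` is at most three times the probability under the hypothesis that the
test rejects there plus a third of the other. The unequal weights bring the total down to `29 / 30 <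
1`; equal weights would only give `2`. -/
lemma prod_affinity_le_of_error_le [Fintype X] {n : ℕ} {R : Fin n → Matrix Y X ℝ}
    (hR : ∀ i, IsChannel (R i)) {p q : X → ℝ} (hp : p ∈ stdSimplex ℝ X) (hq : q ∈ stdSimplex ℝ X)
    {φ : (Fin n → Y) → Bool}
    (h : outputProb R p {y | φ y ≠ true} + outputProb R q {y | φ y ≠ false} ≤ 1 / 10) :
    2 * ∏ i, affinity (R i *ᵥ p) (R i *ᵥ q) ≤ 3 * (1 / 10) + 1 / 3 + 1 / 3 := by
  classical
  have hP := fun i => (hR i).isDist_mulVec hp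
  have hQ := fun i => (hR i).isDist_mulVec hq
  set P : (Fin n → Y) → ℝ≥0∞ := fun y => ∏ i, ENNReal.ofReal ((R i *ᵥ p) (y i)) with hPdef
  set Q : (Fin n → Y) → ℝ≥0∞ := fun y => ∏ i, ENNReal.ofReal ((R i *ᵥ q) (y i)) with hQdef
  have hP1 : ∑' y, P y = 1 := by
    rw [hPdef, tsum_pi_prod n fun i y => ENNReal.ofReal ((R i *ᵥ p) y)]
    simp [(hP _).tsum_ofReal]
  have hQ1 : ∑' y, Q y = 1 := by
    rw [hQdef, tsum_pi_prod n fun i y => ENNReal.ofReal ((R i *ᵥ q) y)]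
    simp [(hQ _).tsum_ofReal]
  have e1 : outputProb R p {y | φ y ≠ true} = ∑' y, {y | φ y ≠ true}.indicator P y :=
    tsum_subtype {y | φ y ≠ true} P
  have e2 : outputProb R q {y | φ y ≠ false} = ∑' y, {y | φ y ≠ false}.indicator Q y :=
    tsum_subtype {y | φ y ≠ false} Q
  rw [e1, e2] at h
  simp only [affinity]
  rw [← tsum_pi_prod, ← ENNReal.tsum_mul_left]
  calc ∑' y : Fin n → Y, 2 * ∏ i, ENNReal.ofReal √((R i *ᵥ p) (y i) * (R i *ᵥ q) (y i))
      ≤ ∑' y, (3 * ({y | φ y ≠ true}.indicator P y + {y | φ y ≠ false}.indicator Q y)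
          + P y / 3 + Q y / 3) := by
        refine ENNReal.tsum_le_tsum fun y => ?_
        have hu : ∀ i, 0 ≤ (R i *ᵥ p) (y i) := fun i => (hP i).1 _
        have hv : ∀ i, 0 ≤ (R i *ᵥ q) (y i) := fun i => (hQ i).1 _
        rw [prod_ofReal_sqrt hu hv]
        have hPy : P y = ENNReal.ofReal (∏ i, (R i *ᵥ p) (y i)) :=
          (ENNReal.ofReal_prod_of_nonneg fun i _ => hu i).symm
        have hQy : Q y = ENNReal.ofReal (∏ i, (R i *ᵥ q) (y i)) :=
          (ENNReal.ofReal_prod_of_nonneg fun i _ => hv i).symm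
        have h1 := two_mul_ofReal_sqrt_le (Finset.prod_nonneg fun i (_ : i ∈ Finset.univ) => hu i)
          (Finset.prod_nonneg fun i (_ : i ∈ Finset.univ) => hv i)
        have h2 := two_mul_ofReal_sqrt_le (Finset.prod_nonneg fun i (_ : i ∈ Finset.univ) => hv i)
          (Finset.prod_nonneg fun i (_ : i ∈ Finset.univ) => hu i)
        rw [mul_comm (∏ i, (R i *ᵥ q) (y i))] at h2
        rw [← hPy, ← hQy] at h1 h2
        cases hφ : φ y
        · simp only [Set.indicator, Set.mem_ofPred_eq, hφ, ne_eq, Bool.false_eq_true,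
            not_false_eq_true, if_true, not_true_eq_false, if_false, add_zero]
          exact h1.trans (by gcongr; exact le_self_add)
        · simp only [Set.indicator, Set.mem_ofPred_eq, hφ, ne_eq, Bool.true_eq_false,
            not_false_eq_true, if_true, not_true_eq_false, if_false, zero_add]
          exact h2.trans le_self_add
    _ = 3 * (∑' y, {y | φ y ≠ true}.indicator P y + ∑' y, {y | φ y ≠ false}.indicator Q y)
          + (∑' y, P y) / 3 + (∑' y, Q y) / 3 := by
        simp only [div_eq_mul_inv]
        rw [ENNReal.tsum_add, ENNReal.tsum_add, ENNReal.tsum_mul_left, ENNReal.tsum_add,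
          ENNReal.tsum_mul_right, ENNReal.tsum_mul_right]
    _ ≤ _ := by
        rw [hP1, hQ1]
        gcongr

/-- Otherwise every affinity is at least `1 - 1 / (2n)`, so by Bernoulli their product is at least
`1 / 2`, against the bound `29 / 30` on its double. For `n = 0` the empty product `1` gives the same
contradiction. -/
lemma exists_triDisc_ge_of_solvableWith [Fintype X] {C : Set (Matrix Y X ℝ)}
    (hC : ∀ T ∈ C, IsChannel T) {p q : X → ℝ} (hp : p ∈ stdSimplex ℝ X)
    (hq : q ∈ stdSimplex ℝ X) {n : ℕ} (h : SolvableWith C p q n) :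
    0 < n ∧ ∃ T ∈ C, 1 / (n : ℝ) ≤ triDisc (T *ᵥ p) (T *ᵥ q) := by
  obtain ⟨R, φ, hR, hφ⟩ := h
  have h1 := prod_affinity_le_of_error_le (fun i => hC _ (hR i)) hp hq hφ
  have hc : (3 * (1 / 10) + 1 / 3 + 1 / 3 : ℝ≥0∞) = ENNReal.ofReal (29 / 30) := by
    have : (29 / 30 : ℝ) = 3 * (1 / 10) + 1 / 3 + 1 / 3 := by norm_num
    rw [this, ENNReal.ofReal_add (by positivity) (by positivity),
      ENNReal.ofReal_add (by positivity) (by positivity), ENNReal.ofReal_mul (by norm_num),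
      ENNReal.ofReal_div_of_pos (by norm_num), ENNReal.ofReal_div_of_pos (by norm_num)]
    simp
  rw [hc] at h1
  by_contra! hcon
  have hn : (1 : ℝ≥0∞) ≤ 2 * ∏ i, affinity (R i *ᵥ p) (R i *ᵥ q) := by
    rcases Nat.eq_zero_or_pos n with rfl | hn
    · simp
    · have hn' : (1 : ℝ) ≤ n := by exact_mod_cast hn
      have hb : (1 / 2 : ℝ) ≤ (1 - 1 / (2 * n)) ^ n := by
        have h0 : (1 : ℝ) / (2 * n) ≤ 1 := by rw [div_le_one (by positivity)]; linarith
        have h2 := one_add_mul_le_pow (a := -(1 / (2 * n) : ℝ)) (by linarith) n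
        have h3 : (1 : ℝ) + n * -(1 / (2 * n)) = 1 / 2 := by field_simp; norm_num
        rw [h3] at h2
        simpa [sub_eq_add_neg] using h2
      have h2 : ENNReal.ofReal ((1 - 1 / (2 * n)) ^ n) ≤ ∏ i, affinity (R i *ᵥ p) (R i *ᵥ q) := by
        have h0 : (0 : ℝ) ≤ 1 - 1 / (2 * n) := by
          have : (1 : ℝ) / (2 * n) ≤ 1 := by rw [div_le_one (by positivity)]; linarith
          linarith
        rw [ENNReal.ofReal_pow h0]
        calc _ = ∏ _i : Fin n, ENNReal.ofReal (1 - 1 / (2 * n)) := by simp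
          _ ≤ _ := by
            refine Finset.prod_le_prod' fun i _ => ?_
            refine le_trans (ENNReal.ofReal_le_ofReal ?_)
              (le_affinity ((hC _ (hR i)).isDist_mulVec hp) ((hC _ (hR i)).isDist_mulVec hq))
            have := hcon hn _ (hR i)
            have e : (1 : ℝ) / (2 * n) = 1 / n / 2 := by field_simp
            rw [e]
            linarith
      calc (1 : ℝ≥0∞) = 2 * ENNReal.ofReal (1 / 2) := by
            rw [ENNReal.ofReal_div_of_pos (by norm_num)]
            simp only [ENNReal.ofReal_one, ENNReal.ofReal_ofNat]
            rw [one_div, ENNReal.mul_inv_cancel (by norm_num) (by norm_num)]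
        _ ≤ _ := by
          gcongr
          exact (ENNReal.ofReal_le_ofReal hb).trans h2
  have h4 := hn.trans h1
  rw [← ENNReal.ofReal_one, ENNReal.ofReal_le_ofReal_iff (by norm_num)] at h4
  norm_num at h4

lemma exp_neg_three_le : Real.exp (-3) ≤ 1 / 10 := by
  have h : (2.7 : ℝ) ^ 3 ≤ Real.exp 1 ^ 3 := by
    gcongr
    linarith [Real.exp_one_gt_d9]
  rw [← Real.exp_nat_mul] at h
  rw [Real.exp_neg, one_div]
  apply inv_anti₀ (by norm_num)
  norm_num at h
  linarith

/-- The maximum likelihood test has total error `∑ min(P, Q) ≤ ∑ √(PQ)`, the `n`-th power of the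
affinity, hence at most `exp (-nD / 4) ≤ e⁻³`. -/
lemma solvableWith_singleton [Fintype X] {T : Matrix Y X ℝ} (hT : IsChannel T) {p q : X → ℝ}
    (hp : p ∈ stdSimplex ℝ X) (hq : q ∈ stdSimplex ℝ X) {n : ℕ}
    (hn : 12 ≤ n * triDisc (T *ᵥ p) (T *ᵥ q)) : SolvableWith {T} p q n := by
  classical
  have hP := hT.isDist_mulVec hp
  have hQ := hT.isDist_mulVec hq
  set P : (Fin n → Y) → ℝ≥0∞ := fun y => ∏ i, ENNReal.ofReal ((T *ᵥ p) (y i)) with hPdef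
  set Q : (Fin n → Y) → ℝ≥0∞ := fun y => ∏ i, ENNReal.ofReal ((T *ᵥ q) (y i)) with hQdef
  refine ⟨fun _ => T, fun y => decide (Q y ≤ P y), fun _ => rfl, ?_⟩
  have e1 : outputProb (fun _ : Fin n => T) p {y | decide (Q y ≤ P y) ≠ true}
      = ∑' y, {y | decide (Q y ≤ P y) ≠ true}.indicator P y := tsum_subtype _ P
  have e2 : outputProb (fun _ : Fin n => T) q {y | decide (Q y ≤ P y) ≠ false}
      = ∑' y, {y | decide (Q y ≤ P y) ≠ false}.indicator Q y := tsum_subtype _ Q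
  rw [e1, e2, ← ENNReal.tsum_add]
  calc _ ≤ ∑' y : Fin n → Y, ∏ i, ENNReal.ofReal √((T *ᵥ p) (y i) * (T *ᵥ q) (y i)) := by
        refine ENNReal.tsum_le_tsum fun y => ?_
        have hu : ∀ i, 0 ≤ (T *ᵥ p) (y i) := fun i => hP.1 _
        have hv : ∀ i, 0 ≤ (T *ᵥ q) (y i) := fun i => hQ.1 _
        rw [prod_ofReal_sqrt hu hv]
        have hu' : 0 ≤ ∏ i, (T *ᵥ p) (y i) := Finset.prod_nonneg fun i _ => hu i
        have hv' : 0 ≤ ∏ i, (T *ᵥ q) (y i) := Finset.prod_nonneg fun i _ => hv i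
        have hPy : P y = ENNReal.ofReal (∏ i, (T *ᵥ p) (y i)) :=
          (ENNReal.ofReal_prod_of_nonneg fun i _ => hu i).symm
        have hQy : Q y = ENNReal.ofReal (∏ i, (T *ᵥ q) (y i)) :=
          (ENNReal.ofReal_prod_of_nonneg fun i _ => hv i).symm
        by_cases hc : Q y ≤ P y
        · simp only [Set.indicator, Set.mem_ofPred_eq, hc, decide_true, ne_eq, not_true_eq_false,
            if_false, Bool.true_eq_false, not_false_eq_true, if_true, zero_add]
          rw [hQy]
          rw [hPy, hQy, ENNReal.ofReal_le_ofReal_iff hu'] at hc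
          apply ENNReal.ofReal_le_ofReal (Real.le_sqrt_of_sq_le _)
          nlinarith
        · simp only [Set.indicator, Set.mem_ofPred_eq, hc, decide_false, ne_eq, not_true_eq_false,
            if_false, Bool.false_eq_true, not_false_eq_true, if_true, add_zero]
          rw [hPy]
          rw [hPy, hQy, ENNReal.ofReal_le_ofReal_iff hu', not_le] at hc
          apply ENNReal.ofReal_le_ofReal (Real.le_sqrt_of_sq_le _)
          nlinarith
    _ = affinity (T *ᵥ p) (T *ᵥ q) ^ n := by
        rw [tsum_pi_prod n fun _ y => ENNReal.ofReal √((T *ᵥ p) y * (T *ᵥ q) y)]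
        simp [affinity]
    _ ≤ ENNReal.ofReal (1 / 10) := by
        have h2 := triDisc_le_two hP hQ
        refine (pow_le_pow_left' (affinity_le hP hQ) n).trans ?_
        rw [← ENNReal.ofReal_pow (by linarith)]
        apply ENNReal.ofReal_le_ofReal
        calc (1 - triDisc (T *ᵥ p) (T *ᵥ q) / 4) ^ n
            ≤ Real.exp (-(triDisc (T *ᵥ p) (T *ᵥ q) / 4)) ^ n := by
              apply pow_le_pow_left₀ (by linarith)
              linarith [Real.add_one_le_exp (-(triDisc (T *ᵥ p) (T *ᵥ q) / 4))]
          _ = Real.exp (n * -(triDisc (T *ᵥ p) (T *ᵥ q) / 4)) := (Real.exp_nat_mul _ _).symm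
          _ ≤ Real.exp (-3) := Real.exp_le_exp.2 (by linarith)
          _ ≤ _ := exp_neg_three_le
    _ = 1 / 10 := by
        rw [ENNReal.ofReal_div_of_pos (by norm_num)]
        simp

lemma sampleComplexity_le [Fintype X] {C : Set (Matrix Y X ℝ)} {p q : X → ℝ} {n : ℕ}
    (h : SolvableWith C p q n) : sampleComplexity C p q ≤ n :=
  iInf₂_le n h

lemma exists_solvableWith_of_ne_top [Fintype X] {C : Set (Matrix Y X ℝ)} {p q : X → ℝ}
    (h : sampleComplexity C p q ≠ ⊤) : ∃ n : ℕ, SolvableWith C p q n ∧ sampleComplexity C p q = n := by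
  classical
  have hex : ∃ n, SolvableWith C p q n := by
    by_contra! hcon
    exact h (by simp [sampleComplexity, hcon])
  refine ⟨Nat.find hex, Nat.find_spec hex, le_antisymm (sampleComplexity_le (Nat.find_spec hex)) ?_⟩
  exact le_iInf₂ fun n hn => by exact_mod_cast Nat.find_min' hex hn

lemma sampleComplexity_anti [Fintype X] {C C' : Set (Matrix Y X ℝ)} (h : C ⊆ C') (p q : X → ℝ) :
    sampleComplexity C' p q ≤ sampleComplexity C p q :=
  le_iInf₂ fun _ ⟨R, φ, hR, hφ⟩ => sampleComplexity_le ⟨R, φ, fun i => h (hR i), hφ⟩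

end Testing

/-! ## Dyadic level sets of the likelihood ratio -/

section Levels

variable {X Y : Type}

/-- `S` is an interval for the preorder that `a` induces. -/
def OrdConvex (a : X → ℝ) (S : Finset X) : Prop :=
  ∀ x ∈ S, ∀ z ∈ S, ∀ w, a x ≤ a w → a w ≤ a z → w ∈ S

/-- Up to a common factor, what a cluster `S` contributes to the triangular discrimination after
randomized response. -/
noncomputable def clusterValue (L : ℝ) (d μ : X → ℝ) (S : Finset X) : ℝ :=
  (∑ x ∈ S, d x) ^ 2 / (2 + L * ∑ x ∈ S, μ x)

/-- `O` bounds the total value of every family of at most `s` disjoint intervals. -/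
def BoundsClusters (L : ℝ) (a d μ : X → ℝ) (s : ℕ) (O : ℝ) : Prop :=
  ∀ (J : Finset ℕ) (S : ℕ → Finset X), J.card ≤ s →
    (∀ i j, i ≠ j → Disjoint (S i) (S j)) → (∀ j, OrdConvex a (S j)) →
    ∑ j ∈ J, clusterValue L d μ (S j) ≤ O

/-- Disjoint dyadic level sets `S j` of `a` below `t`, those with index in `J` of mass at least
`1 / L`. -/
structure LevelFamily (a μ : X → ℝ) (L t : ℝ) (S : ℕ → Finset X) (J : Finset ℕ) : Prop where
  nonneg : 0 ≤ t
  le_one : t ≤ 1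
  disjoint : ∀ i j, i ≠ j → Disjoint (S i) (S j)
  convex : ∀ j, OrdConvex a (S j)
  lt : ∀ j, ∀ x ∈ S j, t / 2 ^ (j + 1) < a x
  heavy : ∀ j ∈ J, 1 ≤ L * ∑ x ∈ S j, μ x

/-- Both bounds are proved in one induction. With `x = w n / 2 ^ n` and `S` the previous sum, `x`
and `S` are at most `M * 2 ^ n`, so the square grows by `2xS + x² ≤ 3 M w n`. -/
lemma geometric_square_le (w : ℕ → ℝ) (hw : ∀ j, 0 ≤ w j) (M : ℝ) (hM : 0 ≤ M) (n : ℕ)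
    (h : ∀ j < n, w j ≤ M * 4 ^ j) :
    (∑ j ∈ Finset.range n, w j / 2 ^ j) ^ 2 ≤ 4 * M * ∑ j ∈ Finset.range n, w j ∧
      ∑ j ∈ Finset.range n, w j / 2 ^ j ≤ M * 2 ^ n := by
  induction n with
  | zero => simpa using hM
  | succ n ih =>
    obtain ⟨h1, h2⟩ := ih fun j hj => h j (by omega)
    rw [Finset.sum_range_succ, Finset.sum_range_succ]
    have h3 := h n (by omega)
    have h4 : w n / 2 ^ n ≤ M * 2 ^ n := by
      rw [div_le_iff₀ (by positivity)]
      calc w n ≤ M * 4 ^ n := h3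
        _ = _ := by rw [mul_assoc, ← mul_pow]; norm_num
    have h5 : w n / 2 ^ n * 2 ^ n = w n := by field_simp
    have h6 : 0 ≤ w n / 2 ^ n := div_nonneg (hw n) (by positivity)
    refine ⟨?_, by rw [pow_succ]; linarith⟩
    have h7 : w n / 2 ^ n * ∑ j ∈ Finset.range n, w j / 2 ^ j ≤ w n / 2 ^ n * (M * 2 ^ n) :=
      mul_le_mul_of_nonneg_left h2 h6
    have h8 : w n / 2 ^ n * (w n / 2 ^ n) ≤ w n / 2 ^ n * (M * 2 ^ n) :=
      mul_le_mul_of_nonneg_left h4 h6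
    have h9 : w n / 2 ^ n * (M * 2 ^ n) = M * w n := by rw [← h5]; field_simp
    nlinarith [mul_nonneg hM (hw n)]

/-- Discarding the smallest term never lowers the average, so the `s` largest terms carry at least
the share `s / |J|` of the sum. The weaker factor `|J| + s` also covers `|J| ≤ s`, where nothing is
discarded. -/
lemma exists_subset_sum_ge (J : Finset ℕ) (v : ℕ → ℝ) (hv : ∀ j, 0 ≤ v j) (s : ℕ) :
    ∃ J' ⊆ J, J'.card ≤ s ∧ s * ∑ j ∈ J, v j ≤ (J.card + s) * ∑ j ∈ J', v j := by
  suffices h : ∀ n (J : Finset ℕ), J.card = s + n →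
      ∃ J' ⊆ J, J'.card ≤ s ∧ s * ∑ j ∈ J, v j ≤ J.card * ∑ j ∈ J', v j by
    by_cases hJ : J.card ≤ s
    · refine ⟨J, subset_rfl, hJ, ?_⟩
      exact mul_le_mul_of_nonneg_right (by linarith [(Nat.cast_nonneg J.card : (0:ℝ) ≤ _)])
        (Finset.sum_nonneg fun j _ => hv j)
    · obtain ⟨J', h1, h2, h3⟩ := h (J.card - s) J (by omega)
      refine ⟨J', h1, h2, h3.trans ?_⟩
      exact mul_le_mul_of_nonneg_right (by linarith [(Nat.cast_nonneg s : (0:ℝ) ≤ _)])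
        (Finset.sum_nonneg fun j _ => hv j)
  intro n
  induction n with
  | zero => exact fun J hJ => ⟨J, subset_rfl, by omega, by rw [hJ]; simp⟩
  | succ n ih =>
    intro J hJ
    obtain ⟨i, hi, hmin⟩ := J.exists_min_image v (Finset.card_pos.1 (by omega))
    have hc : (J.erase i).card = s + n := by rw [Finset.card_erase_of_mem hi]; omega
    obtain ⟨J', h1, h2, h3⟩ := ih _ hc
    refine ⟨J', h1.trans (Finset.erase_subset _ _), h2, ?_⟩
    have h4 : (J.erase i).card * v i ≤ ∑ j ∈ J.erase i, v j := by
      rw [← nsmul_eq_mul]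
      exact Finset.card_nsmul_le_sum _ _ _ fun j hj => hmin j (Finset.mem_of_mem_erase hj)
    have h5 := Finset.add_sum_erase J v hi
    have hc' : (J.card : ℝ) = (J.erase i).card + 1 := by rw [hJ, hc]; push_cast; ring
    have h0 : 0 ≤ ∑ j ∈ J', v j := Finset.sum_nonneg fun j _ => hv j
    rw [hc', ← h5]
    rcases Nat.eq_zero_or_pos (s + n) with h | h
    · have : s = 0 := by omega
      subst this
      simp
      positivity
    · have hpos : (0 : ℝ) < (J.erase i).card := by rw [hc]; exact_mod_cast h
      have hs : (0 : ℝ) ≤ s := Nat.cast_nonneg s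
      have : ((J.erase i).card : ℝ) * (s * (v i + ∑ j ∈ J.erase i, v j))
          ≤ (J.erase i).card * (((J.erase i).card + 1) * ∑ j ∈ J', v j) := by
        nlinarith [mul_le_mul_of_nonneg_left h4 hs,
          mul_le_mul_of_nonneg_left h3 (by linarith : (0:ℝ) ≤ (J.erase i).card + 1)]
      exact le_of_mul_le_mul_left this hpos

variable [Fintype X]

/-- Unless all of `a > 0` is light, `t` is the largest positive value of `a` whose closed upper
level set has mass at least `1 / L`. If the open set above `t` had mass over `1 / L`, the next value
of `a` would also qualify. -/
lemma exists_cutoff (a μ : X → ℝ) (ha : ∀ x, a x ≤ 1) (L : ℝ) :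
    ∃ t, 0 ≤ t ∧ t ≤ 1 ∧ L * ∑ x with t < a x, μ x ≤ 1 ∧
      (t = 0 ∨ 1 ≤ L * ∑ x with t ≤ a x, μ x) := by
  by_cases h0 : L * ∑ x with 0 < a x, μ x ≤ 1
  · exact ⟨0, le_rfl, zero_le_one, h0, Or.inl rfl⟩
  have hmin : ∀ t, ¬ L * ∑ x with t < a x, μ x ≤ 1 →
      ∃ z, t < a z ∧ 1 ≤ L * ∑ x with a z ≤ a x, μ x := by
    intro t ht
    have hne : (Finset.univ.filter fun x => t < a x).Nonempty := by
      by_contra h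
      rw [Finset.not_nonempty_iff_eq_empty] at h
      rw [h] at ht
      simp at ht
    obtain ⟨z, hz, hzmin⟩ := Finset.exists_min_image _ a hne
    have hz' : t < a z := by simpa using hz
    refine ⟨z, hz', ?_⟩
    -- No value of `a` lies strictly between `t` and `a z`.
    have : (Finset.univ.filter fun x => a z ≤ a x) = Finset.univ.filter fun x => t < a x := by
      ext x
      simp only [Finset.mem_filter, Finset.mem_univ, true_and]
      exact ⟨fun h => hz'.trans_le h, fun h => hzmin x (by simpa using h)⟩
    rw [this]
    exact (not_le.1 ht).le
  obtain ⟨z₀, hz₀, hz₀'⟩ := hmin 0 h0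
  obtain ⟨z, hz, hzmax⟩ := Finset.exists_max_image
    (Finset.univ.filter fun z => 0 < a z ∧ 1 ≤ L * ∑ x with a z ≤ a x, μ x) a
    ⟨z₀, by simpa using ⟨hz₀, hz₀'⟩⟩
  simp only [Finset.mem_filter, Finset.mem_univ, true_and] at hz hzmax
  refine ⟨a z, hz.1.le, ha z, ?_, Or.inr hz.2⟩
  by_contra hcon
  obtain ⟨z', h1, h2⟩ := hmin _ hcon
  exact absurd (hzmax z' ⟨hz.1.trans h1, h2⟩) (not_le.2 h1)

lemma exists_level {t r : ℝ} (hr : 0 < r) (hrt : r ≤ t) :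
    ∃ j : ℕ, t / 2 ^ (j + 1) < r ∧ r ≤ t / 2 ^ j := by
  obtain ⟨j, h1, h2⟩ := exists_nat_pow_near (x := t / r) (y := 2)
    (by rwa [one_le_div hr]) one_lt_two
  refine ⟨j, ?_, ?_⟩
  · rw [div_lt_iff₀ (by positivity)]
    rw [div_lt_iff₀ hr] at h2
    linarith
  · rw [le_div_iff₀ (by positivity)]
    rw [le_div_iff₀ hr] at h1
    linarith

lemma sum_div_two_pow_le {c : ℝ} (hc : 0 ≤ c) (K : ℕ) :
    ∑ j ∈ Finset.range K, c / 2 ^ j ≤ 2 * c := by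
  have h : ∀ K : ℕ, ∑ j ∈ Finset.range K, c / 2 ^ j = 2 * c - 2 * c / 2 ^ K := by
    intro K
    induction K with
    | zero => simp
    | succ K ih => rw [Finset.sum_range_succ, ih, pow_succ]; field_simp; ring
  rw [h]
  have : 0 ≤ 2 * c / 2 ^ K := by positivity
  linarith

/-- Levels of mass below `1 / L` are emptied and their points moved to `U`. Level `j` brings at most
`(t / 2 ^ j) / L` into the sum over `U`, so all of them bring at most `2t / L`. -/
lemma level_decomposition (a μ : X → ℝ) (hμ : ∀ x, 0 ≤ μ x) {L t : ℝ} (hL : 0 < L)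
    (ht : 0 ≤ t) :
    ∃ (S : ℕ → Finset X) (K : ℕ) (U : Finset X),
      (∀ i j, i ≠ j → Disjoint (S i) (S j)) ∧ (∀ j, OrdConvex a (S j)) ∧
      (∀ j, ∀ x ∈ S j, t / 2 ^ (j + 1) < a x ∧ a x ≤ t / 2 ^ j) ∧
      (∀ j, (S j).Nonempty → 1 ≤ L * ∑ x ∈ S j, μ x) ∧
      (∀ x, 0 < a x → x ∈ U ∨ ∃ j < K, x ∈ S j) ∧ (∀ x ∈ U, 0 < a x) ∧
      ∑ x ∈ U, a x * μ x ≤ ∑ x with t < a x, a x * μ x + 2 * (t / L) := by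
  classical
  let S' : ℕ → Finset X := fun j => {x | t / 2 ^ (j + 1) < a x ∧ a x ≤ t / 2 ^ j}
  let S : ℕ → Finset X := fun j => if 1 ≤ L * ∑ x ∈ S' j, μ x then S' j else ∅
  have hSS' : ∀ j, S j ⊆ S' j := by
    intro j
    by_cases h : 1 ≤ L * ∑ x ∈ S' j, μ x <;> simp [S, h]
  have hlev : ∀ x, ∃ j : ℕ, 0 < a x → a x ≤ t → x ∈ S' j := by
    intro x
    by_cases h : 0 < a x ∧ a x ≤ t
    · obtain ⟨j, hj⟩ := exists_level h.1 h.2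
      exact ⟨j, fun _ _ => by simpa [S'] using hj⟩
    · exact ⟨0, fun h1 h2 => absurd ⟨h1, h2⟩ h⟩
  choose lev hlev using hlev
  have hpow : ∀ i j : ℕ, i < j → t / 2 ^ j ≤ t / 2 ^ (i + 1) := fun i j hij =>
    div_le_div_of_nonneg_left ht (by positivity) (pow_le_pow_right₀ one_le_two (by omega))
  have hdis : ∀ i j, i < j → Disjoint (S' i) (S' j) := by
    intro i j hij
    rw [Finset.disjoint_left]
    intro x hx hx'
    simp only [S', Finset.mem_filter, Finset.mem_univ, true_and] at hx hx'
    linarith [hpow i j hij]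
  have hdis' : ∀ i j, i ≠ j → Disjoint (S' i) (S' j) := fun i j hij => by
    rcases lt_or_gt_of_ne hij with h | h
    · exact hdis i j h
    · exact (hdis j i h).symm
  let K := Finset.univ.sup lev + 1
  refine ⟨S, K, Finset.univ.filter fun x => 0 < a x ∧ ∀ j < K, x ∉ S j,
    fun i j hij => Finset.disjoint_of_subset_left (hSS' i)
      (Finset.disjoint_of_subset_right (hSS' j) (hdis' i j hij)), ?_, ?_, ?_, ?_, ?_, ?_⟩
  · intro j
    by_cases h : 1 ≤ L * ∑ x ∈ S' j, μ x
    · simp only [S, h, if_true]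
      intro x hx z hz w h1 h2
      simp only [S', Finset.mem_filter, Finset.mem_univ, true_and] at hx hz ⊢
      exact ⟨hx.1.trans_le h1, h2.trans hz.2⟩
    · simp only [S, h, if_false]
      exact fun x hx => absurd hx (Finset.notMem_empty x)
  · intro j x hx
    simpa [S'] using hSS' j hx
  · intro j hj
    by_cases h : 1 ≤ L * ∑ x ∈ S' j, μ x
    · simp [S, h]
    · simp [S, h] at hj
  · intro x hx
    by_cases h : ∀ j < K, x ∉ S j
    · exact Or.inl (by simpa using ⟨hx, h⟩)
    · push Not at h
      exact Or.inr h
  · intro x hx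
    simp only [Finset.mem_filter, Finset.mem_univ, true_and] at hx
    exact hx.1
  · have hnn : ∀ x, 0 < a x → 0 ≤ a x * μ x := fun x hx => mul_nonneg hx.le (hμ x)
    set light := (Finset.range K).filter fun j => ¬ 1 ≤ L * ∑ x ∈ S' j, μ x with hlight
    have hsub : (Finset.univ.filter fun x => 0 < a x ∧ ∀ j < K, x ∉ S j) ⊆
        (Finset.univ.filter fun x => t < a x) ∪ light.biUnion S' := by
      intro x hx
      simp only [Finset.mem_filter, Finset.mem_univ, true_and] at hx
      rw [Finset.mem_union]
      by_cases hxt : t < a x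
      · exact Or.inl (by simpa using hxt)
      · right
        have h1 := hlev x hx.1 (not_lt.1 hxt)
        have hK : lev x < K := Nat.lt_succ_of_le (Finset.le_sup (Finset.mem_univ x))
        rw [Finset.mem_biUnion]
        refine ⟨lev x, ?_, h1⟩
        rw [hlight, Finset.mem_filter, Finset.mem_range]
        refine ⟨hK, fun hcon => hx.2 _ hK ?_⟩
        simpa [S, hcon] using h1
    have hposU : ∀ x ∈ (Finset.univ.filter fun x => t < a x) ∪ light.biUnion S', 0 < a x := by
      intro x hx
      simp only [Finset.mem_union, Finset.mem_filter, Finset.mem_univ, true_and,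
        Finset.mem_biUnion] at hx
      rcases hx with hx | ⟨j, -, hx⟩
      · exact ht.trans_lt hx
      · simp only [S', Finset.mem_filter, Finset.mem_univ, true_and] at hx
        exact lt_of_le_of_lt (by positivity) hx.1
    refine (Finset.sum_le_sum_of_subset_of_nonneg hsub
      fun x hx _ => hnn x (hposU x hx)).trans ?_
    have h1 : ∑ x ∈ light.biUnion S', a x * μ x ≤ 2 * (t / L) := by
      rw [Finset.sum_biUnion fun i _ j _ hij => hdis' i j hij]
      calc ∑ j ∈ light, ∑ x ∈ S' j, a x * μ x ≤ ∑ j ∈ light, t / L / 2 ^ j := by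
            refine Finset.sum_le_sum fun j hj => ?_
            rw [hlight, Finset.mem_filter, not_le] at hj
            calc ∑ x ∈ S' j, a x * μ x ≤ ∑ x ∈ S' j, t / 2 ^ j * μ x := by
                  refine Finset.sum_le_sum fun x hx => ?_
                  simp only [S', Finset.mem_filter, Finset.mem_univ, true_and] at hx
                  exact mul_le_mul_of_nonneg_right hx.2 (hμ x)
              _ = t / 2 ^ j * ∑ x ∈ S' j, μ x := by rw [Finset.mul_sum]
              _ ≤ t / 2 ^ j * (1 / L) := by
                  apply mul_le_mul_of_nonneg_left _ (by positivity)
                  rw [le_div_iff₀ hL]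
                  linarith [hj.2]
              _ = t / L / 2 ^ j := by field_simp
        _ ≤ ∑ j ∈ Finset.range K, t / L / 2 ^ j :=
            Finset.sum_le_sum_of_subset_of_nonneg (Finset.filter_subset _ _)
              fun j _ _ => by positivity
        _ ≤ _ := sum_div_two_pow_le (by positivity) K
    have h2 := Finset.sum_union_inter (s₁ := Finset.univ.filter fun x => t < a x)
      (s₂ := light.biUnion S') (f := fun x => a x * μ x)
    have h3 : 0 ≤ ∑ x ∈ (Finset.univ.filter fun x => t < a x) ∩ light.biUnion S', a x * μ x :=
      Finset.sum_nonneg fun x hx =>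
        hnn x (hposU x (Finset.mem_union_left _ (Finset.mem_of_mem_inter_left hx)))
    linarith

/-- Two single intervals suffice as test families. The open set above `t` has mass at most `1 / L`,
so its value bounds the first sum. The closed set has mass at least `1 / L` and `a ≥ t` on it, so
its value bounds `t / L`. -/
lemma sum_cutoff_sq_le (a μ : X → ℝ) (hμ : ∀ x, 0 ≤ μ x) {L t : ℝ} (hL : 0 < L)
    (ht : 0 ≤ t) (h1 : L * ∑ x with t < a x, μ x ≤ 1)
    (h2 : t = 0 ∨ 1 ≤ L * ∑ x with t ≤ a x, μ x) {s : ℕ} (hs : 1 ≤ s) {O : ℝ}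
    (hO : BoundsClusters L a (fun x => a x * μ x) μ s O) :
    (∑ x with t < a x, a x * μ x + 2 * (t / L)) ^ 2 ≤ 30 * O := by
  have hsingle : ∀ S, OrdConvex a S → clusterValue L (fun x => a x * μ x) μ S ≤ O := by
    intro S hS
    have h := hO {0} (fun j => if j = 0 then S else ∅) (by simpa using hs) (fun i j hij => by
      by_cases hi : i = 0
      · have : j ≠ 0 := fun h => hij (hi.trans h.symm)
        simp [this]
      · simp [hi]) (fun j => by
      by_cases hj : j = 0
      · simpa [hj] using hS
      · simp only [hj, if_false]
        exact fun x hx => absurd hx (Finset.notMem_empty x))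
    simpa using h
  have hTop := hsingle (Finset.univ.filter fun x => t < a x) (by
    intro x hx z _ w hw _
    simp only [Finset.mem_filter, Finset.mem_univ, true_and] at hx ⊢
    exact hx.trans_le hw)
  have hA := hsingle (Finset.univ.filter fun x => t ≤ a x) (by
    intro x hx z _ w hw _
    simp only [Finset.mem_filter, Finset.mem_univ, true_and] at hx ⊢
    exact hx.trans hw)
  unfold clusterValue at hTop hA
  have hW : 0 ≤ ∑ x with t < a x, μ x := Finset.sum_nonneg fun x _ => hμ x
  rw [div_le_iff₀ (by positivity)] at hTop
  have hO0 : 0 ≤ O := by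
    by_contra hcon
    have : O * (2 + L * ∑ x with t < a x, μ x) < 0 :=
      mul_neg_of_neg_of_pos (not_le.1 hcon) (by positivity)
    nlinarith [sq_nonneg (∑ x with t < a x, a x * μ x)]
  have hTop' : (∑ x with t < a x, a x * μ x) ^ 2 ≤ 3 * O :=
    hTop.trans (by nlinarith)
  have ht' : (t / L) ^ 2 ≤ 3 * O := by
    rcases h2 with h2 | h2
    · rw [h2]; simp; exact hO0
    · set W := ∑ x with t ≤ a x, μ x with hWdef
      have hWpos : 0 < W := by
        by_contra hcon
        have : L * W ≤ 0 := mul_nonpos_of_nonneg_of_nonpos hL.le (not_lt.1 hcon)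
        linarith
      rw [div_le_iff₀ (by positivity)] at hA
      have hD : t * W ≤ ∑ x with t ≤ a x, a x * μ x := by
        rw [hWdef, Finset.mul_sum]
        refine Finset.sum_le_sum fun x hx => ?_
        simp only [Finset.mem_filter, Finset.mem_univ, true_and] at hx
        exact mul_le_mul_of_nonneg_right hx (hμ x)
      have h3 : (t * W) ^ 2 ≤ O * (2 + L * W) :=
        (pow_le_pow_left₀ (by positivity) hD 2).trans hA
      have h4 : (t * W) ^ 2 ≤ O * (3 * (L * W)) :=
        h3.trans (mul_le_mul_of_nonneg_left (by linarith) hO0)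
      have h5 : t ^ 2 * W ≤ 3 * O * L := by
        have : W * (t ^ 2 * W) ≤ W * (3 * O * L) := by linarith
        exact le_of_mul_le_mul_left this hWpos
      rw [div_pow, div_le_iff₀ (by positivity)]
      have h6 : t ^ 2 ≤ t ^ 2 * (L * W) := le_mul_of_one_le_right (sq_nonneg t) h2
      nlinarith
  -- `(A + 2B)² ≤ 2A² + 8B²` with `A², B² ≤ 3 O` gives the factor `6 + 24`.
  nlinarith [sq_nonneg (∑ x with t < a x, a x * μ x - 2 * (t / L))]

/-- The numerator is at most `2B² + 2t²H²`, with `B` the part on `U` and `H = ∑ w j / 2 ^ j` the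
part on the heavy levels. The mass `2m` in the denominator absorbs one factor `B ≤ L m ∑ a μ`. The
mass `∑ e μ` absorbs one factor of `H² ≤ 4 (max w j / 4 ^ j) ∑ e μ`, so only the maximizing level
remains. -/
lemma row_le [DecidableEq X] {a μ e : X → ℝ} (hμ : ∀ x, 0 ≤ μ x) {L t m : ℝ} (ht : 0 ≤ t)
    (hm : 0 ≤ m) (he0 : ∀ x, 0 ≤ e x) (he : ∀ x, e x ≤ L * m)
    {S : ℕ → Finset X} {K : ℕ} {U : Finset X}
    (hdis : ∀ i j, i ≠ j → Disjoint (S i) (S j))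
    (hS : ∀ j, ∀ x ∈ S j, t / 2 ^ (j + 1) < a x ∧ a x ≤ t / 2 ^ j)
    (hcov : ∀ x, 0 < a x → x ∈ U ∨ ∃ j < K, x ∈ S j) (hU : ∀ x ∈ U, 0 < a x) :
    ∃ j, (∑ x, e x * (max (a x) 0 * μ x)) ^ 2 / (2 * m + ∑ x, e x * μ x)
      ≤ (L * ∑ x ∈ U, a x * μ x) * ∑ x ∈ U, e x * (a x * μ x)
        + 8 * (t ^ 2 / 4 ^ j * ∑ x ∈ S j, e x * μ x) := by
  set w : ℕ → ℝ := fun j => ∑ x ∈ S j, e x * μ x with hw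
  have hw0 : ∀ j, 0 ≤ w j := fun j => Finset.sum_nonneg fun x _ => mul_nonneg (he0 x) (hμ x)
  -- The range is one longer than needed, so that it is nonempty when `K = 0`.
  obtain ⟨j, hj, hjmax⟩ := Finset.exists_max_image (Finset.range (K + 1))
    (fun j => w j / 4 ^ j) ⟨0, by simp⟩
  refine ⟨j, ?_⟩
  have hM : 0 ≤ w j / 4 ^ j := div_nonneg (hw0 j) (by positivity)
  have hgeo := (geometric_square_le w hw0 (w j / 4 ^ j) hM K fun i hi => by
    have := hjmax i (Finset.mem_range.2 (by omega))
    rwa [div_le_iff₀ (by positivity)] at this).1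
  have hSpos : ∀ j, ∀ x ∈ S j, 0 < a x := fun j x hx =>
    lt_of_le_of_lt (by positivity) (hS j x hx).1
  set B := ∑ x ∈ U, e x * (a x * μ x) with hB
  set H := ∑ j ∈ Finset.range K, w j / 2 ^ j with hH
  have hB0 : 0 ≤ B := Finset.sum_nonneg fun x hx =>
    mul_nonneg (he0 x) (mul_nonneg (hU x hx).le (hμ x))
  have hH0 : 0 ≤ H := Finset.sum_nonneg fun j _ => div_nonneg (hw0 j) (by positivity)
  have hsplit : ∑ x, e x * (max (a x) 0 * μ x) ≤ B + t * H := by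
    have h1 : ∑ j ∈ Finset.range K, ∑ x ∈ S j, e x * (a x * μ x) ≤ t * H := by
      rw [hH, Finset.mul_sum]
      refine Finset.sum_le_sum fun j _ => ?_
      rw [hw, ← mul_div_assoc, mul_div_right_comm, Finset.mul_sum]
      refine Finset.sum_le_sum fun x hx => ?_
      have := mul_le_mul_of_nonneg_right (hS j x hx).2 (mul_nonneg (he0 x) (hμ x))
      linarith
    refine le_trans ?_ (add_le_add_right h1 B)
    rw [← Finset.sum_biUnion fun i _ j _ hij => hdis i j hij]
    have hpos : ∀ x ∈ U ∪ (Finset.range K).biUnion S, 0 < a x := by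
      intro x hx
      simp only [Finset.mem_union, Finset.mem_biUnion] at hx
      rcases hx with hx | ⟨j, -, hx⟩
      · exact hU x hx
      · exact hSpos j x hx
    have h2 := Finset.sum_union_inter (s₁ := U) (s₂ := (Finset.range K).biUnion S)
      (f := fun x => e x * (a x * μ x))
    have h3 : 0 ≤ ∑ x ∈ U ∩ (Finset.range K).biUnion S, e x * (a x * μ x) :=
      Finset.sum_nonneg fun x hx => mul_nonneg (he0 x)
        (mul_nonneg (hU x (Finset.mem_of_mem_inter_left hx)).le (hμ x))
    have h4 : ∑ x, e x * (max (a x) 0 * μ x)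
        = ∑ x ∈ U ∪ (Finset.range K).biUnion S, e x * (a x * μ x) := by
      rw [← Finset.sum_subset (Finset.subset_univ (U ∪ (Finset.range K).biUnion S))]
      · exact Finset.sum_congr rfl fun x hx => by rw [max_eq_left (hpos x hx).le]
      · intro x _ hx
        have : ¬ 0 < a x := fun h => hx (by
          rcases hcov x h with h | ⟨j, hj, h⟩
          · exact Finset.mem_union_left _ h
          · exact Finset.mem_union_right _ (Finset.mem_biUnion.2 ⟨j, by simpa using hj, h⟩))
        rw [max_eq_right (not_lt.1 this)]
        ring
    linarith
  have hsumw : ∑ j ∈ Finset.range K, w j ≤ ∑ x, e x * μ x := by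
    rw [← Finset.sum_biUnion fun i _ j _ hij => hdis i j hij]
    exact Finset.sum_le_sum_of_subset_of_nonneg (Finset.subset_univ _)
      fun x _ _ => mul_nonneg (he0 x) (hμ x)
  have hE0 : 0 ≤ ∑ x, e x * μ x := Finset.sum_nonneg fun x _ => mul_nonneg (he0 x) (hμ x)
  have h0 : 0 ≤ ∑ x, e x * (max (a x) 0 * μ x) := Finset.sum_nonneg fun x _ =>
    mul_nonneg (he0 x) (mul_nonneg (le_max_right _ _) (hμ x))
  have hBle : B ≤ L * m * ∑ x ∈ U, a x * μ x := by
    rw [Finset.mul_sum]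
    exact Finset.sum_le_sum fun x hx =>
      mul_le_mul_of_nonneg_right (he x) (mul_nonneg (hU x hx).le (hμ x))
  have hsq : (∑ x, e x * (max (a x) 0 * μ x)) ^ 2 ≤ 2 * B ^ 2 + 2 * (t ^ 2 * H ^ 2) := by
    have := pow_le_pow_left₀ h0 hsplit 2
    nlinarith [sq_nonneg (B - t * H)]
  have hBB : B ^ 2 ≤ (L * m * ∑ x ∈ U, a x * μ x) * B := by
    rw [sq]; exact mul_le_mul_of_nonneg_right hBle hB0
  have hd : 0 ≤ L * m * ∑ x ∈ U, a x * μ x := hB0.trans hBle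
  have e1 : t ^ 2 * H ^ 2 ≤ t ^ 2 * (4 * (w j / 4 ^ j) * ∑ x, e x * μ x) :=
    mul_le_mul_of_nonneg_left (hgeo.trans (mul_le_mul_of_nonneg_left hsumw (by positivity)))
      (sq_nonneg t)
  -- If `m = 0`, privacy forces the whole row to vanish; otherwise `m` can be divided out.
  rcases hm.eq_or_lt with hm | hm
  · have hz : ∀ x, e x = 0 := fun x => le_antisymm (by simpa [← hm] using he x) (he0 x)
    simp [hz, hB]
  have hdU : 0 ≤ ∑ x ∈ U, a x * μ x := Finset.sum_nonneg fun x hx =>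
    mul_nonneg (hU x hx).le (hμ x)
  have hL : 0 ≤ L * ∑ x ∈ U, a x * μ x := by
    rw [mul_right_comm] at hd
    exact nonneg_of_mul_nonneg_left hd hm
  apply div_le_of_le_mul₀ (by positivity) (add_nonneg (mul_nonneg hL hB0)
    (mul_nonneg (by norm_num) (mul_nonneg (by positivity) (hw0 j))))
  have e2 : t ^ 2 / 4 ^ j * w j = t ^ 2 * (w j / 4 ^ j) := by field_simp
  rw [e2]
  have e3 : 0 ≤ t ^ 2 * (w j / 4 ^ j) := by positivity
  have e4 : 0 ≤ (L * ∑ x ∈ U, a x * μ x) * B := mul_nonneg hL hB0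
  nlinarith [mul_nonneg e3 hm.le, mul_nonneg e4 hE0]

/-- Summing `row_le` over the rows, the column sums of `e` are at most `lam`. The part on `U` then
becomes `lam * L * (∑ a μ)²`, and rows that picked the same level share its mass. `J` consists of
the levels picked, hence has at most one element per row. -/
lemma one_sided (a μ : X → ℝ) (ha : ∀ x, a x ≤ 1) (hμ : ∀ x, 0 ≤ μ x) {L lam : ℝ} (hL : 0 < L)
    {s : ℕ} (hs : 1 ≤ s) {O : ℝ}
    (hO : BoundsClusters L a (fun x => a x * μ x) μ s O) (F : Finset Y) (m : Y → ℝ)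
    (e : Y → X → ℝ) (hm : ∀ y, 0 ≤ m y) (he0 : ∀ y x, 0 ≤ e y x)
    (he : ∀ y x, e y x ≤ L * m y) (hsum : ∀ x, ∑ y ∈ F, e y x ≤ lam) (hlam : 0 ≤ lam) :
    ∃ (S : ℕ → Finset X) (J : Finset ℕ) (t : ℝ), LevelFamily a μ L t S J ∧ J.card ≤ F.card ∧
      ∑ y ∈ F, (∑ x, e y x * (max (a x) 0 * μ x)) ^ 2 / (2 * m y + ∑ x, e y x * μ x)
        ≤ 30 * (lam * L * O) + 8 * (lam * ∑ j ∈ J, t ^ 2 / 4 ^ j * ∑ x ∈ S j, μ x) := by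
  classical
  obtain ⟨t, ht0, ht1, h1, h2⟩ := exists_cutoff a μ ha L
  have hcut := sum_cutoff_sq_le a μ hμ hL ht0 h1 h2 hs hO
  obtain ⟨S, K, U, hdis, hconv, hlev, hheavy, hcov, hUpos, hUle⟩ :=
    level_decomposition a μ hμ hL ht0
  have hrow := fun y => row_le hμ ht0 (hm y) (he0 y) (he y) hdis hlev hcov hUpos
  choose lv hlv using hrow
  -- A row may pick an emptied level. Such a level contributes nothing and is not heavy, so it is
  -- left out of `J`.
  refine ⟨S, (F.image lv).filter fun j => (S j).Nonempty, t, ⟨ht0, ht1, hdis, hconv,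
    fun j x hx => (hlev j x hx).1, fun j hj => hheavy j (Finset.mem_filter.1 hj).2⟩,
    (Finset.card_filter_le _ _).trans Finset.card_image_le, ?_⟩
  refine (Finset.sum_le_sum fun y _ => hlv y).trans ?_
  rw [Finset.sum_add_distrib, ← Finset.mul_sum, ← Finset.mul_sum]
  have hdU : 0 ≤ ∑ x ∈ U, a x * μ x := Finset.sum_nonneg fun x hx =>
    mul_nonneg (hUpos x hx).le (hμ x)
  refine add_le_add ?_ (mul_le_mul_of_nonneg_left ?_ (by norm_num))
  · have h3 : ∑ y ∈ F, ∑ x ∈ U, e y x * (a x * μ x) ≤ lam * ∑ x ∈ U, a x * μ x := by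
      rw [Finset.sum_comm, Finset.mul_sum]
      refine Finset.sum_le_sum fun x hx => ?_
      rw [← Finset.sum_mul]
      exact mul_le_mul_of_nonneg_right (hsum x) (mul_nonneg (hUpos x hx).le (hμ x))
    have h4 : (∑ x ∈ U, a x * μ x) ^ 2 ≤ 30 * O :=
      (pow_le_pow_left₀ hdU hUle 2).trans hcut
    calc _ ≤ (L * ∑ x ∈ U, a x * μ x) * (lam * ∑ x ∈ U, a x * μ x) :=
          mul_le_mul_of_nonneg_left h3 (by positivity)
      _ = lam * L * (∑ x ∈ U, a x * μ x) ^ 2 := by ring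
      _ ≤ lam * L * (30 * O) := mul_le_mul_of_nonneg_left h4 (by positivity)
      _ = _ := by ring
  · have hnn : ∀ y j, 0 ≤ t ^ 2 / 4 ^ j * ∑ x ∈ S j, e y x * μ x := fun y j =>
      mul_nonneg (by positivity) (Finset.sum_nonneg fun x _ => mul_nonneg (he0 y x) (hμ x))
    calc ∑ y ∈ F, t ^ 2 / 4 ^ lv y * ∑ x ∈ S (lv y), e y x * μ x
        ≤ ∑ y ∈ F, ∑ j ∈ F.image lv, t ^ 2 / 4 ^ j * ∑ x ∈ S j, e y x * μ x :=
          Finset.sum_le_sum fun y hy =>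
            Finset.single_le_sum (f := fun j => t ^ 2 / 4 ^ j * ∑ x ∈ S j, e y x * μ x)
              (fun j _ => hnn y j) (Finset.mem_image_of_mem lv hy)
      _ = ∑ j ∈ F.image lv, t ^ 2 / 4 ^ j * ∑ x ∈ S j, (∑ y ∈ F, e y x) * μ x := by
          rw [Finset.sum_comm]
          refine Finset.sum_congr rfl fun j _ => ?_
          rw [← Finset.mul_sum, Finset.sum_comm]
          simp only [Finset.sum_mul]
      _ ≤ ∑ j ∈ F.image lv, t ^ 2 / 4 ^ j * (lam * ∑ x ∈ S j, μ x) := by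
          refine Finset.sum_le_sum fun j _ => mul_le_mul_of_nonneg_left ?_ (by positivity)
          rw [Finset.mul_sum]
          exact Finset.sum_le_sum fun x _ => mul_le_mul_of_nonneg_right (hsum x) (hμ x)
      _ = ∑ j ∈ (F.image lv).filter (fun j => (S j).Nonempty),
            t ^ 2 / 4 ^ j * (lam * ∑ x ∈ S j, μ x) := by
          rw [Finset.sum_filter]
          refine Finset.sum_congr rfl fun j _ => ?_
          by_cases h : (S j).Nonempty
          · simp [h]
          · simp [Finset.not_nonempty_iff_eq_empty.1 h]
      _ = _ := by
          rw [Finset.mul_sum]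
          exact Finset.sum_congr rfl fun j _ => by ring

end Levels

/-! ## Private channels are dominated by randomized response on intervals -/

section Domination

variable {X Y : Type}

/-- The share of `p` in `p + q`; it orders `X` as the likelihood ratio does. -/
noncomputable def share (p q : X → ℝ) (x : X) : ℝ := p x / (p x + q x)

lemma sub_eq_share {p q : X → ℝ} (hp : ∀ x, 0 ≤ p x) (hq : ∀ x, 0 ≤ q x) (x : X) :
    p x - q x = (2 * share p q x - 1) * (p x + q x) := by
  rcases (add_nonneg (hp x) (hq x)).eq_or_lt with h | h
  · have h1 : p x = 0 := by linarith [hp x, hq x]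
    have h2 : q x = 0 := by linarith [hp x, hq x]
    simp [h1, h2]
  · unfold share
    field_simp
    ring

lemma share_nonneg {p q : X → ℝ} (hp : ∀ x, 0 ≤ p x) (hq : ∀ x, 0 ≤ q x) (x : X) :
    0 ≤ share p q x := div_nonneg (hp x) (add_nonneg (hp x) (hq x))

lemma share_le_one {p q : X → ℝ} (hp : ∀ x, 0 ≤ p x) (hq : ∀ x, 0 ≤ q x) (x : X) :
    share p q x ≤ 1 := div_le_one_of_le₀ (by linarith [hq x]) (add_nonneg (hp x) (hq x))

/-- On a level of mass `W` the sum of `a μ` is at least `t W / 2 ^ (j + 1)`, and heaviness gives `2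
+ L W ≤ 3 L W`. The constant `12` is `3` times the `4` lost from the dyadic factor two, squared. -/
lemma LevelFamily.value_le {a μ : X → ℝ} (hμ : ∀ x, 0 ≤ μ x) {L t : ℝ} (hL : 0 < L)
    {S : ℕ → Finset X} {J : Finset ℕ} (h : LevelFamily a μ L t S J) {s : ℕ} {O : ℝ}
    (hO : BoundsClusters L a (fun x => a x * μ x) μ s O) {J' : Finset ℕ} (hJ' : J' ⊆ J)
    (hcard : J'.card ≤ s) :
    ∑ j ∈ J', t ^ 2 / 4 ^ j * ∑ x ∈ S j, μ x ≤ 12 * (L * O) := by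
  have h1 := hO J' S hcard h.disjoint h.convex
  calc ∑ j ∈ J', t ^ 2 / 4 ^ j * ∑ x ∈ S j, μ x
      ≤ ∑ j ∈ J', 12 * (L * clusterValue L (fun x => a x * μ x) μ (S j)) := by
        refine Finset.sum_le_sum fun j hj => ?_
        have hW := h.heavy j (hJ' hj)
        set W := ∑ x ∈ S j, μ x with hWdef
        have hWpos : 0 < W := by
          by_contra hcon
          have : L * W ≤ 0 := mul_nonpos_of_nonneg_of_nonpos hL.le (not_lt.1 hcon)
          linarith
        have hD : t / 2 ^ (j + 1) * W ≤ ∑ x ∈ S j, a x * μ x := by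
          rw [hWdef, Finset.mul_sum]
          exact Finset.sum_le_sum fun x hx =>
            mul_le_mul_of_nonneg_right (h.lt j x hx).le (hμ x)
        have h0 : 0 ≤ t / 2 ^ (j + 1) * W :=
          mul_nonneg (div_nonneg h.nonneg (by positivity)) hWpos.le
        unfold clusterValue
        calc t ^ 2 / 4 ^ j * W = 12 * (L * ((t / 2 ^ (j + 1) * W) ^ 2 / (3 * (L * W)))) := by
              have : (4 : ℝ) ^ j = (2 ^ j) ^ 2 := by rw [← pow_mul, mul_comm, pow_mul]; norm_num
              rw [this]
              field_simp
              ring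
          _ ≤ 12 * (L * ((∑ x ∈ S j, a x * μ x) ^ 2 / (2 + L * W))) := by
              gcongr
              linarith
    _ = 12 * (L * ∑ j ∈ J', clusterValue L (fun x => a x * μ x) μ (S j)) := by
        simp only [Finset.mul_sum]
    _ ≤ _ := by gcongr

lemma LevelFamily.weight_le_of_card {a μ : X → ℝ} (hμ : ∀ x, 0 ≤ μ x) {L t : ℝ} (hL : 0 < L)
    {S : ℕ → Finset X} {J : Finset ℕ} (h : LevelFamily a μ L t S J) {s : ℕ} (hs : 1 ≤ s) {O : ℝ}
    (hO : BoundsClusters L a (fun x => a x * μ x) μ s O) {J' : Finset ℕ} (hJ' : J' ⊆ J) :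
    s * ∑ j ∈ J', t ^ 2 / 4 ^ j * ∑ x ∈ S j, μ x ≤ (J'.card + s) * (12 * (L * O)) := by
  obtain ⟨J'', h1, h2, h3⟩ := exists_subset_sum_ge J'
    (fun j => t ^ 2 / 4 ^ j * ∑ x ∈ S j, μ x)
    (fun j => mul_nonneg (by positivity) (Finset.sum_nonneg fun x _ => hμ x)) s
  exact h3.trans (mul_le_mul_of_nonneg_left (h.value_le hμ hL hO (h1.trans hJ') h2)
    (by positivity))

variable [Fintype X]

/-- Disjoint sets of mass at least `1 / L` share a total mass of at most `2`. -/
lemma LevelFamily.card_le {a μ : X → ℝ} (hμ : ∀ x, 0 ≤ μ x) (hμ2 : ∑ x, μ x ≤ 2) {L t : ℝ}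
    (hL : 0 < L) {S : ℕ → Finset X} {J : Finset ℕ} (h : LevelFamily a μ L t S J) :
    (J.card : ℝ) ≤ 2 * L := by
  classical
  calc (J.card : ℝ) = ∑ j ∈ J, 1 := by simp
    _ ≤ ∑ j ∈ J, L * ∑ x ∈ S j, μ x := Finset.sum_le_sum h.heavy
    _ = L * ∑ x ∈ J.biUnion S, μ x := by
        rw [Finset.sum_biUnion fun i _ j _ hij => h.disjoint i j hij, Finset.mul_sum]
    _ ≤ L * ∑ x, μ x := by
        gcongr
        · exact fun x _ _ => hμ x
        · exact Finset.subset_univ _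
    _ ≤ _ := by nlinarith

lemma LevelFamily.tail_le {a μ : X → ℝ} (hμ : ∀ x, 0 ≤ μ x) (hμ2 : ∑ x, μ x ≤ 2) {L t : ℝ}
    {S : ℕ → Finset X} {J : Finset ℕ} (h : LevelFamily a μ L t S J) (K : ℕ) :
    ∑ j ∈ J with K ≤ j, t ^ 2 / 4 ^ j * ∑ x ∈ S j, μ x ≤ 2 / 4 ^ K := by
  classical
  have ht : t ^ 2 ≤ 1 := pow_le_one₀ h.nonneg h.le_one
  calc ∑ j ∈ J with K ≤ j, t ^ 2 / 4 ^ j * ∑ x ∈ S j, μ x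
      ≤ ∑ j ∈ J with K ≤ j, 1 / 4 ^ K * ∑ x ∈ S j, μ x := by
        refine Finset.sum_le_sum fun j hj => ?_
        have : K ≤ j := (Finset.mem_filter.1 hj).2
        refine mul_le_mul_of_nonneg_right ?_ (Finset.sum_nonneg fun x _ => hμ x)
        gcongr
        norm_num
    _ = 1 / 4 ^ K * ∑ x ∈ (J.filter (K ≤ ·)).biUnion S, μ x := by
        rw [Finset.sum_biUnion fun i _ j _ hij => h.disjoint i j hij, Finset.mul_sum]
    _ ≤ 1 / 4 ^ K * 2 := by
        gcongr
        exact (Finset.sum_le_sum_of_subset_of_nonneg (Finset.subset_univ _)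
          fun x _ _ => hμ x).trans hμ2
    _ = _ := by ring

lemma exists_row_min {T : Matrix Y X ℝ} {ε : ℝ} (hT : T ∈ ldpChannels X Y ε) (y : Y) :
    ∃ m, 0 ≤ m ∧ ∀ x, m ≤ T y x ∧ T y x ≤ Real.exp ε * m := by
  cases isEmpty_or_nonempty X
  · exact ⟨0, le_rfl, fun x => isEmptyElim x⟩
  · obtain ⟨x₀, -, h⟩ := Finset.exists_min_image Finset.univ (T y) Finset.univ_nonempty
    exact ⟨T y x₀, hT.1.1 y x₀, fun x => ⟨h x (Finset.mem_univ x), hT.2 x x₀ y⟩⟩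

/-- A bound on the partial sums of the triangular discrimination after a private channel, from
bounds on the families of level sets on both sides. -/
lemma triDisc_partial_le {p q : X → ℝ} (hp : p ∈ stdSimplex ℝ X) (hq : q ∈ stdSimplex ℝ X)
    {T : Matrix Y X ℝ} {ε L : ℝ} (hT : T ∈ ldpChannels X Y ε) (hε : 0 ≤ ε)
    (hLdef : L = Real.exp ε - 1) {s : ℕ}
    (hs : 1 ≤ s) {O G : ℝ}
    (hO : BoundsClusters L (share p q) (fun x => p x - q x) (fun x => p x + q x) s O)
    (F : Finset Y) (hG0 : 0 ≤ G)
    (hG : ∀ a : X → ℝ, 0 < L →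
      BoundsClusters L a (fun x => a x * (p x + q x)) (fun x => p x + q x) s O →
      ∀ t S J, LevelFamily a (fun x => p x + q x) L t S J → J.card ≤ F.card →
        min 1 L * ∑ j ∈ J, t ^ 2 / 4 ^ j * ∑ x ∈ S j, (p x + q x) ≤ G) :
    ∑ y ∈ F, ((T *ᵥ p) y - (T *ᵥ q) y) ^ 2 / ((T *ᵥ p) y + (T *ᵥ q) y)
      ≤ 4 * (30 * (min 1 L * L * O) + 8 * G) := by
  have hμ : ∀ x, 0 ≤ p x + q x := fun x => add_nonneg (hp.1 x) (hq.1 x)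
  have hL0 : 0 ≤ L := by linarith [Real.one_le_exp hε]
  have hO0 : 0 ≤ O := by simpa using hO ∅ (fun _ => ∅) (by simp) (by simp) (by simp [OrdConvex])
  choose m hm0 hm using exists_row_min hT
  set e : Y → X → ℝ := fun y x => T y x - m y with he_def
  have he0 : ∀ y x, 0 ≤ e y x := fun y x => sub_nonneg.2 (hm y x).1
  have he : ∀ y x, e y x ≤ L * m y := fun y x => by
    have := (hm y x).2
    simp only [he_def, hLdef]
    linarith
  -- The constant `m y` drops out of the difference because `p - q` has total `0`, and leaves `2 * m
  -- y` in the sum because `p + q` has total `2`.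
  have hnum : ∀ y, (T *ᵥ p) y - (T *ᵥ q) y = ∑ x, e y x * (p x - q x) := by
    intro y
    have h1 : ∑ x, (p x - q x) = 0 := by rw [Finset.sum_sub_distrib, hp.2, hq.2, sub_self]
    have h2 : ∑ x, e y x * (p x - q x)
        = ∑ x, T y x * p x - ∑ x, T y x * q x - m y * ∑ x, (p x - q x) := by
      rw [Finset.mul_sum, ← Finset.sum_sub_distrib, ← Finset.sum_sub_distrib]
      exact Finset.sum_congr rfl fun x _ => by simp only [he_def]; ring
    rw [h2, h1, mul_zero, sub_zero]
    rfl
  have hden : ∀ y, (T *ᵥ p) y + (T *ᵥ q) y = 2 * m y + ∑ x, e y x * (p x + q x) := by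
    intro y
    have h1 : ∑ x, (p x + q x) = 2 := by rw [Finset.sum_add_distrib, hp.2, hq.2]; norm_num
    have h2 : ∑ x, e y x * (p x + q x)
        = ∑ x, T y x * p x + ∑ x, T y x * q x - m y * ∑ x, (p x + q x) := by
      rw [Finset.mul_sum, ← Finset.sum_add_distrib, ← Finset.sum_sub_distrib]
      exact Finset.sum_congr rfl fun x _ => by simp only [he_def]; ring
    rw [h2, h1, mul_comm (m y), add_sub_cancel]
    rfl
  simp only [hnum, hden]
  rcases hL0.eq_or_lt with hL | hL
  · have hz : ∀ y x, e y x = 0 := fun y x => le_antisymm (by simpa [← hL] using he y x) (he0 y x)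
    simp [hz, ← hL]
    positivity
  have hlam : 0 ≤ min 1 L := le_min zero_le_one hL0
  -- Both `e ≤ T` and `e ≤ L * T` hold, and the columns of `T` sum to `1`.
  have hsum : ∀ x, ∑ y ∈ F, e y x ≤ min 1 L := by
    intro x
    have h1 : ∑ y ∈ F, T y x ≤ 1 := sum_le_hasSum F (fun y _ => hT.1.1 y x) (hT.1.2 x)
    refine le_min (le_trans (Finset.sum_le_sum fun y _ => ?_) h1) ?_
    · simp only [he_def]; linarith [hm0 y]
    · calc ∑ y ∈ F, e y x ≤ ∑ y ∈ F, L * T y x := Finset.sum_le_sum fun y _ =>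
            (he y x).trans (mul_le_mul_of_nonneg_left (hm y x).1 hL0)
        _ = L * ∑ y ∈ F, T y x := by rw [Finset.mul_sum]
        _ ≤ L * 1 := mul_le_mul_of_nonneg_left h1 hL0
        _ = L := mul_one L
  have hside : ∀ a : X → ℝ, (∀ x, a x ≤ 1) →
      BoundsClusters L a (fun x => a x * (p x + q x)) (fun x => p x + q x) s O →
      ∑ y ∈ F, (∑ x, e y x * (max (a x) 0 * (p x + q x))) ^ 2
          / (2 * m y + ∑ x, e y x * (p x + q x))
        ≤ 30 * (min 1 L * L * O) + 8 * G := by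
    intro a ha hOa
    obtain ⟨S, J, t, hfam, hcard, hle⟩ := one_sided a (fun x => p x + q x) ha hμ hL hs hOa F m e
      hm0 he0 he hsum hlam
    have := hG a hL hOa t S J hfam hcard
    linarith
  have hd := sub_eq_share hp.1 hq.1
  -- The variable `2 * share - 1` is `(p - q) / (p + q)`. It and its negative have the same
  -- intervals as the share, and cluster values see only the square of `p - q`, so the bound `O`
  -- transfers to both sides.
  have hpos := hside (fun x => 2 * share p q x - 1)
    (fun x => by linarith [share_le_one hp.1 hq.1 x]) (by
      intro J S h1 h2 h3
      have := hO J S h1 h2 fun j x hx z hz w hw1 hw2 =>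
        h3 j x hx z hz w (by linarith) (by linarith)
      simpa only [hd] using this)
  have hneg := hside (fun x => -(2 * share p q x - 1))
    (fun x => by linarith [share_nonneg hp.1 hq.1 x]) (by
      intro J S h1 h2 h3
      have := hO J S h1 h2 fun j x hx z hz w hw1 hw2 =>
        h3 j z hz x hx w (by linarith) (by linarith)
      simpa only [hd, clusterValue, neg_mul, Finset.sum_neg_distrib, neg_sq] using this)
  have hrow : ∀ y, (∑ x, e y x * (p x - q x)) ^ 2 / (2 * m y + ∑ x, e y x * (p x + q x))
      ≤ 2 * ((∑ x, e y x * (max (2 * share p q x - 1) 0 * (p x + q x))) ^ 2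
          / (2 * m y + ∑ x, e y x * (p x + q x)))
        + 2 * ((∑ x, e y x * (max (-(2 * share p q x - 1)) 0 * (p x + q x))) ^ 2
          / (2 * m y + ∑ x, e y x * (p x + q x))) := by
    intro y
    have hE : 0 ≤ 2 * m y + ∑ x, e y x * (p x + q x) :=
      add_nonneg (mul_nonneg zero_le_two (hm0 y))
        (Finset.sum_nonneg fun x _ => mul_nonneg (he0 y x) (hμ x))
    rw [← mul_div_assoc, ← mul_div_assoc, ← add_div]
    apply div_le_div_of_nonneg_right _ hE
    have h1 : ∑ x, e y x * (p x - q x)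
        = ∑ x, e y x * (max (2 * share p q x - 1) 0 * (p x + q x))
          - ∑ x, e y x * (max (-(2 * share p q x - 1)) 0 * (p x + q x)) := by
      rw [← Finset.sum_sub_distrib]
      refine Finset.sum_congr rfl fun x _ => ?_
      rw [hd x]
      rcases le_total (2 * share p q x - 1) 0 with h | h
      · rw [max_eq_right h, max_eq_left (by linarith)]; ring
      · rw [max_eq_left h, max_eq_right (by linarith)]; ring
    rw [h1]
    nlinarith [sq_nonneg (∑ x, e y x * (max (2 * share p q x - 1) 0 * (p x + q x))
      + ∑ x, e y x * (max (-(2 * share p q x - 1)) 0 * (p x + q x)))]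
  refine (Finset.sum_le_sum fun y _ => hrow y).trans ?_
  rw [Finset.sum_add_distrib, ← Finset.mul_sum, ← Finset.mul_sum]
  linarith

lemma sum_add_eq_two {p q : X → ℝ} (hp : p ∈ stdSimplex ℝ X) (hq : q ∈ stdSimplex ℝ X) :
    ∑ x, (p x + q x) = 2 := by
  rw [Finset.sum_add_distrib, hp.2, hq.2]; norm_num

/-- Private channels with `ℓ` outputs. -/
lemma triDisc_le_of_fin {p q : X → ℝ} (hp : p ∈ stdSimplex ℝ X) (hq : q ∈ stdSimplex ℝ X)
    {ℓ : ℕ} (hℓ : 1 < ℓ) {T : Matrix (Fin ℓ) X ℝ} {ε L : ℝ} (hT : T ∈ ldpChannels X (Fin ℓ) ε)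
    (hε : 0 ≤ ε) (hLdef : L = Real.exp ε - 1) {s : ℕ} (hs : 1 ≤ s)
    (hs' : s = ℓ - 1 ∨ 2 * L < s) {O : ℝ}
    (hO : BoundsClusters L (share p q) (fun x => p x - q x) (fun x => p x + q x) s O) :
    triDisc (T *ᵥ p) (T *ᵥ q) ≤ 1272 * (min 1 L * L * O) := by
  have hμ : ∀ x, 0 ≤ p x + q x := fun x => add_nonneg (hp.1 x) (hq.1 x)
  have hL0 : 0 ≤ L := by linarith [Real.one_le_exp hε]
  have hO0 : 0 ≤ O := by simpa using hO ∅ (fun _ => ∅) (by simp) (by simp) (by simp [OrdConvex])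
  have hlam : 0 ≤ min 1 L := le_min zero_le_one hL0
  -- At most `2 * s` levels occur, so averaging over the best `s` of them costs a factor `3`, whence
  -- `36 = 3 * 12`. The final constant is `4 * (30 + 8 * 36) = 1272`.
  have h := triDisc_partial_le hp hq hT hε hLdef hs hO Finset.univ
    (G := 36 * (min 1 L * L * O)) (by positivity) (by
      intro a hL hOa t S J hfam hcard
      have h1 := hfam.weight_le_of_card hμ hL hs hOa subset_rfl
      have h2 := hfam.card_le hμ (sum_add_eq_two hp hq).le hL
      have h3 : (J.card : ℝ) ≤ 2 * s := by
        -- Either `|J| ≤ ℓ ≤ 2 * (ℓ - 1) = 2 * s`, or `|J| ≤ 2 * L < s`.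
        rcases hs' with hs' | hs'
        · rw [Finset.card_univ, Fintype.card_fin] at hcard
          have : J.card ≤ 2 * s := by omega
          exact_mod_cast this
        · linarith [(Nat.cast_nonneg s : (0 : ℝ) ≤ s)]
      have hspos : (0 : ℝ) < s := by exact_mod_cast hs
      have h4 : ∑ j ∈ J, t ^ 2 / 4 ^ j * ∑ x ∈ S j, (p x + q x) ≤ 36 * (L * O) := by
        refine le_of_mul_le_mul_left (h1.trans ?_) hspos
        have : 0 ≤ L * O := by positivity
        nlinarith
      calc _ ≤ min 1 L * (36 * (L * O)) := mul_le_mul_of_nonneg_left h4 hlam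
        _ = _ := by ring)
  unfold triDisc
  rw [tsum_fintype]
  linarith

/-- Private channels with countably many outputs. -/
lemma triDisc_le_of_countable {p q : X → ℝ} (hp : p ∈ stdSimplex ℝ X) (hq : q ∈ stdSimplex ℝ X)
    {ℓ : ℕ} (hℓ : 1 < ℓ) {T : Matrix Y X ℝ} {ε L : ℝ} (hT : T ∈ ldpChannels X Y ε)
    (hε : 0 ≤ ε) (hLdef : L = Real.exp ε - 1) {s : ℕ} (hs : 1 ≤ s)
    (hs' : s = ℓ - 1 ∨ 2 * L < s) {O : ℝ}
    (hO : BoundsClusters L (share p q) (fun x => p x - q x) (fun x => p x + q x) s O) (K : ℕ) :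
    triDisc (T *ᵥ p) (T *ᵥ q) ≤ 504 * (min 1 L * L * O) * (1 + K / (ℓ - 1)) + 64 / 4 ^ K := by
  have hμ : ∀ x, 0 ≤ p x + q x := fun x => add_nonneg (hp.1 x) (hq.1 x)
  have hL0 : 0 ≤ L := by linarith [Real.one_le_exp hε]
  have hO0 : 0 ≤ O := by simpa using hO ∅ (fun _ => ∅) (by simp) (by simp) (by simp [OrdConvex])
  have hlam : 0 ≤ min 1 L := le_min zero_le_one hL0
  have hl : (0 : ℝ) < ℓ - 1 := by
    have : (1 : ℝ) < ℓ := by exact_mod_cast hℓ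
    linarith
  have hKl : (0 : ℝ) ≤ K / (ℓ - 1) := by positivity
  refine Real.tsum_le_of_sum_le (fun y => div_nonneg (sq_nonneg _)
    (add_nonneg ((hT.1.isDist_mulVec hp).1 y) ((hT.1.isDist_mulVec hq).1 y))) fun F => ?_
  have h := triDisc_partial_le hp hq hT hε hLdef hs hO F
    (G := 12 * (min 1 L * L * O) * (1 + K / (ℓ - 1)) + 2 / 4 ^ K) (by positivity) (by
      intro a hL hOa t S J hfam _
      -- Fewer than `K + 1` levels have index below `K`. Averaging over `s = ℓ - 1` of them costs
      -- `(K + s) / s`, and if `2 * L < s` all heavy levels already fit into one family.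
      have h1 : ∑ j ∈ J with ¬ K ≤ j, t ^ 2 / 4 ^ j * ∑ x ∈ S j, (p x + q x)
          ≤ 12 * (L * O) * (1 + K / (ℓ - 1)) := by
        have hLO : 0 ≤ 12 * (L * O) := by positivity
        rcases hs' with hs' | hs'
        · have h2 := hfam.weight_le_of_card hμ hL hs hOa
            (Finset.filter_subset (fun j => ¬ K ≤ j) J)
          have h3 : (J.filter fun j => ¬ K ≤ j).card ≤ K := by
            have : (J.filter fun j => ¬ K ≤ j) ⊆ Finset.range K := fun j hj => by
              simpa using (Finset.mem_filter.1 hj).2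
            simpa using Finset.card_le_card this
          have hsl : (s : ℝ) = ℓ - 1 := by rw [hs', Nat.cast_sub (by omega)]; simp
          refine le_of_mul_le_mul_left (h2.trans ?_) (hsl ▸ hl : (0 : ℝ) < s)
          have h3' : ((J.filter fun j => ¬ K ≤ j).card : ℝ) ≤ K := by exact_mod_cast h3
          have e : (s : ℝ) * (12 * (L * O) * (1 + K / (ℓ - 1))) = (K + s) * (12 * (L * O)) := by
            rw [hsl]
            field_simp
            ring
          rw [e]
          exact mul_le_mul_of_nonneg_right (by linarith) hLO
        · have h2 := hfam.card_le hμ (sum_add_eq_two hp hq).le hL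
          have h3 : J.card ≤ s := by
            have : (J.card : ℝ) ≤ s := by linarith
            exact_mod_cast this
          have h4 := hfam.value_le hμ hL hOa (Finset.filter_subset (fun j => ¬ K ≤ j) J)
            ((Finset.card_filter_le _ _).trans h3)
          nlinarith
      have h2 := hfam.tail_le hμ (sum_add_eq_two hp hq).le K
      rw [← Finset.sum_filter_add_sum_filter_not J (K ≤ ·), mul_add]
      have h3 : min 1 L * ∑ j ∈ J with K ≤ j, t ^ 2 / 4 ^ j * ∑ x ∈ S j, (p x + q x)
          ≤ 2 / 4 ^ K :=
        (mul_le_mul_of_nonneg_left h2 hlam).trans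
          (mul_le_of_le_one_left (by positivity) (min_le_left _ _))
      have h4 := mul_le_mul_of_nonneg_left h1 hlam
      have e : min 1 L * (12 * (L * O) * (1 + K / (ℓ - 1)))
        = 12 * (min 1 L * L * O) * (1 + K / (ℓ - 1)) := by ring
      linarith)
  have hV : 0 ≤ min 1 L * L * O := by positivity
  have e : (64 : ℝ) / 4 ^ K = 4 * (8 * (2 / 4 ^ K)) := by ring
  nlinarith [mul_nonneg hV hKl]

end Domination

/-! ## Randomized response on intervals -/

section Response

/-- The largest `i < n` with `P i`, and `s` if there is none. -/
noncomputable def lastHit (s : ℕ) (P : ℕ → Prop) : ℕ → ℕ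
  | 0 => s
  | n + 1 => open Classical in if P n then n else lastHit s P n

lemma lastHit_congr {s : ℕ} {P Q : ℕ → Prop} {n : ℕ} (h : ∀ i < n, (P i ↔ Q i)) :
    lastHit s P n = lastHit s Q n := by
  induction n with
  | zero => rfl
  | succ n ih =>
    have hn := h n (by omega)
    simp only [lastHit, ih fun i hi => h i (by omega)]
    by_cases hQ : Q n <;> simp [hQ, hn]

lemma lastHit_spec (s : ℕ) (P : ℕ → Prop) (n : ℕ) :
    (lastHit s P n = s ∧ ∀ i < n, ¬ P i) ∨ (lastHit s P n < n ∧ P (lastHit s P n)) := by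
  induction n with
  | zero => exact Or.inl ⟨rfl, by simp⟩
  | succ n ih =>
    by_cases h : P n
    · simp [lastHit, h]
    · simp only [lastHit, h, if_false]
      rcases ih with ⟨h1, h2⟩ | ⟨h1, h2⟩
      · refine Or.inl ⟨h1, fun i hi => ?_⟩
        rcases Nat.lt_succ_iff_lt_or_eq.1 hi with h3 | rfl
        · exact h2 i h3
        · exact h
      · exact Or.inr ⟨by omega, h2⟩

lemma lastHit_le (s : ℕ) (P : ℕ → Prop) : lastHit s P s ≤ s := by
  rcases lastHit_spec s P s with h | h <;> omega

lemma lastHit_pred {s : ℕ} {P : ℕ → Prop} (h : lastHit s P s < s) : P (lastHit s P s) := by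
  rcases lastHit_spec s P s with h' | h'
  · omega
  · exact h'.2

lemma lastHit_lt {s : ℕ} {P : ℕ → Prop} {i : ℕ} (hi : i < s) (h : P i) : lastHit s P s < s := by
  rcases lastHit_spec s P s with h' | h'
  · exact absurd h (h'.2 i hi)
  · exact h'.1

variable {X : Type}

/-- The cluster of `x`: the last `i < s` for which `b x` lies between `b (c i)` and
`b (c (s + i))`, and `s` if there is none. -/
noncomputable def clusterOf (b : X → ℝ) (c : ℕ → X) (s : ℕ) (x : X) : ℕ :=
  lastHit s (fun i => b (c i) ≤ b x ∧ b x ≤ b (c (s + i))) s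

lemma OrdConvex.exists_endpoints {b : X → ℝ} {S : Finset X} (h : OrdConvex b S)
    (hS : S.Nonempty) : ∃ u v, ∀ w, w ∈ S ↔ b u ≤ b w ∧ b w ≤ b v := by
  obtain ⟨u, hu, humin⟩ := S.exists_min_image b hS
  obtain ⟨v, hv, hvmax⟩ := S.exists_max_image b hS
  exact ⟨u, v, fun w => ⟨fun hw => ⟨humin w hw, hvmax w hw⟩, fun hw => h u hu v hv w hw.1 hw.2⟩⟩

/-- Unused indices repeat an element of `J`, so that all `s` pairs of end points are defined. -/
lemma exists_enumeration {J : Finset ℕ} (hJ : J.Nonempty) {s : ℕ} (hs : J.card ≤ s) :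
    ∃ e : ℕ → ℕ, (∀ i, e i ∈ J) ∧ ∀ j ∈ J, ∃ i < s, e i = j := by
  obtain ⟨j₀, hj₀⟩ := hJ
  refine ⟨fun i => if h : i < J.card then J.equivFin.symm ⟨i, h⟩ else j₀, fun i => ?_,
    fun j hj => ⟨J.equivFin ⟨j, hj⟩, (J.equivFin ⟨j, hj⟩).2.trans_le hs, ?_⟩⟩
  · by_cases h : i < J.card <;> simp [h, hj₀]
  · simp

/-- For a finite ratio `r` the share is `r / (1 + r)`, and the conventions agree at the ends: ratio
`∞` has share `1`, and `0 / 0` gives `0` in both. The share is always a real number, so the program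
can compute with it. -/
lemma share_lt_share_iff {p q : X → ℝ} (hp : ∀ x, 0 ≤ p x) (hq : ∀ x, 0 ≤ q x) (x x' : X) :
    likelihoodRatio p q x < likelihoodRatio p q x' ↔ share p q x < share p q x' := by
  unfold likelihoodRatio share
  have h0 : ∀ x, q x = 0 → ENNReal.ofReal (p x) / ENNReal.ofReal (q x)
      = if p x = 0 then 0 else ⊤ := by
    intro x h
    split_ifs with h1
    · simp [h1]
    · rw [h, ENNReal.ofReal_zero, ENNReal.div_zero]
      simpa using lt_of_le_of_ne (hp x) (Ne.symm h1)
  have h1 : ∀ x, q x ≠ 0 → ENNReal.ofReal (p x) / ENNReal.ofReal (q x)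
      = ENNReal.ofReal (p x / q x) := fun x h =>
    (ENNReal.ofReal_div_of_pos (lt_of_le_of_ne (hq x) (Ne.symm h))).symm
  by_cases hx : q x = 0 <;> by_cases hx' : q x' = 0
  · rw [h0 x hx, h0 x' hx', hx, hx']
    by_cases h2 : p x = 0 <;> by_cases h3 : p x' = 0 <;> simp [h2, h3]
  · rw [h0 x hx, h1 x' hx', hx]
    have hq' : 0 < q x' := lt_of_le_of_ne (hq x') (Ne.symm hx')
    by_cases h2 : p x = 0
    · simp only [h2, if_true, zero_div, ENNReal.ofReal_pos]
      rw [div_pos_iff_of_pos_right hq']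
      constructor
      · intro h; have := hp x'; positivity
      · intro h
        refine lt_of_le_of_ne (hp x') fun h3 => ?_
        simp [← h3] at h
    · simp only [h2, if_false, not_top_lt, add_zero, div_self h2, false_iff, not_lt]
      exact div_le_one_of_le₀ (by linarith) (by linarith [hp x'])
  · rw [h1 x hx, h0 x' hx', hx']
    have hq' : 0 < q x := lt_of_le_of_ne (hq x) (Ne.symm hx)
    by_cases h3 : p x' = 0
    · simp only [h3, if_true, not_lt_zero, add_zero, zero_div, false_iff, not_lt]
      exact div_nonneg (hp x) (by linarith [hp x])
    · simp only [h3, if_false, ENNReal.ofReal_lt_top, add_zero, div_self h3, true_iff]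
      rw [div_lt_one (by linarith [hp x])]
      linarith
  · have hqx : 0 < q x := lt_of_le_of_ne (hq x) (Ne.symm hx)
    have hqx' : 0 < q x' := lt_of_le_of_ne (hq x') (Ne.symm hx')
    rw [h1 x hx, h1 x' hx', ENNReal.ofReal_lt_ofReal_iff']
    have e1 : p x / (p x + q x) < p x' / (p x' + q x') ↔ p x * q x' < p x' * q x := by
      rw [div_lt_div_iff₀ (by linarith [hp x]) (by linarith [hp x'])]
      constructor <;> intro h <;> linarith
    have e2 : p x / q x < p x' / q x' ↔ p x * q x' < p x' * q x := div_lt_div_iff₀ hqx hqx'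
    rw [e1, e2]
    constructor
    · exact fun h => h.1
    · intro h
      refine ⟨h, ?_⟩
      have : 0 < p x' := by
        refine lt_of_le_of_ne (hp x') fun h3 => ?_
        rw [← h3] at h
        have := mul_nonneg (hp x) hqx'.le
        linarith
      positivity

/-- The number of interval end points to the left of `x`. -/
noncomputable def endpointCount (b : X → ℝ) (c : ℕ → X) (s : ℕ) (x : X) : ℕ :=
  ((Finset.range s).filter fun i => b (c i) ≤ b x).card
    + ((Finset.range s).filter fun i => b (c (s + i)) < b x).card

lemma endpointCount_le (b : X → ℝ) (c : ℕ → X) (s : ℕ) (x : X) :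
    endpointCount b c s x ≤ 2 * s := by
  have h1 := Finset.card_filter_le (Finset.range s) fun i => b (c i) ≤ b x
  have h2 := Finset.card_filter_le (Finset.range s) fun i => b (c (s + i)) < b x
  rw [Finset.card_range] at h1 h2
  exact (Nat.add_le_add h1 h2).trans (by omega)

lemma endpointCount_mono {b : X → ℝ} (c : ℕ → X) (s : ℕ) {x x' : X} (h : b x ≤ b x') :
    endpointCount b c s x ≤ endpointCount b c s x' := by
  exact Nat.add_le_add
    (Finset.card_le_card (Finset.monotone_filter_right _ fun i _ hi => le_trans hi h))
    (Finset.card_le_card (Finset.monotone_filter_right _ fun i _ hi => lt_of_lt_of_le hi h))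

/-- Both sets of counted end points grow with `b x`, so equal totals force equal sets, and these
sets decide every comparison in the definition of the cluster. -/
lemma clusterOf_eq_of_endpointCount_eq {b : X → ℝ} (c : ℕ → X) (s : ℕ) {x x' : X}
    (h : endpointCount b c s x = endpointCount b c s x') :
    clusterOf b c s x = clusterOf b c s x' := by
  wlog hle : b x ≤ b x' generalizing x x'
  · exact (this h.symm (not_le.1 hle).le).symm
  have s1 : (Finset.range s).filter (fun i => b (c i) ≤ b x)
      ⊆ (Finset.range s).filter (fun i => b (c i) ≤ b x') :=
    Finset.monotone_filter_right _ fun i _ hi => le_trans hi hle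
  have s2 : (Finset.range s).filter (fun i => b (c (s + i)) < b x)
      ⊆ (Finset.range s).filter (fun i => b (c (s + i)) < b x') :=
    Finset.monotone_filter_right _ fun i _ hi => lt_of_lt_of_le hi hle
  have h' : ((Finset.range s).filter fun i => b (c i) ≤ b x).card
      + ((Finset.range s).filter fun i => b (c (s + i)) < b x).card
      = ((Finset.range s).filter fun i => b (c i) ≤ b x').card
      + ((Finset.range s).filter fun i => b (c (s + i)) < b x').card := h
  have c1 := Finset.card_le_card s1
  have c2 := Finset.card_le_card s2
  have e1 := Finset.eq_of_subset_of_card_le s1 (by omega)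
  have e2 := Finset.eq_of_subset_of_card_le s2 (by omega)
  refine lastHit_congr fun i hi => ?_
  have f1 := Finset.ext_iff.1 e1 i
  have f2 := Finset.ext_iff.1 e2 i
  simp only [Finset.mem_filter, Finset.mem_range, hi, true_and] at f1 f2
  rw [f1, ← not_lt (a := b (c (s + i))), f2, not_lt]

/-- Randomized response with `s + 1` of `ℓ` answers, applied to `f`. -/
noncomputable def responseChannel (E : ℝ) (ℓ s : ℕ) (f : X → ℕ) : Matrix (Fin ℓ) X ℝ :=
  Matrix.of fun y x => if y.val ≤ s then (if f x = y.val then E else 1) / (s + E) else 0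

lemma responseChannel_mem {ε : ℝ} (hε : 0 ≤ ε) {ℓ s : ℕ} (hs : s < ℓ) {f : X → ℕ}
    (hf : ∀ x, f x ≤ s) : responseChannel (Real.exp ε) ℓ s f ∈ ldpChannels X (Fin ℓ) ε := by
  have hE := Real.one_le_exp hε
  have hpos : 0 < (s : ℝ) + Real.exp ε := by positivity
  refine ⟨⟨fun y x => ?_, fun x => ?_⟩, fun x x' y => ?_⟩
  · simp only [responseChannel, Matrix.of_apply]
    split_ifs <;> positivity
  · have h : ∑ y : Fin ℓ, responseChannel (Real.exp ε) ℓ s f y x = 1 := by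
      simp only [responseChannel, Matrix.of_apply]
      rw [Fin.sum_univ_eq_sum_range
        (fun y => if y ≤ s then (if f x = y then Real.exp ε else 1) / (s + Real.exp ε) else 0) ℓ,
        ← Finset.sum_filter]
      have h1 : (Finset.range ℓ).filter (· ≤ s) = Finset.range (s + 1) := by
        ext i
        simp only [Finset.mem_filter, Finset.mem_range]
        omega
      rw [h1, ← Finset.sum_div, div_eq_one_iff_eq hpos.ne']
      have h2 : ∀ y, (if f x = y then Real.exp ε else 1)
          = 1 + if f x = y then Real.exp ε - 1 else 0 := fun y => by split_ifs <;> ring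
      simp only [h2, Finset.sum_add_distrib, Finset.sum_ite_eq, Finset.mem_range,
        Nat.lt_succ_of_le (hf x), if_true]
      simp
    rw [← h]
    exact hasSum_fintype _
  · simp only [responseChannel, Matrix.of_apply]
    split_ifs
    · rw [← mul_div_assoc]
      apply div_le_div_of_nonneg_right _ hpos.le
      nlinarith
    · rw [← mul_div_assoc]
      apply div_le_div_of_nonneg_right _ hpos.le
      linarith
    · rw [← mul_div_assoc]
      apply div_le_div_of_nonneg_right _ hpos.le
      nlinarith
    · rw [← mul_div_assoc]
      apply div_le_div_of_nonneg_right _ hpos.le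
      linarith
    · simp

/-- The first channel sends `x` to its number of preceding end points. The second applies the
response channel to a representative of that number, so its columns are columns of a private
channel. Only `2 * s + 1` of the `2 * ℓ ^ 2` values can occur. -/
lemma exists_threshold_factorization [Nonempty X] {p q : X → ℝ} (hp : ∀ x, 0 ≤ p x)
    (hq : ∀ x, 0 ≤ q x) {ε : ℝ} (hε : 0 ≤ ε) {ℓ s : ℕ} (hs : s < ℓ) (c : ℕ → X) :
    ∃ (T₁ : Matrix (Fin (2 * ℓ ^ 2)) X ℝ) (T₂ : Matrix (Fin ℓ) (Fin (2 * ℓ ^ 2)) ℝ),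
      IsThresholdChannel p q T₁ ∧ T₂ ∈ ldpChannels (Fin (2 * ℓ ^ 2)) (Fin ℓ) ε ∧
      responseChannel (Real.exp ε) ℓ s (clusterOf (share p q) c s) = T₂ * T₁ := by
  classical
  have hlt : ∀ x, endpointCount (share p q) c s x < 2 * ℓ ^ 2 := fun x => by
    have := endpointCount_le (share p q) c s x
    nlinarith
  set f₁ : X → Fin (2 * ℓ ^ 2) := fun x => ⟨endpointCount (share p q) c s x, hlt x⟩ with hf₁
  -- On values that `f₁` does not take, `g` is an arbitrary point.
  set g : Fin (2 * ℓ ^ 2) → X := Function.invFun f₁ with hg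
  have hT := responseChannel_mem hε hs (f := clusterOf (share p q) c s)
    fun x => lastHit_le s _
  set T := responseChannel (Real.exp ε) ℓ s (clusterOf (share p q) c s) with hTdef
  refine ⟨detChannel f₁, Matrix.of fun y i => T y (g i), ⟨f₁, rfl, ?_⟩,
    ⟨⟨fun y i => hT.1.1 y (g i), fun i => hT.1.2 (g i)⟩, fun i i' y => hT.2 (g i) (g i') y⟩, ?_⟩
  · intro u v _ huv w hw
    have h1 := (share_lt_share_iff hp hq u w).1 hw.1
    have h2 := (share_lt_share_iff hp hq w v).1 hw.2
    have h3 : endpointCount (share p q) c s u = endpointCount (share p q) c s v :=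
      congrArg Fin.val huv
    exact Fin.ext (le_antisymm ((endpointCount_mono c s h2.le).trans h3.ge)
      (endpointCount_mono c s h1.le))
  · ext y x
    have h1 : f₁ (g (f₁ x)) = f₁ x := Function.invFun_eq ⟨x, rfl⟩
    have h2 : clusterOf (share p q) c s (g (f₁ x)) = clusterOf (share p q) c s x :=
      clusterOf_eq_of_endpointCount_eq c s (congrArg Fin.val h1)
    simp only [Matrix.mul_apply, detChannel, Matrix.of_apply, mul_ite, mul_one, mul_zero,
      Finset.sum_ite_eq', Finset.mem_univ, if_true]
    simp only [hTdef, responseChannel, Matrix.of_apply, h2]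

variable [Fintype X]

/-- Nonempty intervals are given by their extreme points. Since the intervals are disjoint, a point
of `S j` lies in exactly those enumerated intervals that equal `S j`, so its cluster is the last
index of `j`. All other clusters have nonnegative value. -/
lemma exists_clusterOf_ge [Nonempty X] (L : ℝ) (hL : 0 ≤ L) (b d μ : X → ℝ)
    (hμ : ∀ x, 0 ≤ μ x) (s : ℕ) (J : Finset ℕ) (S : ℕ → Finset X) (hcard : J.card ≤ s)
    (hdis : ∀ i j, i ≠ j → Disjoint (S i) (S j)) (hconv : ∀ j, OrdConvex b (S j)) :
    ∃ c : ℕ → X, ∑ j ∈ J, clusterValue L d μ (S j)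
      ≤ ∑ i ∈ Finset.range s, clusterValue L d μ {x | clusterOf b c s x = i} := by
  classical
  have hval0 : ∀ S : Finset X, 0 ≤ clusterValue L d μ S := fun S =>
    div_nonneg (sq_nonneg _) (add_nonneg zero_le_two
      (mul_nonneg hL (Finset.sum_nonneg fun x _ => hμ x)))
  set J' := J.filter fun j => (S j).Nonempty with hJ'
  have hsum : ∑ j ∈ J, clusterValue L d μ (S j) = ∑ j ∈ J', clusterValue L d μ (S j) := by
    rw [hJ', Finset.sum_filter]
    refine Finset.sum_congr rfl fun j _ => ?_
    by_cases h : (S j).Nonempty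
    · simp [h]
    · simp [Finset.not_nonempty_iff_eq_empty.1 h, clusterValue]
  rw [hsum]
  rcases J'.eq_empty_or_nonempty with h | hne
  · obtain ⟨x₀⟩ := ‹Nonempty X›
    refine ⟨fun _ => x₀, ?_⟩
    rw [h, Finset.sum_empty]
    exact Finset.sum_nonneg fun i _ => hval0 _
  obtain ⟨e, he, hesurj⟩ := exists_enumeration hne ((Finset.card_filter_le _ _).trans hcard)
  have hep : ∀ i, ∃ u v, ∀ w, w ∈ S (e i) ↔ b u ≤ b w ∧ b w ≤ b v := fun i =>
    (hconv (e i)).exists_endpoints (Finset.mem_filter.1 (he i)).2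
  choose u v huv using hep
  refine ⟨fun i => if i < s then u i else v (i - s), ?_⟩
  set c : ℕ → X := fun i => if i < s then u i else v (i - s) with hc
  have hcl : ∀ x, clusterOf b c s x = lastHit s (fun i => x ∈ S (e i)) s := by
    intro x
    refine lastHit_congr fun i hi => ?_
    rw [huv i x]
    simp [hc, hi]
  set ind : ℕ → ℕ := fun j => lastHit s (fun i => e i = j) s with hind
  have hindlt : ∀ j ∈ J', ind j < s := fun j hj => by
    obtain ⟨i, hi, hij⟩ := hesurj j hj
    exact lastHit_lt hi hij
  have heind : ∀ j ∈ J', e (ind j) = j := fun j hj => lastHit_pred (hindlt j hj)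
  have hfib : ∀ j ∈ J', (Finset.univ.filter fun x => clusterOf b c s x = ind j) = S j := by
    intro j hj
    ext x
    simp only [Finset.mem_filter, Finset.mem_univ, true_and, hcl]
    constructor
    · intro h
      have h1 : lastHit s (fun i => x ∈ S (e i)) s < s := h ▸ hindlt j hj
      have h2 := lastHit_pred h1
      simp only [h, heind j hj] at h2
      exact h2
    · intro h
      refine lastHit_congr fun i _ => ⟨fun h' => ?_, fun h' => h' ▸ h⟩
      by_contra hcon
      exact Finset.disjoint_left.1 (hdis _ _ hcon) h' h
  calc ∑ j ∈ J', clusterValue L d μ (S j)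
      = ∑ j ∈ J', clusterValue L d μ {x | clusterOf b c s x = ind j} :=
        Finset.sum_congr rfl fun j hj => by rw [hfib j hj]
    _ = ∑ i ∈ J'.image ind, clusterValue L d μ {x | clusterOf b c s x = i} := by
        rw [Finset.sum_image]
        intro i hi j hj hij
        rw [← heind i hi, ← heind j hj]
        exact congrArg e hij
    _ ≤ _ := Finset.sum_le_sum_of_subset_of_nonneg
        (fun i hi => by
          obtain ⟨j, hj, rfl⟩ := Finset.mem_image.1 hi
          exact Finset.mem_range.2 (hindlt j hj))
        fun i _ _ => hval0 _

lemma responseChannel_mulVec {E : ℝ} {ℓ s : ℕ} (f : X → ℕ) (r : X → ℝ) (hr : ∑ x, r x = 1)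
    (y : Fin ℓ) (hy : y.val ≤ s) :
    (responseChannel E ℓ s f *ᵥ r) y
      = (1 + (E - 1) * ∑ x with f x = y.val, r x) / (s + E) := by
  simp only [Matrix.mulVec, dotProduct, responseChannel, Matrix.of_apply, hy, if_true]
  have h : ∀ x, (if f x = y.val then E else 1) / (s + E) * r x
      = (r x + (E - 1) * if f x = y.val then r x else 0) / (s + E) := fun x => by
    split_ifs <;> ring
  rw [Finset.sum_congr rfl fun x _ => h x, ← Finset.sum_div, Finset.sum_add_distrib, hr,
    ← Finset.mul_sum, Finset.sum_filter]

/-- For an answer `i < s` the difference of the two laws is `L (p - q)(S) / (s + e^ε)` and their sum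
is `(2 + L μ(S)) / (s + e^ε)`, with `S` the cluster. The term of the answer `s` is dropped. -/
lemma le_triDisc_responseChannel {p q : X → ℝ} (hp : p ∈ stdSimplex ℝ X)
    (hq : q ∈ stdSimplex ℝ X) {ε L : ℝ} (hε : 0 ≤ ε) (hL : L = Real.exp ε - 1) {ℓ s : ℕ}
    (hs : s < ℓ) {f : X → ℕ} (hf : ∀ x, f x ≤ s) :
    L ^ 2 / (s + Real.exp ε) * ∑ i ∈ Finset.range s,
        clusterValue L (fun x => p x - q x) (fun x => p x + q x) {x | f x = i}
      ≤ triDisc (responseChannel (Real.exp ε) ℓ s f *ᵥ p)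
          (responseChannel (Real.exp ε) ℓ s f *ᵥ q) := by
  have hch := (responseChannel_mem hε hs hf).1
  have hP := hch.isDist_mulVec hp
  have hQ := hch.isDist_mulVec hq
  unfold triDisc
  rw [tsum_fintype]
  set g : Fin ℓ → ℝ := fun y => ((responseChannel (Real.exp ε) ℓ s f *ᵥ p) y
    - (responseChannel (Real.exp ε) ℓ s f *ᵥ q) y) ^ 2
    / ((responseChannel (Real.exp ε) ℓ s f *ᵥ p) y
    + (responseChannel (Real.exp ε) ℓ s f *ᵥ q) y) with hg
  have hg0 : ∀ y, 0 ≤ g y := fun y =>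
    div_nonneg (sq_nonneg _) (add_nonneg (hP.1 y) (hQ.1 y))
  have hE : 0 < (s : ℝ) + Real.exp ε := by positivity
  calc _ = ∑ i : Fin s, g (Fin.castLE hs.le i) := by
        rw [Finset.mul_sum, Finset.sum_range]
        refine Finset.sum_congr rfl fun i _ => ?_
        have hi : (Fin.castLE hs.le i).val ≤ s := i.2.le
        simp only [hg, responseChannel_mulVec f p hp.2 _ hi, responseChannel_mulVec f q hq.2 _ hi,
          clusterValue, Finset.sum_sub_distrib, Finset.sum_add_distrib, Fin.val_castLE, ← hL]
        rw [← sub_div, ← add_div, div_pow]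
        set P := ∑ x with f x = i.val, p x
        set Q := ∑ x with f x = i.val, q x
        have e1 : (1 + L * P - (1 + L * Q)) = L * (P - Q) := by ring
        have e2 : (1 + L * P + (1 + L * Q)) = 2 + L * (P + Q) := by ring
        rw [e1, e2, mul_pow, div_div_div_eq]
        have h3 : 0 < 2 + L * (P + Q) := by
          have : 0 ≤ L := by linarith [Real.one_le_exp hε]
          have hP0 : 0 ≤ P := Finset.sum_nonneg fun x _ => hp.1 x
          have hQ0 : 0 ≤ Q := Finset.sum_nonneg fun x _ => hq.1 x
          positivity
        field_simp
    _ = ∑ y ∈ Finset.univ.map (Fin.castLEEmb hs.le), g y := by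
        rw [Finset.sum_map]; rfl
    _ ≤ _ := Finset.sum_le_sum_of_subset_of_nonneg (Finset.subset_univ _) fun y _ _ => hg0 y

end Response

/-! ## Reasoning about real RAM programs -/

namespace RealRAM

/-- From `m`, the program `P` halts within `B` steps in a memory that satisfies `Q`. -/
def Runs (P : Prog) (m : Memory) (B : ℕ) (Q : Memory → Prop) : Prop :=
  ∃ m' t, Exec P m m' t ∧ t ≤ B ∧ Q m'

/-- The natural-number arrays that a program writes to. -/
def Prog.nats : Prog → List ℕ
  | .skip => []
  | .setNat a _ _ => [a]
  | .setReal _ _ _ => []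
  | .seq P Q => P.nats ++ Q.nats
  | .ite _ P Q => P.nats ++ Q.nats
  | .loop _ P => P.nats

/-- The real arrays that a program writes to. -/
def Prog.reals : Prog → List ℕ
  | .skip => []
  | .setNat _ _ _ => []
  | .setReal a _ _ => [a]
  | .seq P Q => P.reals ++ Q.reals
  | .ite _ P Q => P.reals ++ Q.reals
  | .loop _ P => P.reals

/-- `m'` agrees with `m` outside the arrays that `P` writes to. -/
def Frame (P : Prog) (m m' : Memory) : Prop :=
  (∀ a, a ∉ P.nats → m'.nat a = m.nat a) ∧ ∀ a, a ∉ P.reals → m'.real a = m.real a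

lemma setNat_nat (m : Memory) (a i v b j : ℕ) :
    (m.setNat a i v).nat b j = if b = a ∧ j = i then v else m.nat b j := rfl

lemma setNat_real (m : Memory) (a i v : ℕ) : (m.setNat a i v).real = m.real := rfl

lemma setReal_nat (m : Memory) (a i : ℕ) (v : ℝ) : (m.setReal a i v).nat = m.nat := rfl

lemma setReal_real (m : Memory) (a i : ℕ) (v : ℝ) (b j : ℕ) :
    (m.setReal a i v).real b j = if b = a ∧ j = i then v else m.real b j := rfl

/-- Whether a program writes to an array is a decidable question about its text, so facts about the
other arrays survive without any invariant. -/
lemma Exec.frame {P : Prog} {m m' : Memory} {t : ℕ} (h : Exec P m m' t) : Frame P m m' := by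
  induction h with
  | skip m => exact ⟨fun _ _ => rfl, fun _ _ => rfl⟩
  | setNat m a i e =>
    refine ⟨fun b hb => ?_, fun _ _ => rfl⟩
    have : b ≠ a := by simpa [Prog.nats] using hb
    funext j
    simp [setNat_nat, this]
  | setReal m a i e =>
    refine ⟨fun _ _ => rfl, fun b hb => ?_⟩
    have : b ≠ a := by simpa [Prog.reals] using hb
    funext j
    simp [setReal_real, this]
  | seq _ _ ih₁ ih₂ =>
    refine ⟨fun a ha => ?_, fun a ha => ?_⟩
    · simp only [Prog.nats, List.mem_append, not_or] at ha
      rw [ih₂.1 a ha.2, ih₁.1 a ha.1]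
    · simp only [Prog.reals, List.mem_append, not_or] at ha
      rw [ih₂.2 a ha.2, ih₁.2 a ha.1]
  | iteTrue _ _ ih =>
    refine ⟨fun a ha => ?_, fun a ha => ?_⟩
    · simp only [Prog.nats, List.mem_append, not_or] at ha
      exact ih.1 a ha.1
    · simp only [Prog.reals, List.mem_append, not_or] at ha
      exact ih.2 a ha.1
  | iteFalse _ _ ih =>
    refine ⟨fun a ha => ?_, fun a ha => ?_⟩
    · simp only [Prog.nats, List.mem_append, not_or] at ha
      exact ih.1 a ha.2
    · simp only [Prog.reals, List.mem_append, not_or] at ha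
      exact ih.2 a ha.2
  | loopTrue _ _ _ ih₁ ih₂ =>
    exact ⟨fun a ha => (ih₂.1 a ha).trans (ih₁.1 a ha),
      fun a ha => (ih₂.2 a ha).trans (ih₁.2 a ha)⟩
  | loopFalse _ => exact ⟨fun _ _ => rfl, fun _ _ => rfl⟩

lemma Runs.mono {P : Prog} {m : Memory} {B B' : ℕ} {Q : Memory → Prop} (h : Runs P m B Q)
    (hB : B ≤ B') : Runs P m B' Q := by
  obtain ⟨m', t, h1, h2, h3⟩ := h
  exact ⟨m', t, h1, h2.trans hB, h3⟩

lemma Runs.skip {m : Memory} {Q : Memory → Prop} (h : Q m) : Runs .skip m 1 Q :=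
  ⟨m, 1, .skip m, le_rfl, h⟩

lemma Runs.setNat {m : Memory} {a : ℕ} {i e : NatExpr} {Q : Memory → Prop}
    (h : Q (m.setNat a (i.eval m) (e.eval m))) :
    Runs (.setNat a i e) m (i.cost + e.cost + 1) Q :=
  ⟨_, _, .setNat m a i e, le_rfl, h⟩

lemma Runs.setReal {m : Memory} {a : ℕ} {i : NatExpr} {e : RealExpr} {Q : Memory → Prop}
    (h : Q (m.setReal a (i.eval m) (e.eval m))) :
    Runs (.setReal a i e) m (i.cost + e.cost + 1) Q :=
  ⟨_, _, .setReal m a i e, le_rfl, h⟩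

lemma Runs.seq {P P' : Prog} {m : Memory} {B B' : ℕ} {Q R : Memory → Prop} (h : Runs P m B Q)
    (h' : ∀ m', Q m' → Frame P m m' → Runs P' m' B' R) : Runs (.seq P P') m (B + B') R := by
  obtain ⟨m₁, t₁, h1, h2, h3⟩ := h
  obtain ⟨m₂, t₂, h4, h5, h6⟩ := h' m₁ h3 h1.frame
  exact ⟨m₂, _, .seq h1 h4, add_le_add h2 h5, h6⟩

lemma Runs.setNat_seq {m : Memory} {a : ℕ} {i e : NatExpr} {P : Prog} {B : ℕ}
    {Q : Memory → Prop} (h : Runs P (m.setNat a (i.eval m) (e.eval m)) B Q) :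
    Runs (.seq (.setNat a i e) P) m (i.cost + e.cost + 1 + B) Q := by
  obtain ⟨m₁, t₁, h1, h2, h3⟩ := h
  exact ⟨m₁, _, .seq (.setNat m a i e) h1, by omega, h3⟩

lemma Runs.setReal_seq {m : Memory} {a : ℕ} {i : NatExpr} {e : RealExpr} {P : Prog} {B : ℕ}
    {Q : Memory → Prop} (h : Runs P (m.setReal a (i.eval m) (e.eval m)) B Q) :
    Runs (.seq (.setReal a i e) P) m (i.cost + e.cost + 1 + B) Q := by
  obtain ⟨m₁, t₁, h1, h2, h3⟩ := h
  exact ⟨m₁, _, .seq (.setReal m a i e) h1, by omega, h3⟩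

lemma Runs.ite {b : Test} {P P' : Prog} {m : Memory} {B B' : ℕ} {Q : Memory → Prop}
    (h : b.Holds m → Runs P m B Q) (h' : ¬ b.Holds m → Runs P' m B' Q) :
    Runs (.ite b P P') m (b.cost + B + B') Q := by
  by_cases hb : b.Holds m
  · obtain ⟨m₁, t₁, h1, h2, h3⟩ := h hb
    exact ⟨m₁, _, .iteTrue hb h1, by omega, h3⟩
  · obtain ⟨m₁, t₁, h1, h2, h3⟩ := h' hb
    exact ⟨m₁, _, .iteFalse hb h1, by omega, h3⟩

/-- `for v = 0, …, n - 1 do P`. -/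
def forLoop (v : ℕ) (n : NatExpr) (P : Prog) : Prog :=
  .seq (.setNat v (.const 0) (.const 0))
    (.loop (.natLt (.get v (.const 0)) n)
      (.seq P (.setNat v (.const 0) (.add (.get v (.const 0)) (.const 1)))))

/-- The invariant `I i` speaks of the memory in which the counter already holds `i`; hence the
conclusion about the body is stated after the increment. The body may not write to the counter, and
the loop may not change the bound `N`. -/
lemma Runs.forLoop {v : ℕ} {n : NatExpr} {P : Prog} {m : Memory} {N B : ℕ} {Q : Memory → Prop}
    (I : ℕ → Memory → Prop) (hv : v ∉ P.nats) (h0 : I 0 (m.setNat v 0 0))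
    (hn : ∀ m', Frame (RealRAM.forLoop v n P) m m' → n.eval m' = N)
    (hstep : ∀ i m', i < N → m'.nat v 0 = i → Frame (RealRAM.forLoop v n P) m m' → I i m' →
      Runs P m' B fun m'' => I (i + 1) (m''.setNat v 0 (i + 1)))
    (hQ : ∀ m', Frame (RealRAM.forLoop v n P) m m' → I N m' → Q m') :
    Runs (RealRAM.forLoop v n P) m ((N + 1) * (B + n.cost + 10)) Q := by
  have htrans : ∀ {m' m'' t}, Frame (RealRAM.forLoop v n P) m m' →
      Exec (.seq P (.setNat v (.const 0) (.add (.get v (.const 0)) (.const 1)))) m' m'' t →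
      Frame (RealRAM.forLoop v n P) m m'' := by
    intro m' m'' t hf he
    refine ⟨fun a ha => ?_, fun a ha => ?_⟩
    · rw [he.frame.1 a, hf.1 a ha]
      simp only [RealRAM.forLoop, Prog.nats, List.mem_append, not_or] at ha ⊢
      tauto
    · rw [he.frame.2 a, hf.2 a ha]
      simp only [RealRAM.forLoop, Prog.reals, List.mem_append, not_or] at ha ⊢
      tauto
  have key : ∀ d i m', i + d = N → m'.nat v 0 = i → Frame (RealRAM.forLoop v n P) m m' →
      I i m' → ∃ m'' t, Exec (.loop (.natLt (.get v (.const 0)) n)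
        (.seq P (.setNat v (.const 0) (.add (.get v (.const 0)) (.const 1))))) m' m'' t ∧
        t ≤ d * (B + n.cost + 10) + (n.cost + 3) ∧ Q m'' := by
    intro d
    induction d with
    | zero =>
      intro i m' hi hvi hf hI
      refine ⟨m', _, .loopFalse ?_, ?_, hQ m' hf (by rwa [← hi])⟩
      · simp only [Test.Holds, NatExpr.eval, hvi, hn m' hf]
        omega
      · simp only [Test.cost, NatExpr.cost]
        omega
    | succ d ih =>
      intro i m' hi hvi hf hI
      obtain ⟨m₁, t₁, h1, h2, h3⟩ := hstep i m' (by omega) hvi hf hI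
      have hvi' : m₁.nat v 0 = i := by rw [h1.frame.1 v hv, hvi]
      have hex : Exec (.seq P (.setNat v (.const 0) (.add (.get v (.const 0)) (.const 1)))) m'
          (m₁.setNat v 0 (i + 1)) (t₁ + (1 + 4 + 1)) := by
        have h := Exec.seq h1 (.setNat m₁ v (.const 0) (.add (.get v (.const 0)) (.const 1)))
        simpa only [NatExpr.eval, hvi', NatExpr.cost] using h
      obtain ⟨m₂, t₂, h4, h5, h6⟩ := ih (i + 1) (m₁.setNat v 0 (i + 1)) (by omega)
        (by simp [setNat_nat]) (htrans hf hex) h3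
      refine ⟨m₂, _, .loopTrue ?_ hex h4, ?_, h6⟩
      · simp only [Test.Holds, NatExpr.eval, hvi, hn m' hf]
        omega
      · simp only [Test.cost, NatExpr.cost]
        rw [Nat.succ_mul]
        omega
  have hf0 : Frame (RealRAM.forLoop v n P) m (m.setNat v 0 0) := by
    refine ⟨fun a ha => ?_, fun _ _ => rfl⟩
    have : a ≠ v := by
      simp only [RealRAM.forLoop, Prog.nats, List.mem_append, not_or] at ha
      simpa using ha.1
    funext j
    simp [setNat_nat, this]
  obtain ⟨m', t, h1, h2, h3⟩ := key N 0 (m.setNat v 0 0) (by omega) (by simp [setNat_nat]) hf0 h0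
  refine ⟨m', _, .seq (.setNat m v (.const 0) (.const 0)) h1, ?_, h3⟩
  simp only [NatExpr.cost]
  rw [Nat.succ_mul]
  omega

end RealRAM

/-! ## The program

Natural-number arrays: 0 input, 1 number of clusters, 2 number of candidates, 3 accumulator,
4 candidate counter, 5 remaining digits, 6 quotient, 7 digits, 8 clusters, 9 best candidate,
10 and 11 counters, 12 output position, 13 current candidate.
Real arrays: 0 to 2 input, 3 output, 4 shares, 5 number of clusters, 6 and 7 sums over a cluster,
8 value of the candidate, 9 best value. -/

namespace RealRAM

/-- A natural-number variable: entry 0 of an array. -/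
abbrev nvar (a : ℕ) : NatExpr := .get a (.const 0)

/-- A real variable: entry 0 of an array. -/
abbrev rvar (a : ℕ) : RealExpr := .get a (.const 0)

/-- Assignment to a natural-number variable. -/
abbrev assignNat (a : ℕ) (e : NatExpr) : Prog := .setNat a (.const 0) e

/-- Assignment to a real variable. -/
abbrev assignReal (a : ℕ) (e : RealExpr) : Prog := .setReal a (.const 0) e

/-- The input `k`. -/
abbrev inputK : NatExpr := .get 0 (.const 0)

/-- The input `ℓ`. -/
abbrev inputL : NatExpr := .get 0 (.const 1)

/-- Computes the shares `p / (p + q)`. -/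
def shareProg : Prog :=
  forLoop 10 inputK (.setReal 4 (nvar 10)
    (.div (.get 1 (nvar 10)) (.add (.get 1 (nvar 10)) (.get 2 (nvar 10)))))

/-- Computes the number of clusters. -/
def countProg : Prog :=
  .seq (assignNat 1 (.const 1)) (.seq (assignReal 5 (.const 1))
    (forLoop 10 (.sub inputL (.const 2))
      (.ite (.realLt (.mul (.const 2) (.sub (rvar 0) (.const 1))) (rvar 5)) .skip
        (.seq (assignNat 1 (.add (nvar 1) (.const 1)))
          (assignReal 5 (.add (rvar 5) (.const 1)))))))

/-- Computes the number `k ^ (2 s)` of candidates. -/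
def powProg : Prog :=
  .seq (assignNat 2 (.const 1)) (forLoop 10 (.add (nvar 1) (nvar 1))
    (.seq (assignNat 3 (.const 0)) (.seq
      (forLoop 11 inputK (assignNat 3 (.add (nvar 3) (nvar 2))))
      (assignNat 2 (nvar 3)))))

/-- Divides variable 5 by `k`: the quotient goes to variable 6, the remainder stays. -/
def divProg : Prog :=
  .seq (assignNat 6 (.const 0)) (.loop (.natLt inputK (.add (nvar 5) (.const 1)))
    (.seq (assignNat 5 (.sub (nvar 5) inputK)) (assignNat 6 (.add (nvar 6) (.const 1)))))

/-- Computes the base `k` digits of the candidate. -/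
def digitsProg : Prog :=
  .seq (assignNat 5 (nvar 13)) (forLoop 10 (.add (nvar 1) (nvar 1))
    (.seq divProg (.seq (.setNat 7 (nvar 10) (nvar 5)) (assignNat 5 (nvar 6)))))

/-- Computes the clusters of the candidate. -/
def clusterProg : Prog :=
  forLoop 10 inputK (.seq (.setNat 8 (nvar 10) (nvar 1)) (forLoop 11 (nvar 1)
    (.ite (.realLt (.get 4 (nvar 10)) (.get 4 (.get 7 (nvar 11)))) .skip
      (.ite (.realLt (.get 4 (.get 7 (.add (nvar 1) (nvar 11)))) (.get 4 (nvar 10))) .skip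
        (.setNat 8 (nvar 10) (nvar 11))))))

/-- Tests whether two natural numbers differ. -/
abbrev natNe (e f : NatExpr) : Test := .natLt (.const 0) (.add (.sub e f) (.sub f e))

/-- Computes the value of the candidate. -/
def valueProg : Prog :=
  .seq (assignReal 8 (.const 0)) (forLoop 10 (nvar 1)
    (.seq (assignReal 6 (.const 0)) (.seq (assignReal 7 (.const 0)) (.seq
      (forLoop 11 inputK (.ite (natNe (.get 8 (nvar 11)) (nvar 10)) .skip
        (.seq (assignReal 6 (.add (rvar 6) (.sub (.get 1 (nvar 11)) (.get 2 (nvar 11)))))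
          (assignReal 7 (.add (rvar 7) (.add (.get 1 (nvar 11)) (.get 2 (nvar 11))))))))
      (assignReal 8 (.add (rvar 8) (.div (.mul (rvar 6) (rvar 6))
        (.add (.const 2) (.mul (.sub (rvar 0) (.const 1)) (rvar 7))))))))))

/-- Finds the best candidate. -/
def searchProg : Prog :=
  .seq (assignReal 9 (.const (-1))) (.seq (assignNat 9 (.const 0)) (forLoop 4 (nvar 2)
    (.seq (assignNat 13 (nvar 4)) (.seq digitsProg (.seq clusterProg (.seq valueProg
      (.ite (.realLt (rvar 9) (rvar 8))
        (.seq (assignReal 9 (rvar 8)) (assignNat 9 (nvar 13))) .skip)))))))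

/-- Writes the matrix of randomized response on the clusters. -/
def writeProg : Prog :=
  .seq (assignNat 12 (.const 0)) (forLoop 10 inputL (forLoop 11 inputK
    (.seq (.ite (.natLt (nvar 1) (nvar 10)) (.setReal 3 (nvar 12) (.const 0))
      (.ite (natNe (.get 8 (nvar 11)) (nvar 10))
        (.setReal 3 (nvar 12) (.div (.const 1) (.add (rvar 5) (rvar 0))))
        (.setReal 3 (nvar 12) (.div (rvar 0) (.add (rvar 5) (rvar 0))))))
      (assignNat 12 (.add (nvar 12) (.const 1))))))

/-- The whole program. -/
def mainProg : Prog :=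
  .seq shareProg (.seq countProg (.seq powProg (.seq searchProg
    (.seq (assignNat 13 (nvar 9)) (.seq digitsProg (.seq clusterProg writeProg))))))

/-! ### Results and running times of the subroutines -/

lemma runs_shareProg (m : Memory) :
    Runs shareProg m ((m.nat 0 0 + 1) * 100) fun m' => ∀ x < m.nat 0 0,
      m'.real 4 x = m.real 1 x / (m.real 1 x + m.real 2 x) := by
  refine Runs.mono (Runs.forLoop (N := m.nat 0 0)
    (fun i m' => ∀ x < i, m'.real 4 x = m.real 1 x / (m.real 1 x + m.real 2 x))
    (by decide) (by simp) ?_ (B := 80) ?_ (fun _ _ h => h)) ?_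
  rotate_left 1
  · intro i m' hi hvi hf hI
    have f0 := hf.2 1 (by decide)
    have f1 := hf.2 2 (by decide)
    refine Runs.mono (Runs.setReal ?_) (by decide)
    intro x hx
    simp only [setNat_real, setReal_real, NatExpr.eval, RealExpr.eval, hvi, f0, f1]
    by_cases h : x = i
    · simp [h]
    · simp only [h, and_false, if_false]
      exact hI x (by omega)
  · simp only [NatExpr.cost]
    gcongr
    norm_num
  · intro m' hf
    simp only [NatExpr.eval, hf.1 0 (by decide)]

/-- The count starts at `1` and in each of `ℓ - 2` rounds grows by one as long as it is at most `2 *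
L`. It is kept both as a natural and as a real number, since the machine has no conversion between
them. -/
lemma runs_countProg (m : Memory) (ℓ : ℕ) (hm : m.nat 0 1 = ℓ) (hℓ : 1 < ℓ)
    (hE : 1 ≤ m.real 0 0) :
    Runs countProg m ((ℓ + 1) * 100) fun m' => ∃ s : ℕ, m'.nat 1 0 = s ∧ m'.real 5 0 = s ∧
      1 ≤ s ∧ s < ℓ ∧ s ≤ 2 * (m.real 0 0 - 1) + 1 ∧
      (s = ℓ - 1 ∨ 2 * (m.real 0 0 - 1) < s) := by
  refine Runs.mono (Runs.setNat_seq (Runs.setReal_seq (Runs.forLoop (N := ℓ - 2)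
    (fun i m' => ∃ s : ℕ, m'.nat 1 0 = s ∧ m'.real 5 0 = s ∧ 1 ≤ s ∧ s ≤ i + 1 ∧
      s ≤ 2 * (m.real 0 0 - 1) + 1 ∧ (s = i + 1 ∨ 2 * (m.real 0 0 - 1) < s))
    (by decide) ?_ ?_ (B := 80) ?_ ?_))) ?_
  · refine ⟨1, ?_, ?_, le_rfl, le_rfl, ?_, Or.inl rfl⟩
    · simp [setNat_nat, setReal_nat, NatExpr.eval]
    · simp [setNat_real, setReal_real, RealExpr.eval, NatExpr.eval]
    · push_cast; linarith
  · intro m' hf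
    have f := hf.1 0 (by decide)
    simp [NatExpr.eval, f, setReal_nat, setNat_nat, hm]
  · rintro i m' hi hvi hf ⟨s, h1, h2, h3, h4, h5, h6⟩
    have f0 : m'.real 0 0 = m.real 0 0 := by
      rw [hf.2 0 (by decide), setReal_real]
      simp [setNat_real]
    refine Runs.mono (Runs.ite (fun hb => Runs.skip ?_)
      (fun hb => Runs.setNat_seq (Runs.setReal ?_))) (by decide)
    · simp only [Test.Holds, RealExpr.eval, NatExpr.eval, h2, f0] at hb
      push_cast at hb
      exact ⟨s, by simp [setNat_nat, h1], by simp [setNat_real, h2], h3, by omega, h5, Or.inr hb⟩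
    · simp only [Test.Holds, RealExpr.eval, NatExpr.eval, h2, f0] at hb
      push_cast at hb
      have hs : s = i + 1 := h6.resolve_right hb
      refine ⟨s + 1, ?_, ?_, by omega, by omega, ?_, Or.inl (by omega)⟩
      · simp [setNat_nat, setReal_nat, NatExpr.eval, h1]
      · simp [setNat_real, setReal_real, NatExpr.eval, RealExpr.eval, h2]
      · push_cast; linarith
  · rintro m' hf ⟨s, h1, h2, h3, h4, h5, h6⟩
    refine ⟨s, h1, h2, h3, by omega, h5, ?_⟩
    rcases h6 with h6 | h6
    · exact Or.inl (by omega)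
    · exact Or.inr h6
  · simp only [NatExpr.cost, RealExpr.cost]
    omega

lemma runs_powProg (m : Memory) (k s : ℕ) (hk : m.nat 0 0 = k) (hs : m.nat 1 0 = s) :
    Runs powProg m ((s + s + 1) * ((k + 1) * 100 + 100) + 100) fun m' =>
      m'.nat 2 0 = k ^ (s + s) := by
  refine Runs.mono (Runs.setNat_seq (Runs.forLoop (N := s + s)
    (fun i m' => m'.nat 2 0 = k ^ i) (by decide) ?_ ?_ (B := (k + 1) * 100 + 20) ?_
    (fun _ _ h => h))) ?_
  · simp [setNat_nat, NatExpr.eval]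
  · intro m' hf
    simp [NatExpr.eval, hf.1 1 (by decide), setNat_nat, hs]
  · intro i m' hi hvi hf hI
    have f0 : m'.nat 0 0 = k := by rw [hf.1 0 (by decide)]; simp [setNat_nat, hk]
    refine Runs.mono (Runs.setNat_seq (Runs.seq (Runs.forLoop (N := k)
      (fun j m'' => m''.nat 3 0 = j * k ^ i) (by decide) ?_ ?_ (B := 80) ?_
      (Q := fun m'' => m''.nat 3 0 = k * k ^ i) (fun _ _ h => h)) (B' := 10) ?_)) ?_
    · simp [setNat_nat, NatExpr.eval]
    · intro m'' hf'
      simp [NatExpr.eval, hf'.1 0 (by decide), setNat_nat, f0]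
    · intro j m'' hj hvj hf' hI'
      have f2 : m''.nat 2 0 = k ^ i := by rw [hf'.1 2 (by decide)]; simp [setNat_nat, hI]
      refine Runs.mono (Runs.setNat ?_) (by decide)
      simp only [setNat_nat, NatExpr.eval, hI', f2]
      simp
      ring
    · intro m'' h1 _
      refine Runs.mono (Runs.setNat ?_) (by decide)
      simp only [setNat_nat, NatExpr.eval, h1]
      simp
      ring
    · simp only [NatExpr.cost]
      omega
  · simp only [NatExpr.cost]
    nlinarith

/-- Division is by repeated subtraction, in time linear in the dividend. This is affordable because
candidates are numbered below `k ^ (2 * s)`, which the time bound dominates anyway. -/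
lemma runs_divProg (m : Memory) (k : ℕ) (hk : m.nat 0 0 = k) (hk0 : 0 < k) :
    Runs divProg m ((m.nat 5 0 + 1) * 100) fun m' =>
      m'.nat 5 0 = m.nat 5 0 % k ∧ m'.nat 6 0 = m.nat 5 0 / k := by
  set x := m.nat 5 0 with hx
  have key : ∀ r (m' : Memory), m'.nat 0 0 = k → m'.nat 5 0 = r →
      Runs (.loop (.natLt inputK (.add (nvar 5) (.const 1)))
        (.seq (assignNat 5 (.sub (nvar 5) inputK)) (assignNat 6 (.add (nvar 6) (.const 1)))))
        m' ((r + 1) * 50) fun m'' => m''.nat 5 0 = r % k ∧ m''.nat 6 0 = m'.nat 6 0 + r / k := by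
    intro r
    induction r using Nat.strong_induction_on with
    | _ r ih =>
      intro m' h0 h5
      -- The machine has only strict comparison, so `k ≤ r` is tested as `k < r + 1`.
      by_cases h : k < r + 1
      · set m₁ := (m'.setNat 5 0 (r - k)).setNat 6 0 (m'.nat 6 0 + 1) with hm₁
        have hex : Exec (.seq (assignNat 5 (.sub (nvar 5) inputK))
            (assignNat 6 (.add (nvar 6) (.const 1)))) m' m₁ (1 + 5 + 1 + (1 + 4 + 1)) := by
          have := Exec.seq (.setNat m' 5 (.const 0) (.sub (nvar 5) inputK))
            (.setNat _ 6 (.const 0) (.add (nvar 6) (.const 1)))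
          simpa [NatExpr.eval, NatExpr.cost, h5, h0, setNat_nat] using this
        obtain ⟨m₂, t, h1, h2, h3, h4⟩ := ih (r - k) (by omega) m₁
          (by simp [hm₁, setNat_nat, h0]) (by simp [hm₁, setNat_nat])
        refine ⟨m₂, _, .loopTrue ?_ hex h1, ?_, ?_, ?_⟩
        · simp only [Test.Holds, NatExpr.eval, h0, h5]
          exact h
        · simp only [Test.cost, NatExpr.cost]
          omega
        · rw [h3, ← Nat.mod_eq_sub_mod (by omega)]
        · rw [h4, hm₁, Nat.div_eq_sub_div hk0 (by omega : k ≤ r)]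
          simp [setNat_nat]
          ring
      · refine ⟨m', _, .loopFalse ?_, ?_, ?_, ?_⟩
        · simp only [Test.Holds, NatExpr.eval, h0, h5]
          exact h
        · simp only [Test.cost, NatExpr.cost]
          omega
        · rw [h5, Nat.mod_eq_of_lt (by omega)]
        · rw [Nat.div_eq_of_lt (by omega), add_zero]
  refine Runs.mono (Runs.setNat_seq ?_) (B := 1 + 1 + 1 + (x + 1) * 50) (by omega)
  have := key x (m.setNat 6 0 0) (by simp [setNat_nat, hk]) (by simp [setNat_nat, hx])
  simpa [setNat_nat, NatExpr.eval] using this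

lemma runs_digitsProg (m : Memory) (k s : ℕ) (hk : m.nat 0 0 = k) (hk0 : 0 < k)
    (hs : m.nat 1 0 = s) :
    Runs digitsProg m ((s + s + 1) * ((m.nat 13 0 + 1) * 100 + 100) + 100) fun m' =>
      ∀ i < s + s, m'.nat 7 i = m.nat 13 0 / k ^ i % k := by
  set N := m.nat 13 0 with hN
  refine Runs.mono (Runs.setNat_seq (Runs.forLoop (N := s + s)
    (fun i m' => m'.nat 5 0 = N / k ^ i ∧ ∀ j < i, m'.nat 7 j = N / k ^ j % k) (by decide) ?_ ?_
    (B := (N + 1) * 100 + 50) ?_ (fun _ _ h => h.2))) ?_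
  · simp [setNat_nat, NatExpr.eval, hN]
  · intro m' hf
    simp [NatExpr.eval, hf.1 1 (by decide), setNat_nat, hs]
  · rintro i m' hi hvi hf ⟨h5, h7⟩
    have f0 : m'.nat 0 0 = k := by rw [hf.1 0 (by decide)]; simp [setNat_nat, hk]
    refine Runs.mono (Runs.seq (runs_divProg m' k f0 hk0) (B' := 30) fun m₁ h1 hf1 =>
      Runs.mono (Runs.setNat_seq (Runs.setNat ?_)) (by decide)) ?_
    · obtain ⟨h1, h2⟩ := h1
      have f10 : m₁.nat 10 0 = i := by rw [hf1.1 10 (by decide), hvi]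
      have f7 := hf1.1 7 (by decide)
      refine ⟨?_, fun j hj => ?_⟩
      · simp [setNat_nat, NatExpr.eval, h2, h5, Nat.div_div_eq_div_mul, pow_succ]
      · simp only [setNat_nat, NatExpr.eval, f10, f7, h1, h5]
        by_cases hji : j = i
        · simp [hji]
        · simp [hji, h7 j (by omega)]
    · rw [h5]
      have : N / k ^ i ≤ N := Nat.div_le_self _ _
      omega
  · simp only [NatExpr.cost]
    nlinarith

/-- The entry starts at the default `s`, and every later hit overwrites earlier ones, which is the
recursion of `lastHit`. -/
lemma runs_clusterProg (m : Memory) (k s : ℕ) (hk : m.nat 0 0 = k) (hs : m.nat 1 0 = s) :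
    Runs clusterProg m ((k + 1) * ((s + 1) * 100 + 100)) fun m' => ∀ x < k, m'.nat 8 x =
      lastHit s (fun i => m.real 4 (m.nat 7 i) ≤ m.real 4 x ∧
        m.real 4 x ≤ m.real 4 (m.nat 7 (s + i))) s := by
  refine Runs.mono (Runs.forLoop (N := k)
    (fun i m' => ∀ x < i, m'.nat 8 x = lastHit s (fun i => m.real 4 (m.nat 7 i) ≤ m.real 4 x ∧
        m.real 4 x ≤ m.real 4 (m.nat 7 (s + i))) s) (by decide) (by simp) ?_
    (B := (s + 1) * 100 + 50) ?_ (fun _ _ h => h)) ?_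
  · intro m' hf
    simp [NatExpr.eval, hf.1 0 (by decide), hk]
  · intro x m' hx hvx hf hI
    have f1 : m'.nat 1 0 = s := by rw [hf.1 1 (by decide), hs]
    have f7 := hf.1 7 (by decide)
    have f4 := hf.2 4 (by decide)
    refine Runs.mono (Runs.setNat_seq (Runs.forLoop (N := s)
      (fun j m'' => (∀ y < x, m''.nat 8 y = m'.nat 8 y) ∧
        m''.nat 8 x = lastHit s (fun i => m.real 4 (m.nat 7 i) ≤ m.real 4 x ∧
        m.real 4 x ≤ m.real 4 (m.nat 7 (s + i))) j) (by decide) ?_ ?_ (B := 80) ?_ ?_)) ?_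
    · refine ⟨fun y hy => ?_, ?_⟩
      · simp [setNat_nat, NatExpr.eval, hvx, hy.ne]
      · simp [setNat_nat, NatExpr.eval, hvx, f1, lastHit]
    · intro m'' hf'
      simp [NatExpr.eval, hf'.1 1 (by decide), setNat_nat, f1]
    · rintro j m'' hj hvj hf' ⟨h1, h2⟩
      have g1 : m''.nat 1 0 = s := by rw [hf'.1 1 (by decide)]; simp [setNat_nat, f1]
      have g10 : m''.nat 10 0 = x := by rw [hf'.1 10 (by decide)]; simp [setNat_nat, hvx]
      have g7 : ∀ i, m''.nat 7 i = m.nat 7 i := by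
        intro i; rw [hf'.1 7 (by decide)]; simp [setNat_nat, f7]
      have g4 : m''.real 4 = m.real 4 := by
        rw [hf'.2 4 (by decide), setNat_real, f4]
      refine Runs.mono (Runs.ite (fun hb => Runs.skip ?_) (fun hb =>
        Runs.ite (fun hb' => Runs.skip ?_) (fun hb' => Runs.setNat ?_))) (by decide)
      · simp only [Test.Holds, RealExpr.eval, NatExpr.eval, hvj, g10, g7, g4] at hb
        refine ⟨fun y hy => by simp [setNat_nat, h1 y hy], ?_⟩
        simp [setNat_nat, h2, lastHit, not_le.2 hb]
      · simp only [Test.Holds, RealExpr.eval, NatExpr.eval, hvj, g1, g10, g7, g4] at hb'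
        refine ⟨fun y hy => by simp [setNat_nat, h1 y hy], ?_⟩
        simp [setNat_nat, h2, lastHit, not_le.2 hb']
      · simp only [Test.Holds, RealExpr.eval, NatExpr.eval, hvj, g1, g10, g7, g4, not_lt] at hb hb'
        refine ⟨fun y hy => by simp [setNat_nat, NatExpr.eval, g10, h1 y hy, hy.ne], ?_⟩
        simp [setNat_nat, NatExpr.eval, g10, hvj, lastHit, hb, hb']
    · rintro m'' hf' ⟨h1, h2⟩ y hy
      rcases Nat.lt_succ_iff_lt_or_eq.1 hy with hy | rfl
      · simp [setNat_nat, h1 y hy, hI y hy]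
      · simp [setNat_nat, h2]
    · simp only [NatExpr.cost]
      omega
  · simp only [NatExpr.cost]
    exact Nat.mul_le_mul_left _ (by omega)

lemma natNe_holds (m : Memory) (e f : NatExpr) : (natNe e f).Holds m ↔ e.eval m ≠ f.eval m := by
  simp only [Test.Holds, NatExpr.eval]
  omega

lemma runs_valueProg (m : Memory) (k s : ℕ) (hk : m.nat 0 0 = k) (hs : m.nat 1 0 = s) :
    Runs valueProg m ((s + 1) * ((k + 1) * 100 + 100) + 100) fun m' => m'.real 8 0 =
      ∑ i ∈ Finset.range s,
        (∑ x ∈ Finset.range k, if m.nat 8 x = i then m.real 1 x - m.real 2 x else 0) ^ 2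
        / (2 + (m.real 0 0 - 1) *
          ∑ x ∈ Finset.range k, if m.nat 8 x = i then m.real 1 x + m.real 2 x else 0) := by
  refine Runs.mono (Runs.setReal_seq (Runs.forLoop (N := s)
    (fun j m' => m'.real 8 0 = ∑ i ∈ Finset.range j,
        (∑ x ∈ Finset.range k, if m.nat 8 x = i then m.real 1 x - m.real 2 x else 0) ^ 2
        / (2 + (m.real 0 0 - 1) *
          ∑ x ∈ Finset.range k, if m.nat 8 x = i then m.real 1 x + m.real 2 x else 0))
    (by decide) ?_ ?_ (B := (k + 1) * 100 + 80) ?_ (fun _ _ h => h))) ?_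
  · simp [setNat_real, setReal_real, NatExpr.eval, RealExpr.eval]
  · intro m' hf
    simp [NatExpr.eval, hf.1 1 (by decide), setReal_nat, hs]
  · intro i m' hi hvi hf hI
    have f0 : m'.nat 0 0 = k := by rw [hf.1 0 (by decide), setReal_nat, hk]
    have f8 : ∀ x, m'.nat 8 x = m.nat 8 x := fun x => by rw [hf.1 8 (by decide), setReal_nat]
    have r0 : ∀ x, m'.real 0 x = m.real 0 x := fun x => by
      rw [hf.2 0 (by decide)]; simp [setReal_real]
    have r1 : ∀ x, m'.real 1 x = m.real 1 x := fun x => by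
      rw [hf.2 1 (by decide)]; simp [setReal_real]
    have r2 : ∀ x, m'.real 2 x = m.real 2 x := fun x => by
      rw [hf.2 2 (by decide)]; simp [setReal_real]
    refine Runs.mono (Runs.setReal_seq (Runs.setReal_seq (Runs.seq (Runs.forLoop (N := k)
      (fun j m'' =>
        m''.real 6 0 = (∑ x ∈ Finset.range j,
          if m.nat 8 x = i then m.real 1 x - m.real 2 x else 0) ∧
        m''.real 7 0 = ∑ x ∈ Finset.range j,
          if m.nat 8 x = i then m.real 1 x + m.real 2 x else 0) (by decide) ?_ ?_ (B := 80) ?_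
      (Q := fun m'' =>
        m''.real 6 0 = (∑ x ∈ Finset.range k,
          if m.nat 8 x = i then m.real 1 x - m.real 2 x else 0) ∧
        m''.real 7 0 = ∑ x ∈ Finset.range k,
          if m.nat 8 x = i then m.real 1 x + m.real 2 x else 0)
      (fun _ _ h => h)) (B' := 40) ?_))) ?_
    · simp [setNat_real, setReal_real, NatExpr.eval, RealExpr.eval]
    · intro m'' hf'
      simp [NatExpr.eval, hf'.1 0 (by decide), setReal_nat, f0]
    · rintro j m'' hj hvj hf' ⟨h1, h2⟩
      have g10 : m''.nat 10 0 = i := by rw [hf'.1 10 (by decide)]; simp [setReal_nat, hvi]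
      have g8 : ∀ x, m''.nat 8 x = m.nat 8 x := fun x => by
        rw [hf'.1 8 (by decide)]; simp [setReal_nat, f8]
      have g1 : ∀ x, m''.real 1 x = m.real 1 x := fun x => by
        rw [hf'.2 1 (by decide)]; simp [setReal_real, r1]
      have g2 : ∀ x, m''.real 2 x = m.real 2 x := fun x => by
        rw [hf'.2 2 (by decide)]; simp [setReal_real, r2]
      refine Runs.mono (Runs.ite (fun hb => Runs.skip ?_)
        (fun hb => Runs.setReal_seq (Runs.setReal ?_))) (by decide)
      · rw [natNe_holds] at hb
        simp only [NatExpr.eval, hvj, g10, g8] at hb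
        simp [setNat_real, h1, h2, Finset.sum_range_succ, hb]
      · rw [natNe_holds] at hb
        simp only [NatExpr.eval, hvj, g10, g8, ne_eq, not_not] at hb
        simp [setNat_real, setReal_real, setReal_nat, NatExpr.eval, RealExpr.eval, h1, h2, hvj,
          g1, g2, Finset.sum_range_succ, hb]
    · rintro m'' ⟨h1, h2⟩ hf'
      have g0 : m''.real 0 0 = m.real 0 0 := by
        rw [hf'.2 0 (by decide)]; simp [setReal_real, r0]
      have g8 : m''.real 8 0 = m'.real 8 0 := by
        rw [hf'.2 8 (by decide)]; simp [setReal_real]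
      refine Runs.mono (Runs.setReal ?_) (by decide)
      simp only [setNat_real, setReal_real, NatExpr.eval, RealExpr.eval, h1, h2, g0, g8, hI,
        Finset.sum_range_succ]
      simp [sq]
    · simp only [NatExpr.cost, RealExpr.cost]
      omega
  · simp only [NatExpr.cost, RealExpr.cost]
    have : (s + 1) * ((k + 1) * 100 + 80 + (1 + 1) + 10) ≤ (s + 1) * ((k + 1) * 100 + 100) :=
      Nat.mul_le_mul_left _ (by omega)
    omega

/-- The cluster of `x` for the candidate whose base `k` digits are the interval end points. -/
noncomputable def candCluster (b : ℕ → ℝ) (k s N x : ℕ) : ℕ :=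
  lastHit s (fun i => b (N / k ^ i % k) ≤ b x ∧ b x ≤ b (N / k ^ (s + i) % k)) s

/-- The value of a candidate. -/
noncomputable def candValue (L : ℝ) (p q b : ℕ → ℝ) (k s N : ℕ) : ℝ :=
  ∑ i ∈ Finset.range s,
    (∑ x ∈ Finset.range k, if candCluster b k s N x = i then p x - q x else 0) ^ 2
    / (2 + L * ∑ x ∈ Finset.range k, if candCluster b k s N x = i then p x + q x else 0)

lemma candValue_nonneg {L : ℝ} (hL : 0 ≤ L) {p q : ℕ → ℝ} {k : ℕ} (hp : ∀ x < k, 0 ≤ p x)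
    (hq : ∀ x < k, 0 ≤ q x) (b : ℕ → ℝ) (s N : ℕ) : 0 ≤ candValue L p q b k s N := by
  refine Finset.sum_nonneg fun i _ => div_nonneg (sq_nonneg _) (add_nonneg zero_le_two
    (mul_nonneg hL (Finset.sum_nonneg fun x hx => ?_)))
  have := hp x (Finset.mem_range.1 hx)
  have := hq x (Finset.mem_range.1 hx)
  split_ifs <;> linarith

lemma runs_digits_cluster (m : Memory) (k s N : ℕ) (hk : m.nat 0 0 = k) (hk0 : 0 < k)
    (hs : m.nat 1 0 = s) (hN : m.nat 13 0 = N) {P : Prog} {B : ℕ} {Q : Memory → Prop}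
    (h : ∀ m', (∀ x < k, m'.nat 8 x = candCluster (m.real 4) k s N x) →
      Frame (.seq digitsProg clusterProg) m m' → Runs P m' B Q) :
    Runs (.seq digitsProg (.seq clusterProg P)) m
      ((s + s + 1) * ((N + 1) * 100 + 100) + 100 + ((k + 1) * ((s + 1) * 100 + 100) + B)) Q := by
  subst hN
  refine Runs.seq (runs_digitsProg m k s hk hk0 hs) fun m₁ h1 hf1 => ?_
  have f0 : m₁.nat 0 0 = k := by rw [hf1.1 0 (by decide), hk]
  have f1 : m₁.nat 1 0 = s := by rw [hf1.1 1 (by decide), hs]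
  have f4 : m₁.real 4 = m.real 4 := hf1.2 4 (by decide)
  refine Runs.seq (runs_clusterProg m₁ k s f0 f1) fun m₂ h2 hf2 => h m₂ (fun x hx => ?_) ?_
  · rw [h2 x hx, f4]
    refine lastHit_congr fun i hi => ?_
    rw [h1 i (by omega), h1 (s + i) (by omega)]
  · refine ⟨fun a ha => ?_, fun a ha => ?_⟩
    · simp only [Prog.nats, List.mem_append, not_or] at ha
      rw [hf2.1 a ha.2, hf1.1 a ha.1]
    · simp only [Prog.reals, List.mem_append, not_or] at ha
      rw [hf2.2 a ha.2, hf1.2 a ha.1]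

/-- The best value starts at `-1`, below every candidate value, so the first candidate is always
accepted. From then on the stored value belongs to the stored candidate. -/
lemma runs_searchProg (m : Memory) (k s K : ℕ) (hk : m.nat 0 0 = k) (hk0 : 0 < k)
    (hs : m.nat 1 0 = s) (hK : m.nat 2 0 = K) (hK0 : 0 < K) (hE : 1 ≤ m.real 0 0)
    (hp : ∀ x < k, 0 ≤ m.real 1 x) (hq : ∀ x < k, 0 ≤ m.real 2 x) :
    Runs searchProg m ((K + 1) * ((s + s + 1) * ((K + 1) * 100 + 100) + 100 +
      ((k + 1) * ((s + 1) * 100 + 100) + ((s + 1) * ((k + 1) * 100 + 100) + 100)) + 100) + 100)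
      fun m' => m'.nat 9 0 ≤ K ∧ ∀ N < K,
        candValue (m.real 0 0 - 1) (m.real 1) (m.real 2) (m.real 4) k s N
          ≤ candValue (m.real 0 0 - 1) (m.real 1) (m.real 2) (m.real 4) k s (m'.nat 9 0) := by
  set V := candValue (m.real 0 0 - 1) (m.real 1) (m.real 2) (m.real 4) k s with hV
  have hV0 : ∀ N, 0 ≤ V N := fun N => candValue_nonneg (by linarith) hp hq _ _ _
  refine Runs.mono (Runs.setReal_seq (Runs.setNat_seq (Runs.forLoop (N := K)
    (fun i m' => m'.nat 9 0 ≤ i ∧ (∀ N < i, V N ≤ m'.real 9 0) ∧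
      (m'.real 9 0 = V (m'.nat 9 0) ∨ (i = 0 ∧ m'.real 9 0 = -1))) (by decide) ?_ ?_
    (B := (s + s + 1) * ((K + 1) * 100 + 100) + 100 +
      ((k + 1) * ((s + 1) * 100 + 100) + ((s + 1) * ((k + 1) * 100 + 100) + 100)) + 50) ?_ ?_))) ?_
  · refine ⟨?_, by simp, Or.inr ⟨rfl, ?_⟩⟩
    · simp [setNat_nat, NatExpr.eval]
    · simp [setNat_real, setReal_real, NatExpr.eval, RealExpr.eval]
  · intro m' hf
    simp [NatExpr.eval, hf.1 2 (by decide), setNat_nat, setReal_nat, hK]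
  · rintro i m' hi hvi hf ⟨h1, h2, h3⟩
    have f0 : m'.nat 0 0 = k := by
      rw [hf.1 0 (by decide)]; simp [setNat_nat, setReal_nat, hk]
    have f1 : m'.nat 1 0 = s := by
      rw [hf.1 1 (by decide)]; simp [setNat_nat, setReal_nat, hs]
    have r0 : m'.real 0 = m.real 0 := by
      rw [hf.2 0 (by decide)]
      funext x
      simp [setNat_real, setReal_real]
    have r1 : m'.real 1 = m.real 1 := by
      rw [hf.2 1 (by decide)]
      funext x
      simp [setNat_real, setReal_real]
    have r2 : m'.real 2 = m.real 2 := by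
      rw [hf.2 2 (by decide)]
      funext x
      simp [setNat_real, setReal_real]
    have r4 : m'.real 4 = m.real 4 := by
      rw [hf.2 4 (by decide)]
      funext x
      simp [setNat_real, setReal_real]
    refine Runs.mono (Runs.setNat_seq (runs_digits_cluster _ k s i ?_ hk0 ?_ ?_
      (B := ((s + 1) * ((k + 1) * 100 + 100) + 100) + 30) fun m₁ h8 hf1 =>
      Runs.seq (runs_valueProg m₁ k s ?_ ?_) (B' := 30) fun m₂ hv hf2 =>
      Runs.mono (Runs.ite (fun hb => Runs.setReal_seq (Runs.setNat ?_))
        (fun hb => Runs.skip ?_)) (by decide))) ?_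
    · simp [setNat_nat, f0]
    · simp [setNat_nat, f1]
    · simp [setNat_nat, NatExpr.eval, hvi]
    · rw [hf1.1 0 (by decide)]; simp [setNat_nat, f0]
    · rw [hf1.1 1 (by decide)]; simp [setNat_nat, f1]
    rotate_right 1
    · have : (s + s + 1) * ((i + 1) * 100 + 100) ≤ (s + s + 1) * ((K + 1) * 100 + 100) :=
        Nat.mul_le_mul_left _ (by omega)
      simp only [NatExpr.cost]
      omega
    all_goals
      have g : m₂.real 8 0 = V i := by
        rw [hv, hV]
        refine Finset.sum_congr rfl fun j _ => ?_
        have e0 : m₁.real 0 = m.real 0 := by rw [hf1.2 0 (by decide), setNat_real, r0]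
        have e1 : m₁.real 1 = m.real 1 := by rw [hf1.2 1 (by decide), setNat_real, r1]
        have e2 : m₁.real 2 = m.real 2 := by rw [hf1.2 2 (by decide), setNat_real, r2]
        have e8 : ∀ x ∈ Finset.range k, m₁.nat 8 x = candCluster (m.real 4) k s i x := by
          intro x hx
          rw [h8 x (Finset.mem_range.1 hx), setNat_real, r4]
        rw [e0, e1, e2]
        congr 1
        · congr 1
          exact Finset.sum_congr rfl fun x hx => by rw [e8 x hx]
        · congr 2
          exact Finset.sum_congr rfl fun x hx => by rw [e8 x hx]
      have g9 : m₂.real 9 0 = m'.real 9 0 := by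
        rw [hf2.2 9 (by decide), hf1.2 9 (by decide), setNat_real]
      have g9' : m₂.nat 9 0 = m'.nat 9 0 := by
        rw [hf2.1 9 (by decide), hf1.1 9 (by decide)]; simp [setNat_nat]
      have g13 : m₂.nat 13 0 = i := by
        rw [hf2.1 13 (by decide), hf1.1 13 (by decide)]; simp [setNat_nat, NatExpr.eval, hvi]
    · simp only [Test.Holds, RealExpr.eval, NatExpr.eval, g, g9] at hb
      refine ⟨?_, fun N hN => ?_, Or.inl ?_⟩
      · simp [setNat_nat, setReal_nat, NatExpr.eval, g13]
      · simp only [setNat_real, setReal_real, NatExpr.eval, RealExpr.eval, g]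
        rcases Nat.lt_succ_iff_lt_or_eq.1 hN with hN | rfl
        · simpa using (h2 N hN).trans hb.le
        · simp
      · simp [setNat_nat, setNat_real, setReal_real, setReal_nat, NatExpr.eval, RealExpr.eval, g,
          g13]
    · simp only [Test.Holds, RealExpr.eval, NatExpr.eval, g, g9, not_lt] at hb
      refine ⟨?_, fun N hN => ?_, Or.inl ?_⟩
      · simp [setNat_nat, g9']
        omega
      · simp only [setNat_real, g9]
        rcases Nat.lt_succ_iff_lt_or_eq.1 hN with hN | rfl
        · exact h2 N hN
        · exact hb
      · simp only [setNat_real, setNat_nat, g9, g9']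
        rcases h3 with h3 | ⟨-, h3⟩
        · simpa using h3
        · linarith [hV0 i]
  · rintro m' hf ⟨h1, h2, h3⟩
    rcases h3 with h3 | ⟨h3, -⟩
    · exact ⟨h1, fun N hN => h3 ▸ h2 N hN⟩
    · omega
  · simp only [NatExpr.cost, RealExpr.cost]
    have : ∀ a, (K + 1) * (a + 50 + (1 + 1) + 10) ≤ (K + 1) * (a + 100) := fun a =>
      Nat.mul_le_mul_left _ (by omega)
    exact (Nat.add_le_add_left (Nat.add_le_add_left (this _) _) _).trans (by omega)

/-- The row-major position `y * k + x` is kept as a running counter, because natural numbers cannot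
be multiplied at unit cost. -/
lemma runs_writeProg (m : Memory) (k ℓ s : ℕ) (hk : m.nat 0 0 = k) (hl : m.nat 0 1 = ℓ)
    (hs : m.nat 1 0 = s) :
    Runs writeProg m ((ℓ + 1) * ((k + 1) * 100 + 100) + 100) fun m' => ∀ y < ℓ, ∀ x < k,
      m'.real 3 (y * k + x) = if y ≤ s then (if m.nat 8 x = y then m.real 0 0 else 1)
        / (m.real 5 0 + m.real 0 0) else 0 := by
  set val : ℕ → ℕ → ℝ := fun y x => if y ≤ s then (if m.nat 8 x = y then m.real 0 0 else 1)
        / (m.real 5 0 + m.real 0 0) else 0 with hval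
  refine Runs.mono (Runs.setNat_seq (Runs.forLoop (N := ℓ)
    (fun i m' => m'.nat 12 0 = i * k ∧ ∀ y < i, ∀ x < k, m'.real 3 (y * k + x) = val y x)
    (by decide) ?_ ?_ (B := (k + 1) * 100 + 50) ?_ (fun _ _ h => h.2))) ?_
  · simp [setNat_nat, NatExpr.eval]
  · intro m' hf
    simp [NatExpr.eval, hf.1 0 (by decide), setNat_nat, hl]
  · rintro i m' hi hvi hf ⟨h1, h2⟩
    have f0 : m'.nat 0 0 = k := by rw [hf.1 0 (by decide)]; simp [setNat_nat, hk]
    have f1 : m'.nat 1 0 = s := by rw [hf.1 1 (by decide)]; simp [setNat_nat, hs]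
    have f8 : ∀ x, m'.nat 8 x = m.nat 8 x := fun x => by
      rw [hf.1 8 (by decide)]; simp [setNat_nat]
    have r0 : m'.real 0 = m.real 0 := by rw [hf.2 0 (by decide), setNat_real]
    have r5 : m'.real 5 = m.real 5 := by rw [hf.2 5 (by decide), setNat_real]
    refine Runs.mono (Runs.forLoop (N := k)
      (fun j m'' => m''.nat 12 0 = i * k + j ∧
        (∀ y < i, ∀ x < k, m''.real 3 (y * k + x) = val y x) ∧
        ∀ x < j, m''.real 3 (i * k + x) = val i x) (by decide) ?_ ?_ (B := 80) ?_ ?_) ?_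
    · refine ⟨?_, ?_, by simp⟩
      · simp [setNat_nat, h1]
      · simpa only [setNat_real] using h2
    · intro m'' hf'
      simp [NatExpr.eval, hf'.1 0 (by decide), f0]
    · rintro j m'' hj hvj hf' ⟨h3, h4, h5⟩
      have g10 : m''.nat 10 0 = i := by rw [hf'.1 10 (by decide), hvi]
      have g1 : m''.nat 1 0 = s := by rw [hf'.1 1 (by decide), f1]
      have g8 : ∀ x, m''.nat 8 x = m.nat 8 x := fun x => by rw [hf'.1 8 (by decide), f8]
      have q0 : m''.real 0 0 = m.real 0 0 := by rw [hf'.2 0 (by decide), r0]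
      have q5 : m''.real 5 0 = m.real 5 0 := by rw [hf'.2 5 (by decide), r5]
      -- Entries of earlier rows lie below position `i * k`, so they are not overwritten.
      have hne : ∀ y < i, ∀ x < k, y * k + x ≠ i * k + j := by
        intro y hy x hx
        have : (y + 1) * k ≤ i * k := Nat.mul_le_mul_right k hy
        rw [Nat.succ_mul] at this
        omega
      have hset : ∀ v, v = val i j → ∀ m₁, m₁ = m''.setReal 3 (i * k + j) v →
          Runs (assignNat 12 (.add (nvar 12) (.const 1))) m₁ 10 fun m₂ =>
            (m₂.setNat 11 0 (j + 1)).nat 12 0 = i * k + (j + 1) ∧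
            (∀ y < i, ∀ x < k, (m₂.setNat 11 0 (j + 1)).real 3 (y * k + x) = val y x) ∧
            ∀ x < j + 1, (m₂.setNat 11 0 (j + 1)).real 3 (i * k + x) = val i x := by
        rintro v rfl m₁ rfl
        refine Runs.mono (Runs.setNat ?_) (by decide)
        refine ⟨?_, fun y hy x hx => ?_, fun x hx => ?_⟩
        · simp [setNat_nat, setReal_nat, NatExpr.eval, h3, add_assoc]
        · simp only [setNat_real, setReal_real, hne y hy x hx, and_false, if_false]
          exact h4 y hy x hx
        · simp only [setNat_real, setReal_real]
          rcases Nat.lt_succ_iff_lt_or_eq.1 hx with hx | rfl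
          · have : i * k + x ≠ i * k + j := by omega
            simp only [this, and_false, if_false]
            exact h5 x hx
          · simp
      refine Runs.mono (Runs.seq (Q := fun m₁ => m₁ = m''.setReal 3 (i * k + j) (val i j))
        (Runs.ite (fun hb => Runs.setReal ?_) (fun hb =>
          Runs.ite (fun hb' => Runs.setReal ?_) (fun hb' => Runs.setReal ?_))) (B' := 10)
          fun m₁ hm₁ _ => hset _ rfl m₁ hm₁) (by decide)
      · simp only [Test.Holds, NatExpr.eval, g1, g10] at hb
        simp [NatExpr.eval, RealExpr.eval, h3, hval, not_le.2 hb]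
      · simp only [Test.Holds, NatExpr.eval, g1, g10, not_lt] at hb
        rw [natNe_holds] at hb'
        simp only [NatExpr.eval, hvj, g10, g8] at hb'
        simp [NatExpr.eval, RealExpr.eval, h3, hval, hb, hb', q0, q5]
      · simp only [Test.Holds, NatExpr.eval, g1, g10, not_lt] at hb
        rw [natNe_holds] at hb'
        simp only [NatExpr.eval, hvj, g10, g8, ne_eq, not_not] at hb'
        simp [NatExpr.eval, RealExpr.eval, h3, hval, hb, hb', q0, q5]
    · rintro m'' hf' ⟨h3, h4, h5⟩
      refine ⟨?_, fun y hy x hx => ?_⟩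
      · simp [setNat_nat, h3]
        ring
      · rw [setNat_real]
        rcases Nat.lt_succ_iff_lt_or_eq.1 hy with hy | rfl
        · exact h4 y hy x hx
        · exact h5 x hx
    · simp only [NatExpr.cost]
      omega
  · simp only [NatExpr.cost]
    have : (ℓ + 1) * ((k + 1) * 100 + 50 + (1 + 1) + 10) ≤ (ℓ + 1) * ((k + 1) * 100 + 100) :=
      Nat.mul_le_mul_left _ (by omega)
    omega

end RealRAM

/-! ## Correctness and running time of the program -/

namespace RealRAM

/-- Every choice of end points is the digit sequence of some number in base `k`, so the search over
numbers misses no family of intervals. -/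
lemma exists_candidate {k : ℕ} (n : ℕ) (c : ℕ → Fin k) :
    ∃ N < k ^ n, ∀ i < n, N / k ^ i % k = c i := by
  refine ⟨finFunctionFinEquiv fun i : Fin n => c i, Fin.is_lt _, fun i hi => ?_⟩
  have h := congrFun (finFunctionFinEquiv.symm_apply_apply fun i : Fin n => c i) ⟨i, hi⟩
  exact (congrArg Fin.val h : _)

lemma candCluster_eq {k s N : ℕ} {b : ℕ → ℝ} {β : Fin k → ℝ} (hb : ∀ x : Fin k, b x = β x)
    (c : ℕ → Fin k) (hc : ∀ i < s + s, N / k ^ i % k = c i) (x : Fin k) :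
    candCluster b k s N x = clusterOf β c s x := by
  refine lastHit_congr fun i hi => ?_
  rw [hc i (by omega), hc (s + i) (by omega), hb, hb, hb]

lemma candValue_eq {k s N : ℕ} {b : ℕ → ℝ} {β : Fin k → ℝ} (hb : ∀ x : Fin k, b x = β x)
    (c : ℕ → Fin k) (hc : ∀ i < s + s, N / k ^ i % k = c i) {p q : ℕ → ℝ} {p' q' : Fin k → ℝ}
    (hp : ∀ x : Fin k, p x = p' x) (hq : ∀ x : Fin k, q x = q' x) (L : ℝ) :
    candValue L p q b k s N = ∑ i ∈ Finset.range s,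
      clusterValue L (fun x => p' x - q' x) (fun x => p' x + q' x)
        {x | clusterOf β c s x = i} := by
  refine Finset.sum_congr rfl fun i _ => ?_
  simp only [clusterValue, Finset.sum_range, candCluster_eq hb c hc, Finset.sum_filter, hp, hq]

/-- The time from the computation of the number of candidates on. -/
def restTime (k ℓ s K : ℕ) : ℕ :=
  (s + s + 1) * ((k + 1) * 100 + 100) + 100 +
    ((K + 1) * ((s + s + 1) * ((K + 1) * 100 + 100) + 100 +
      ((k + 1) * ((s + 1) * 100 + 100) + ((s + 1) * ((k + 1) * 100 + 100) + 100)) + 100) + 100 +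
    (10 + ((s + s + 1) * ((K + 1) * 100 + 100) + 100 + ((k + 1) * ((s + 1) * 100 + 100) +
      ((ℓ + 1) * ((k + 1) * 100 + 100) + 100)))))

lemma restTime_mono (k ℓ : ℕ) {s s' K K' : ℕ} (hs : s ≤ s') (hK : K ≤ K') :
    restTime k ℓ s K ≤ restTime k ℓ s' K' := by
  unfold restTime
  gcongr

lemma runs_mainProg {k ℓ : ℕ} {p q : Fin k → ℝ} {ε : ℝ} (hp : p ∈ stdSimplex ℝ (Fin k))
    (hq : q ∈ stdSimplex ℝ (Fin k)) (hε : 0 ≤ ε) (hℓ : 1 < ℓ) (hk : 0 < k) :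
    Runs mainProg (inputMemory k ℓ ε p q)
      ((k + 1) * 100 + ((ℓ + 1) * 100 + restTime k ℓ ℓ (k ^ (ℓ + ℓ)))) fun m =>
      ∃ (s : ℕ) (c : ℕ → Fin k),
      1 ≤ s ∧ s < ℓ ∧ s ≤ 2 * (Real.exp ε - 1) + 1 ∧ (s = ℓ - 1 ∨ 2 * (Real.exp ε - 1) < s) ∧
      outputMatrix k ℓ m = responseChannel (Real.exp ε) ℓ s (clusterOf (share p q) c s) ∧
      BoundsClusters (Real.exp ε - 1) (share p q) (fun x => p x - q x) (fun x => p x + q x) s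
        (∑ i ∈ Finset.range s, clusterValue (Real.exp ε - 1) (fun x => p x - q x)
          (fun x => p x + q x) {x | clusterOf (share p q) c s x = i}) := by
  have hE := Real.one_le_exp hε
  have : Nonempty (Fin k) := ⟨⟨0, hk⟩⟩
  set m₀ := inputMemory k ℓ ε p q with hm₀
  have nk : m₀.nat 0 0 = k := by simp [hm₀, inputMemory]
  have nl : m₀.nat 0 1 = ℓ := by simp [hm₀, inputMemory]
  have rE : m₀.real 0 0 = Real.exp ε := by simp [hm₀, inputMemory]
  have rp : ∀ x : Fin k, m₀.real 1 x = p x := fun x => by simp [hm₀, inputMemory]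
  have rq : ∀ x : Fin k, m₀.real 2 x = q x := fun x => by simp [hm₀, inputMemory]
  refine Runs.seq (Runs.mono (runs_shareProg m₀) (by rw [nk])) fun m₁ h1 hf1 => ?_
  have nl1 : m₁.nat 0 1 = ℓ := by rw [hf1.1 0 (by decide), nl]
  have rE1 : m₁.real 0 0 = Real.exp ε := by rw [hf1.2 0 (by decide), rE]
  refine Runs.seq (runs_countProg m₁ ℓ nl1 hℓ (by rw [rE1]; exact hE)) fun m₂ h2 hf2 => ?_
  obtain ⟨s, hs2, hR2, hs1, hsl, hsL, hs'⟩ := h2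
  rw [rE1] at hsL hs'
  -- The number `s` is known only after this stage has run; the time bound uses `ℓ` in its place.
  refine Runs.mono ?_ (restTime_mono k ℓ hsl.le (Nat.pow_le_pow_right hk
    (show s + s ≤ ℓ + ℓ by omega)))
  have nk2 : m₂.nat 0 0 = k := by rw [hf2.1 0 (by decide), hf1.1 0 (by decide), nk]
  refine Runs.seq (runs_powProg m₂ k s nk2 hs2) fun m₃ hK hf3 => ?_
  have nk3 : m₃.nat 0 0 = k := by rw [hf3.1 0 (by decide), nk2]
  have nl3 : m₃.nat 0 1 = ℓ := by rw [hf3.1 0 (by decide), hf2.1 0 (by decide), nl1]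
  have hs3 : m₃.nat 1 0 = s := by rw [hf3.1 1 (by decide), hs2]
  have hR3 : m₃.real 5 0 = s := by rw [hf3.2 5 (by decide), hR2]
  have rE3 : m₃.real 0 0 = Real.exp ε := by
    rw [hf3.2 0 (by decide), hf2.2 0 (by decide), rE1]
  have e1 : m₃.real 1 = m₀.real 1 := by
    rw [hf3.2 1 (by decide), hf2.2 1 (by decide), hf1.2 1 (by decide)]
  have e2 : m₃.real 2 = m₀.real 2 := by
    rw [hf3.2 2 (by decide), hf2.2 2 (by decide), hf1.2 2 (by decide)]
  have e4 : ∀ x : Fin k, m₃.real 4 x = share p q x := by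
    intro x
    rw [hf3.2 4 (by decide), hf2.2 4 (by decide), h1 x (by rw [nk]; exact x.2), rp, rq]
    rfl
  have rp3 : ∀ x : Fin k, m₃.real 1 x = p x := fun x => by rw [e1, rp]
  have rq3 : ∀ x : Fin k, m₃.real 2 x = q x := fun x => by rw [e2, rq]
  refine Runs.seq (runs_searchProg m₃ k s (k ^ (s + s)) nk3 hk hs3 hK (by positivity)
    (by rw [rE3]; exact hE) (fun x hx => by rw [rp3 ⟨x, hx⟩]; exact hp.1 _)
    (fun x hx => by rw [rq3 ⟨x, hx⟩]; exact hq.1 _)) fun m₄ hbest hf4 => ?_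
  obtain ⟨hNK, hbest⟩ := hbest
  set N := m₄.nat 9 0 with hN
  have nk4 : m₄.nat 0 0 = k := by rw [hf4.1 0 (by decide), nk3]
  have hs4 : m₄.nat 1 0 = s := by rw [hf4.1 1 (by decide), hs3]
  have e4' : m₄.real 4 = m₃.real 4 := hf4.2 4 (by decide)
  refine Runs.mono (Runs.setNat_seq (runs_digits_cluster _ k s N ?_ hk ?_ ?_
    (B := (ℓ + 1) * ((k + 1) * 100 + 100) + 100) fun m₅ h5 hf5 => ?_)) ?_
  · simp [setNat_nat, nk4]
  · simp [setNat_nat, hs4]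
  · simp [setNat_nat, NatExpr.eval, hN]
  · have nk5 : m₅.nat 0 0 = k := by rw [hf5.1 0 (by decide)]; simp [setNat_nat, nk4]
    have nl5 : m₅.nat 0 1 = ℓ := by
      rw [hf5.1 0 (by decide)]; simp [setNat_nat, hf4.1 0 (by decide), nl3]
    have hs5 : m₅.nat 1 0 = s := by rw [hf5.1 1 (by decide)]; simp [setNat_nat, hs4]
    have rE5 : m₅.real 0 0 = Real.exp ε := by
      rw [hf5.2 0 (by decide), setNat_real, hf4.2 0 (by decide), rE3]
    have hR5 : m₅.real 5 0 = s := by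
      rw [hf5.2 5 (by decide), setNat_real, hf4.2 5 (by decide), hR3]
    have hc : ∀ i < s + s, N / k ^ i % k = (⟨N / k ^ i % k, Nat.mod_lt _ hk⟩ : Fin k) :=
      fun i _ => rfl
    obtain ⟨m, t, ht1, ht2, ht3⟩ := runs_writeProg m₅ k ℓ s nk5 nl5 hs5
    refine ⟨m, t, ht1, ht2, s, fun i => ⟨N / k ^ i % k, Nat.mod_lt _ hk⟩, hs1, hsl, hsL, hs',
      ?_, ?_⟩
    · ext y x
      simp only [outputMatrix, responseChannel, Matrix.of_apply]
      rw [ht3 y y.2 x x.2, h5 x x.2, setNat_real, e4', candCluster_eq e4 _ hc, rE5, hR5]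
    -- A family of intervals is dominated by some choice of end points, and this choice by the best
    -- candidate.
    · intro J S hcard hdis hconv
      obtain ⟨c, hcJ⟩ := exists_clusterOf_ge (Real.exp ε - 1) (by linarith) (share p q)
        (fun x => p x - q x) (fun x => p x + q x) (fun x => add_nonneg (hp.1 x) (hq.1 x)) s J S
        hcard hdis hconv
      obtain ⟨N', hN', hc'⟩ := exists_candidate (s + s) c
      have h := hbest N' hN'
      rw [candValue_eq e4 c hc' rp3 rq3, candValue_eq e4 _ hc rp3 rq3, rE3] at h
      exact hcJ.trans h
  · have : (s + s + 1) * ((N + 1) * 100 + 100) ≤ (s + s + 1) * ((k ^ (s + s) + 1) * 100 + 100) :=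
      Nat.mul_le_mul_left _ (by omega)
    simp only [NatExpr.cost]
    omega

/-- The numbers `k`, `ℓ` and `k ^ (2 * ℓ)` are all at most `Z = (k * ℓ) ^ ℓ ^ 2`, the last because
`2 * ℓ ≤ ℓ ^ 2`. The running time is a polynomial in them. -/
lemma time_le {k ℓ : ℕ} (hk : 0 < k) (hℓ : 1 < ℓ) :
    (k + 1) * 100 + ((ℓ + 1) * 100 + restTime k ℓ ℓ (k ^ (ℓ + ℓ)))
      ≤ 20000 * ((k * ℓ) ^ ℓ ^ 2) ^ 5 := by
  set Z := (k * ℓ) ^ ℓ ^ 2 with hZ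
  have hpos : 0 < k * ℓ := by positivity
  have h1 : 1 ≤ Z := Nat.one_le_pow _ _ hpos
  have hkl : k * ℓ ≤ Z := Nat.le_self_pow (by positivity) _
  have hkZ : k ≤ Z := (Nat.le_mul_of_pos_right k (by omega)).trans hkl
  have hlZ : ℓ ≤ Z := (Nat.le_mul_of_pos_left ℓ hk).trans hkl
  have hK : k ^ (ℓ + ℓ) ≤ Z := by
    calc k ^ (ℓ + ℓ) ≤ k ^ ℓ ^ 2 := Nat.pow_le_pow_right hk (by nlinarith)
      _ ≤ Z := Nat.pow_le_pow_left (Nat.le_mul_of_pos_right k (by omega)) _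
  have h2 : (k + 1) * 100 + ((ℓ + 1) * 100 + restTime k ℓ ℓ (k ^ (ℓ + ℓ)))
      ≤ (Z + 1) * 100 + ((Z + 1) * 100 + restTime Z Z Z Z) := by
    unfold restTime
    gcongr
  refine h2.trans ?_
  have p0 : 1 ≤ Z ^ 5 := Nat.one_le_pow _ _ h1
  have p1 : Z ≤ Z ^ 5 := Nat.le_self_pow (by norm_num) _
  have p2 : Z ^ 2 ≤ Z ^ 5 := Nat.pow_le_pow_right h1 (by norm_num)
  have p3 : Z ^ 3 ≤ Z ^ 5 := Nat.pow_le_pow_right h1 (by norm_num)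
  unfold restTime
  ring_nf
  omega

/-- Since `ℓ * log 2 ≥ 1`, the factor `ℓ ^ ℓ ^ 2 = exp (ℓ² log ℓ)` is at most `2 ^ (ℓ³ log ℓ)`. -/
lemma mul_pow_le {k ℓ : ℕ} (hℓ : 1 < ℓ) :
    (((k * ℓ) ^ ℓ ^ 2 : ℕ) : ℝ)
      ≤ (k : ℝ) ^ (ℓ ^ 2) * (2 : ℝ) ^ ((ℓ : ℝ) ^ 3 * Real.log ℓ) := by
  have hl : (2 : ℝ) ≤ ℓ := by exact_mod_cast hℓ
  push_cast
  rw [mul_pow]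
  gcongr
  rw [← Real.rpow_natCast, Real.rpow_def_of_pos (by linarith), Real.rpow_def_of_pos (by norm_num)]
  apply Real.exp_le_exp.2
  have h1 := Real.log_two_gt_d9
  have h2 : 0 ≤ Real.log ℓ := Real.log_nonneg (by linarith)
  push_cast
  have h3 : 1 ≤ Real.log 2 * ℓ := by nlinarith
  have h4 : 0 ≤ Real.log ℓ * (ℓ : ℝ) ^ 2 := by positivity
  nlinarith

end RealRAM

/-! ### Comparison of the output with all private channels, and the theorem -/

section Main

/-- The output of the program is as good, up to constants, as every private channel. -/
lemma clusters_le_triDisc {X : Type} [Fintype X] {p q : X → ℝ} (hp : p ∈ stdSimplex ℝ X)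
    (hq : q ∈ stdSimplex ℝ X) {ε L : ℝ} (hε : 0 ≤ ε) (hL : L = Real.exp ε - 1) {ℓ s : ℕ}
    (hs : s < ℓ) (hsL : s ≤ 2 * L + 1) {f : X → ℕ} (hf : ∀ x, f x ≤ s) :
    min 1 L * L * ∑ i ∈ Finset.range s,
        clusterValue L (fun x => p x - q x) (fun x => p x + q x) {x | f x = i}
      ≤ 5 * triDisc (responseChannel (Real.exp ε) ℓ s f *ᵥ p)
          (responseChannel (Real.exp ε) ℓ s f *ᵥ q) := by
  have hL0 : 0 ≤ L := by linarith [Real.one_le_exp hε]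
  have h := le_triDisc_responseChannel hp hq hε hL hs hf
  set O := ∑ i ∈ Finset.range s,
    clusterValue L (fun x => p x - q x) (fun x => p x + q x) {x | f x = i} with hO
  have hO0 : 0 ≤ O := Finset.sum_nonneg fun i _ => div_nonneg (sq_nonneg _)
    (add_nonneg zero_le_two (mul_nonneg hL0
      (Finset.sum_nonneg fun x _ => add_nonneg (hp.1 x) (hq.1 x))))
  have hE : 0 < (s : ℝ) + Real.exp ε := by positivity
  have h1 : min 1 L * L ≤ 5 * (L ^ 2 / (s + Real.exp ε)) := by
    rw [← mul_div_assoc, le_div_iff₀ hE]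
    -- This is where `s ≤ 2 * L + 1` matters: more clusters would make the normalization `s + e^ε`
    -- too large.
    have h2 : (s : ℝ) + Real.exp ε ≤ 3 * L + 2 := by linarith
    have h3 : min 1 L * (3 * L + 2) ≤ 5 * L := by
      rcases le_total 1 L with h | h
      · rw [min_eq_left h]; linarith
      · rw [min_eq_right h]; nlinarith
    calc min 1 L * L * (s + Real.exp ε) ≤ min 1 L * L * (3 * L + 2) :=
          mul_le_mul_of_nonneg_left h2 (mul_nonneg (le_min zero_le_one hL0) hL0)
      _ = L * (min 1 L * (3 * L + 2)) := by ring
      _ ≤ L * (5 * L) := mul_le_mul_of_nonneg_left h3 hL0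
      _ = _ := by ring
  calc _ ≤ 5 * (L ^ 2 / (s + Real.exp ε)) * O := mul_le_mul_of_nonneg_right h1 hO0
    _ = 5 * (L ^ 2 / (s + Real.exp ε) * O) := by ring
    _ ≤ _ := by linarith

/-- The factor `128` makes the tail `64 / 4 ^ K` at most `1 / (2n)`, half of the lower bound on the
discrimination. It is covered by `4 ^ 4 = 256`, and `e < 4` handles `n`. -/
lemma exists_level_cut {n : ℕ} (hn : 0 < n) :
    ∃ K : ℕ, 128 * (n : ℝ) ≤ 4 ^ K ∧ (K : ℝ) ≤ 5 + Real.log n := by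
  have hn' : (1 : ℝ) ≤ n := by exact_mod_cast hn
  have hlog := Real.log_nonneg hn'
  refine ⟨4 + ⌈Real.log n⌉₊, ?_, ?_⟩
  · have h1 : (n : ℝ) ≤ 4 ^ ⌈Real.log n⌉₊ := by
      calc (n : ℝ) = Real.exp (Real.log n) := (Real.exp_log (by linarith)).symm
        _ ≤ Real.exp (⌈Real.log n⌉₊) := Real.exp_le_exp.2 (Nat.le_ceil _)
        _ = Real.exp 1 ^ ⌈Real.log n⌉₊ := by rw [← Real.exp_nat_mul, mul_one]
        _ ≤ 4 ^ ⌈Real.log n⌉₊ := by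
          gcongr
          linarith [Real.exp_one_lt_d9]
    rw [pow_add]
    nlinarith
  · push_cast
    linarith [(Nat.ceil_lt_add_one hlog).le]

theorem mainTheorem9 :
    ∃ (P : RealRAM.Prog) (A C : ℕ), 0 < C ∧
      ∀ (k ℓ : ℕ) (p q : Fin k → ℝ) (ε : ℝ),
        p ∈ stdSimplex ℝ (Fin k) → q ∈ stdSimplex ℝ (Fin k) → 0 ≤ ε → 1 < ℓ →
        ∃ (m : RealRAM.Memory) (t : ℕ) (T : Matrix (Fin ℓ) (Fin k) ℝ),
          -- the algorithm halts after `t` steps with output `T`, in polynomial time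
          RealRAM.Exec P (RealRAM.inputMemory k ℓ ε p q) m t ∧
          T = RealRAM.outputMatrix k ℓ m ∧
          (t : ℝ) ≤ A * ((k : ℝ) ^ (ℓ ^ 2) * (2 : ℝ) ^ ((ℓ : ℝ) ^ 3 * Real.log ℓ)) ^ A ∧
          -- `T` is an `ε`-LDP channel from `[k]` to `[ℓ]`
          T ∈ ldpChannels (Fin k) (Fin ℓ) ε ∧
          -- its sample complexity is of the order of `n*(p, q, ε, ℓ)`
          sampleComplexity {T} p q ≤ C * nStarLDPComm p q ε ℓ ∧
          nStarLDPComm p q ε ℓ ≤ C * sampleComplexity {T} p q ∧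
          -- the bound in terms of `n*(p, q, ε)`, which says nothing if the latter is infinite
          (∀ n : ℕ, nStarLDP p q ε = n →
            ∃ N : ℕ, sampleComplexity {T} p q = N ∧
              (N : ℝ) ≤ C * (n * (1 + Real.log n / ℓ))) ∧
          -- threshold channel into `[2ℓ²]`, followed by an `ε`-LDP channel from `[2ℓ²]` to `[ℓ]`
          ∃ (T₁ : Matrix (Fin (2 * ℓ ^ 2)) (Fin k) ℝ) (T₂ : Matrix (Fin ℓ) (Fin (2 * ℓ ^ 2)) ℝ),
            IsThresholdChannel p q T₁ ∧ T₂ ∈ ldpChannels (Fin (2 * ℓ ^ 2)) (Fin ℓ) ε ∧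
            T = T₂ * T₁ := by
  -- `A` serves as factor and as exponent; it is kept opaque so that no power with this exponent is
  -- evaluated.
  obtain ⟨A, hA⟩ : ∃ A : ℕ, 20000 ≤ A := ⟨_, le_rfl⟩
  refine ⟨RealRAM.mainProg, A, 400000, by norm_num, fun k ℓ p q ε hp hq hε hℓ => ?_⟩
  have hk : 0 < k := by
    rcases Nat.eq_zero_or_pos k with rfl | h
    · simpa using hp.2
    · exact h
  have : Nonempty (Fin k) := ⟨⟨0, hk⟩⟩
  obtain ⟨m, t, hex, ht, s, c, hs1, hsl, hsL, hs', hout, hbound⟩ :=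
    RealRAM.runs_mainProg hp hq hε hℓ hk
  have hf : ∀ x, clusterOf (share p q) c s x ≤ s := fun x => lastHit_le s _
  have hT := responseChannel_mem hε hsl hf
  have hV := clusters_le_triDisc hp hq hε rfl hsl hsL hf
  set T := responseChannel (Real.exp ε) ℓ s (clusterOf (share p q) c s) with hTdef
  set D := triDisc (T *ᵥ p) (T *ᵥ q) with hD
  refine ⟨m, t, T, hex, hout.symm, ?_, hT, ?_, ?_, ?_,
    exists_threshold_factorization hp.1 hq.1 hε hsl c⟩
  · have h1 : 1 ≤ (k * ℓ) ^ ℓ ^ 2 := Nat.one_le_pow _ _ (by positivity)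
    have h2 : t ≤ A * ((k * ℓ) ^ ℓ ^ 2) ^ A :=
      (ht.trans (RealRAM.time_le hk hℓ)).trans
        (Nat.mul_le_mul hA (Nat.pow_le_pow_right h1 (by omega)))
    calc (t : ℝ) ≤ ((A * ((k * ℓ) ^ ℓ ^ 2) ^ A : ℕ) : ℝ) := by exact_mod_cast h2
      _ = (A : ℝ) * (((k * ℓ) ^ ℓ ^ 2 : ℕ) : ℝ) ^ A := by
        rw [Nat.cast_mul, Nat.cast_pow (((k * ℓ) ^ ℓ ^ 2))]
      _ ≤ _ := by
        gcongr
        exact RealRAM.mul_pow_le hℓ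
  · by_cases htop : nStarLDPComm p q ε ℓ = ⊤
    · rw [htop, ENat.mul_top (by norm_num)]
      exact le_top
    · obtain ⟨n, hn, hn'⟩ := exists_solvableWith_of_ne_top htop
      obtain ⟨hn0, T', hT', hge⟩ := exists_triDisc_ge_of_solvableWith (fun T h => h.1) hp hq hn
      have h1 := triDisc_le_of_fin hp hq hℓ hT' hε rfl hs1 hs' hbound
      have hnpos : (0 : ℝ) < n := by exact_mod_cast hn0
      -- `6360 = 1272 * 5`; since `12 * 6360 ≤ 400000`, that many times `n` users suffice.
      have h2 : 1 ≤ n * (6360 * D) := by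
        have : 1 / (n : ℝ) ≤ 6360 * D := by linarith
        rwa [div_le_iff₀' hnpos] at this
      have h3 := sampleComplexity_le (solvableWith_singleton hT.1 hp hq (n := 400000 * n) (by
        push_cast
        nlinarith))
      change _ ≤ _ * sampleComplexity _ p q
      rw [hn']
      exact_mod_cast h3
  · refine (sampleComplexity_anti (Set.singleton_subset_iff.2 hT) p q).trans ?_
    exact le_mul_of_one_le_left zero_le (by norm_num)
  · intro n hn
    obtain ⟨n', hsolv, hn'⟩ := exists_solvableWith_of_ne_top
      (C := ldpChannels (Fin k) ℕ ε) (p := p) (q := q) (by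
        change nStarLDP p q ε ≠ ⊤
        rw [hn]
        exact ENat.natCast_ne_top n)
    have hnn : n' = n := by
      have : (n' : ℕ∞) = n := hn'.symm.trans hn
      exact_mod_cast this
    subst hnn
    obtain ⟨hn0, T', hT', hge⟩ := exists_triDisc_ge_of_solvableWith (fun T h => h.1) hp hq hsolv
    obtain ⟨K, hK1, hK2⟩ := exists_level_cut hn0
    have h1 := triDisc_le_of_countable hp hq hℓ hT' hε rfl hs1 hs' hbound K
    have hnpos : (1 : ℝ) ≤ n' := by exact_mod_cast hn0
    have hl : (2 : ℝ) ≤ ℓ := by exact_mod_cast hℓ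
    have hlog := Real.log_nonneg hnpos
    have hD0 : 0 ≤ D :=
      triDisc_nonneg (hT.1.isDist_mulVec hp).1 (hT.1.isDist_mulVec hq).1
    set g := 1 + Real.log n' / ℓ with hg
    have hg1 : 1 ≤ g := by
      have : 0 ≤ Real.log n' / ℓ := by positivity
      linarith
    have hKl : 1 + (K : ℝ) / (ℓ - 1) ≤ 6 * g := by
      have h2 : (K : ℝ) / (ℓ - 1) ≤ (5 + Real.log n') / (ℓ / 2) := by
        apply div_le_div₀ (by positivity) hK2 (by positivity) (by linarith)
      have h3 : (5 + Real.log n') / (ℓ / 2) = 10 / ℓ + 2 * (Real.log n' / ℓ) := by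
        field_simp
        ring
      have h4 : (10 : ℝ) / ℓ ≤ 5 := by
        rw [div_le_iff₀ (by linarith)]
        linarith
      have : 0 ≤ Real.log n' / ℓ := by positivity
      linarith
    have htail : (64 : ℝ) / 4 ^ K ≤ 1 / n' / 2 := by
      rw [div_div, div_le_div_iff₀ (by positivity) (by positivity)]
      linarith
    -- `504 * 5 * 6 = 15120`, doubled because the tail takes up half of `1 / n'`.
    have hmain : 1 / (n' : ℝ) ≤ 30240 * (D * g) := by
      have hKl0 : 0 ≤ 1 + (K : ℝ) / (ℓ - 1) := by
        have : (0 : ℝ) ≤ K / (ℓ - 1) := div_nonneg (Nat.cast_nonneg K) (by linarith)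
        linarith
      have h2 := mul_le_mul_of_nonneg_right hV hKl0
      have h3 := mul_le_mul_of_nonneg_left hKl hD0
      linarith
    have hmain' : 1 ≤ n' * (30240 * (D * g)) := by
      rwa [div_le_iff₀' (by linarith)] at hmain
    have hDpos : 0 < D := by
      rcases hD0.eq_or_lt with h | h
      · rw [← h] at hmain'
        norm_num at hmain'
      · exact h
    -- `12 / D` users suffice up to rounding, and the extra user from rounding is covered by `1 ≤ n'
    -- * g`.
    have hsc := sampleComplexity_le (solvableWith_singleton hT.1 hp hq (n := ⌈12 / D⌉₊) (by
      have := Nat.le_ceil (12 / D)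
      rwa [div_le_iff₀ hDpos] at this))
    obtain ⟨N, -, hN⟩ := exists_solvableWith_of_ne_top
      (ne_top_of_le_ne_top (ENat.natCast_ne_top _) hsc)
    refine ⟨N, hN, ?_⟩
    rw [hN] at hsc
    have hNle : N ≤ ⌈12 / D⌉₊ := by exact_mod_cast hsc
    have h2 : (N : ℝ) ≤ 12 / D + 1 :=
      (Nat.cast_le.2 hNle).trans (Nat.ceil_lt_add_one (by positivity)).le
    have h3 : 12 / D ≤ 362880 * (n' * g) := by
      rw [div_le_iff₀ hDpos]
      linarith
    have h4 : 1 ≤ n' * g := one_le_mul_of_one_le_of_one_le hnpos hg1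
    push_cast
    linarith

end Main
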